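/- Let $0<a<b$ and let $D_r\subset\mathbb{R}^2$ denote the closed disc of radius $r$ centred at the origin. Let $\mathscr{C}_{a,b}$ be the class of convex sets $K\subseteq\mathbb{R}^2$ with $D_a\subseteq K\subseteq D_b$, and for $\lambda\in\mathbb{R}$ put $J_\lambda(K)=\lambda|K|-P(K)$, where $|K|$ is the area of $K$ and $P(K)$ its perimeter, that is, the length (one-dimensional Hausdorff measure) of $\partial K$. A set $\Omega\in\mathscr{C}_{a,b}$ is optimal if $J_\lambda(\Omega)\le J_\lambda(K)$ for all $K\in\mathscr{C}_{a,b}$. A side of $\Omega$ is a maximal nondegenerate segment contained in $\partial\Omega$. A segment is tangent to $D_a$ at its point $T$ if $|T|=a$ and the segment is orthogonal to the radius $OT$. Let $\mathscr{L}^a_b$ be the class of the nondegenerate segments $[T,Q]$ such that $Q$ is an endpoint of a side of $\Omega$ which is tangent to $D_a$ at $T$, and $Q\in\partial D_b$; let $\mathscr{L}^a$ be the class defined in the same way with $Q\notin\partial D_b$. Suppose that $\frac1{2b}<\lambda<\frac1{a+b}$ and that $\Omega$ is optimal. Then the classes $\mathscr{L}^a_b$ and $\mathscr{L}^a$ are empty,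 and no side of $\Omega$ is tangent to $D_a$. Moreover $\Omega$ is, up to its boundary points, a polygon strictly inscribed in $D_b$: the closure $\overline\Omega$ is the convex hull of finitely many points of $\partial D_b$, and every side of $\Omega$ has both endpoints on $\partial D_b$ and does not meet $D_a$. -/

import Mathlib

open MeasureTheory Metric

noncomputable section

namespace ConvexRing

/-- The Euclidean plane. -/
abbrev Plane : Type := EuclideanSpace ℝ (Fin 2)

/-- The admissible class: convex sets `K` with `D_a ⊆ K ⊆ D_b`, where `D_r` is the closed disc of
radius `r` centred at the origin. -/
def Admissible (a b : ℝ) : Set (Set Plane) :=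
  {K | Convex ℝ K ∧ closedBall (0 : Plane) a ⊆ K ∧ K ⊆ closedBall (0 : Plane) b}

/-- The area of a plane set. -/
def area (K : Set Plane) : ℝ := (volume K).toReal

/-- The perimeter of a convex plane set with interior points: the length (one-dimensional Hausdorff
measure) of its boundary. -/
def perimeter (K : Set Plane) : ℝ := (μH[1] (frontier K)).toReal

/-- The functional `J_lam(K) = lam |K| - P(K)`. -/
def J (lam : ℝ) (K : Set Plane) : ℝ := lam * area K - perimeter K

/-- `K` minimizes `J_lam` in the admissible class. -/
def IsOptimal (a b lam : ℝ) (K : Set Plane) : Prop :=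
  K ∈ Admissible a b ∧ ∀ K' ∈ Admissible a b, J lam K ≤ J lam K'

/-- `[P, Q]` is a side of `K`: a maximal nondegenerate segment contained in the boundary of `K`. -/
def IsSide (K : Set Plane) (P Q : Plane) : Prop :=
  P ≠ Q ∧ segment ℝ P Q ⊆ frontier K ∧
    ∀ P' Q' : Plane, segment ℝ P Q ⊆ segment ℝ P' Q' → segment ℝ P' Q' ⊆ frontier K →
      segment ℝ P' Q' = segment ℝ P Q

/-- The segment `[P, Q]` is tangent to `D_a` at its point `T`: it meets the circle of radius `a`
at `T`, and it is orthogonal there to the radius. -/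
def IsTangentAt (a : ℝ) (P Q T : Plane) : Prop :=
  T ∈ segment ℝ P Q ∧ ‖T‖ = a ∧ inner ℝ (Q - P) T = 0

/-- The class `L^a_b` of `K`: the segments `[T, Q]` cut from a side `[P, Q]` of `K` tangent to `D_a`
at `T` by the tangency point, with `Q` on the outer circle. The two halves of a chord are not
identified here; that identification matters only for counting elements. -/
def classLab (a b : ℝ) (K : Set Plane) : Set (Set Plane) :=
  {S | ∃ P Q T : Plane, IsSide K P Q ∧ IsTangentAt a P Q T ∧ T ≠ Q ∧ ‖Q‖ = b ∧
    S = segment ℝ T Q}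

/-- The class `L^a` of `K`: the segments `[T, Q]` cut from a side `[P, Q]` of `K` tangent to `D_a`
at `T` by the tangency point, with `Q` not on the outer circle. The two segments with a common
endpoint `Q` are not identified here; that identification matters only for counting elements. -/
def classLa (a b : ℝ) (K : Set Plane) : Set (Set Plane) :=
  {S | ∃ P Q T : Plane, IsSide K P Q ∧ IsTangentAt a P Q T ∧ T ≠ Q ∧ ‖Q‖ ≠ b ∧
    S = segment ℝ T Q}

/-- `K` is, up to its boundary points, a polygon inscribed in `D_b`: its closure is the convex hull
of finitely many points of the circle of radius `b`. -/
def IsInscribedPolygon (b : ℝ) (K : Set Plane) : Prop :=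
  ∃ V : Finset Plane, (∀ v ∈ V, ‖v‖ = b) ∧ closure K = convexHull ℝ (V : Set Plane)

end ConvexRing

end

/-! Two competitors drive the proof. Write `A` and `L` for the area and the boundary length of the
cap of `K` beyond a chord `XY`. Cutting off a cap that misses `D_a` gives `lam * A ≤ L - |XY|`
(`IsOptimal.capArea_le`). Adding a triangle `XYZ` of area `T`, where `ZX` and `ZY` support `K` and
`Z ∈ D_b`, gives `|XZ| + |YZ| - L ≤ lam * (T - A)` (`IsCorner.dist_add_dist_sub_le`). Projection
onto a convex set is 1-Lipschitz, so `L` is at most the length of a curve enclosing the cap. For a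
cap of relative height `t` this yields `L ≤ (1 - t)|XY| + t(|XZ| + |YZ|)`, while `A ≥ tT`. Hence a
corner with `Z ∉ K` satisfies `|XZ| + |YZ| - |XY| ≤ lam * T` (`IsCorner.sub_le_of_notMem`), and if
its cap may also be cut off, the cap is flat (`IsCorner.bary_nonpos_of_notMem`).

The bound `lam < 1/(a+b)`: if `K` touches `D_a`, the corner at either end of the tangent chord of
`D_b` would gain too much length, so the whole chord lies in `K` (`tangent_endpoint_mem`). A
triangle on this chord with its vertex on the outer circle gains length at a rate per unit of area
that tends to `1/(a+b)` as the vertex approaches an end of the chord, which is again too much. So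
`K` contains a disc larger than `D_a`, small corners can be both cut and added, and no extreme point
lies strictly inside `D_b` (`norm_eq_of_mem_extremePoints`).

The bound `lam > 1/(2b)`: for inscribed triangles over short arcs the same rate is close to
`1/(2b)`. Hence, beyond a short chord, `L - |XY| ≤ ρ * A` for some `ρ < lam` (`excess_nonpos`), and
the cutting inequality forces `A = 0`. Thus no short arc of the outer circle carries three points of
`K`, the extreme points are finite in number, and Krein–Milman gives the polygon. Sides end at
extreme points, and the boundary avoids `D_a`. -/

noncomputable section

namespace ConvexRing

/-! ### Barycentric coordinates and triangles -/

/-- The determinant of two plane vectors. -/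
def cross (x y : Plane) : ℝ := x 0 * y 1 - x 1 * y 0

theorem inner_eq (x y : Plane) : inner ℝ x y = x 0 * y 0 + x 1 * y 1 := by
  simp [PiLp.inner_apply, Fin.sum_univ_two, mul_comm]

theorem norm_sq_eq (x : Plane) : ‖x‖ ^ 2 = x 0 ^ 2 + x 1 ^ 2 := by
  rw [← real_inner_self_eq_norm_sq, inner_eq]; ring

/-- The rotation by a right angle. -/
def perp (x : Plane) : Plane := !₂[-x 1, x 0]

@[simp] theorem perp_zero_apply (x : Plane) : perp x 0 = -x 1 := rfl

@[simp] theorem perp_one_apply (x : Plane) : perp x 1 = x 0 := rfl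

theorem inner_perp (x y : Plane) : inner ℝ (perp x) y = cross x y := by
  rw [inner_eq, cross]; simp; ring

theorem plane_ext {x y : Plane} (h0 : x 0 = y 0) (h1 : x 1 = y 1) : x = y := by
  ext i; fin_cases i <;> assumption

/-- The barycentric coordinate of `k` relative to the vertex `Z` of the triangle `X Y Z`. -/
def bary (X Y Z k : Plane) : ℝ := cross (Y - X) (k - X) / cross (Y - X) (Z - X)

theorem cross_rotate (X Y Z : Plane) : cross (Z - Y) (X - Y) = cross (Y - X) (Z - X) := by
  simp [cross]; ring

theorem bary_sum {X Y Z : Plane} (hD : cross (Y - X) (Z - X) ≠ 0) (k : Plane) :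
    bary Y Z X k + bary Z X Y k + bary X Y Z k = 1 := by
  have h2 : cross (X - Z) (Y - Z) = cross (Y - X) (Z - X) := by simp [cross]; ring
  rw [bary, bary, bary, cross_rotate X Y Z, h2, ← add_div, ← add_div, div_eq_one_iff_eq hD]
  simp [cross]; ring

theorem bary_eq {X Y Z : Plane} (hD : cross (Y - X) (Z - X) ≠ 0) (k : Plane) :
    k = bary Y Z X k • X + bary Z X Y k • Y + bary X Y Z k • Z := by
  have h2 : cross (X - Z) (Y - Z) = cross (Y - X) (Z - X) := by simp [cross]; ring
  rw [bary, bary, bary, cross_rotate X Y Z, h2]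
  apply plane_ext <;>
  · simp only [PiLp.add_apply, PiLp.smul_apply, smul_eq_mul, div_mul_eq_mul_div]
    rw [← add_div, ← add_div, eq_div_iff hD]
    simp [cross]; ring

theorem bary_comb (X Y Z k l : Plane) {s t : ℝ} (hst : s + t = 1) :
    bary X Y Z (s • k + t • l) = s * bary X Y Z k + t * bary X Y Z l := by
  obtain rfl : s = 1 - t := by linarith
  simp only [bary]
  rw [← mul_div_assoc, ← mul_div_assoc, ← add_div]
  congr 1
  simp [cross]; ring

theorem bary_self_left (X Y Z : Plane) : bary X Y Z X = 0 := by simp [bary, cross]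

theorem bary_self_mid (X Y Z : Plane) : bary X Y Z Y = 0 := by
  simp [bary, cross]; left; ring

theorem bary_self_right {X Y Z : Plane} (hD : cross (Y - X) (Z - X) ≠ 0) : bary X Y Z Z = 1 :=
  div_self hD

theorem bary_eq_inner (X Y Z k : Plane) :
    bary X Y Z k = inner ℝ ((cross (Y - X) (Z - X))⁻¹ • perp (Y - X)) k -
      inner ℝ ((cross (Y - X) (Z - X))⁻¹ • perp (Y - X)) X := by
  rw [← inner_sub_right, real_inner_smul_left, inner_perp, bary, div_eq_inv_mul]

theorem continuous_bary (X Y Z : Plane) : Continuous (bary X Y Z) := by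
  have : bary X Y Z = fun k => inner ℝ ((cross (Y - X) (Z - X))⁻¹ • perp (Y - X)) k -
      inner ℝ ((cross (Y - X) (Z - X))⁻¹ • perp (Y - X)) X := funext (bary_eq_inner X Y Z)
  rw [this]; fun_prop

/-- The closed triangle with vertices `X`, `Y`, `Z`. -/
def tri (X Y Z : Plane) : Set Plane :=
  {k | 0 ≤ bary Y Z X k ∧ 0 ≤ bary Z X Y k ∧ 0 ≤ bary X Y Z k}

theorem isClosed_tri (X Y Z : Plane) : IsClosed (tri X Y Z) :=
  (isClosed_le continuous_const (continuous_bary _ _ _)).inter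
    ((isClosed_le continuous_const (continuous_bary _ _ _)).inter
      (isClosed_le continuous_const (continuous_bary _ _ _)))

theorem tri_subset {X Y Z : Plane} (hD : cross (Y - X) (Z - X) ≠ 0) {C : Set Plane}
    (hC : Convex ℝ C) (hX : X ∈ C) (hY : Y ∈ C) (hZ : Z ∈ C) : tri X Y Z ⊆ C := by
  rintro k ⟨hu, hv, hw⟩
  rw [bary_eq hD k]
  have hs := bary_sum hD k
  have := hC.sum_mem (t := Finset.univ) (w := ![bary Y Z X k, bary Z X Y k, bary X Y Z k])
    (z := ![X, Y, Z]) (by intro i _; fin_cases i <;> simpa) (by simp [Fin.sum_univ_three, hs])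
    (by intro i _; fin_cases i <;> simpa)
  simpa [Fin.sum_univ_three] using this

/-! ### Area of triangles and of lines -/

theorem volume_unit_triangle :
    volume {p : Plane | 0 ≤ p 0 ∧ 0 ≤ p 1 ∧ p 0 + p 1 ≤ 1} = ENNReal.ofReal (1 / 2) := by
  have hmp : MeasurePreserving
      (fun p : Plane => (MeasurableEquiv.finTwoArrow (α := ℝ))
        ((MeasurableEquiv.toLp 2 (Fin 2 → ℝ)).symm p)) volume volume :=
    (volume_preserving_finTwoArrow ℝ).comp
      (EuclideanSpace.volume_preserving_symm_measurableEquiv_toLp (Fin 2))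
  set S : Set (ℝ × ℝ) := {q | 0 ≤ q.1 ∧ 0 ≤ q.2 ∧ q.1 + q.2 ≤ 1} with hS
  have hSm : MeasurableSet S := by
    apply IsClosed.measurableSet
    exact (isClosed_le continuous_const continuous_fst).inter
      ((isClosed_le continuous_const continuous_snd).inter
        (isClosed_le (continuous_fst.add continuous_snd) continuous_const))
  have h1 : {p : Plane | 0 ≤ p 0 ∧ 0 ≤ p 1 ∧ p 0 + p 1 ≤ 1} =
      (fun p : Plane => (MeasurableEquiv.finTwoArrow (α := ℝ))
        ((MeasurableEquiv.toLp 2 (Fin 2 → ℝ)).symm p)) ⁻¹' S := rfl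
  rw [h1, hmp.measure_preimage hSm.nullMeasurableSet, Measure.volume_eq_prod,
    Measure.prod_apply hSm]
  have h2 : ∀ x : ℝ, volume (Prod.mk x ⁻¹' S) =
      (Set.Icc (0 : ℝ) 1).indicator (fun x => ENNReal.ofReal (1 - x)) x := by
    intro x
    by_cases hx : x ∈ Set.Icc (0 : ℝ) 1
    · rw [Set.indicator_of_mem hx]
      have : Prod.mk x ⁻¹' S = Set.Icc 0 (1 - x) := by
        ext y; simp only [hS, Set.mem_preimage, Set.mem_ofPred_eq, Set.mem_Icc]
        constructor
        · rintro ⟨_, h, h'⟩; exact ⟨h, by linarith⟩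
        · rintro ⟨h, h'⟩; exact ⟨hx.1, h, by linarith⟩
      rw [this, Real.volume_Icc, sub_zero]
    · rw [Set.indicator_of_notMem hx]
      have : Prod.mk x ⁻¹' S = ∅ := by
        ext y; simp only [hS, Set.mem_preimage, Set.mem_ofPred_eq, Set.mem_empty_iff_false, iff_false]
        rintro ⟨h, h', h''⟩; exact hx ⟨h, by linarith⟩
      rw [this, measure_empty]
  simp_rw [h2]
  rw [lintegral_indicator measurableSet_Icc, ← ofReal_integral_eq_lintegral_ofReal]
  · rw [integral_Icc_eq_integral_Ioc, ← intervalIntegral.integral_of_le zero_le_one]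
    congr 1
    rw [intervalIntegral.integral_sub (by simp) (by simp), integral_id]
    norm_num
  · exact (by fun_prop : Continuous fun x : ℝ => 1 - x).integrableOn_Icc
  · filter_upwards [ae_restrict_mem measurableSet_Icc] with x hx
    simpa using hx.2

theorem volume_tri {X Y Z : Plane} (hD : cross (Y - X) (Z - X) ≠ 0) :
    volume (tri X Y Z) = ENNReal.ofReal (|cross (Y - X) (Z - X)| / 2) := by
  set A : Matrix (Fin 2) (Fin 2) ℝ := !![(Y - X) 0, (Z - X) 0; (Y - X) 1, (Z - X) 1] with hA
  set b := (EuclideanSpace.basisFun (Fin 2) ℝ).toBasis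
  set f : Plane →ₗ[ℝ] Plane := Matrix.toLin b b A with hf
  have hdet : LinearMap.det f = cross (Y - X) (Z - X) := by
    rw [hf, LinearMap.det_toLin, Matrix.det_fin_two_of, cross]; ring
  have hfp : ∀ p : Plane, f p = p 0 • (Y - X) + p 1 • (Z - X) := by
    intro p
    have hp : p = p 0 • b 0 + p 1 • b 1 := by
      apply plane_ext <;> simp [b]
    conv_lhs => rw [hp]
    rw [map_add, map_smul, map_smul, hf, Matrix.toLin_self, Matrix.toLin_self]
    apply plane_ext <;> simp [b, hA, Fin.sum_univ_two]
  have himg : tri X Y Z = (fun k => X + k) '' (f '' {p : Plane | 0 ≤ p 0 ∧ 0 ≤ p 1 ∧ p 0 + p 1 ≤ 1}) := by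
    ext k
    simp only [Set.mem_image, exists_exists_and_eq_and, Set.mem_ofPred_eq]
    constructor
    · rintro ⟨hu, hv, hw⟩
      refine ⟨!₂[bary Z X Y k, bary X Y Z k], ⟨by simpa, by simpa, ?_⟩, ?_⟩
      · have := bary_sum hD k
        simp; linarith
      · rw [hfp]
        conv_rhs => rw [bary_eq hD k]
        have := bary_sum hD k
        have h3 : bary Y Z X k = 1 - bary Z X Y k - bary X Y Z k := by linarith
        rw [h3]
        apply plane_ext <;> simp <;> ring
    · rintro ⟨p, ⟨h0, h1, h2⟩, rfl⟩
      have hk : X + f p = (1 - p 0 - p 1) • X + p 0 • Y + p 1 • Z := by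
        rw [hfp]; apply plane_ext <;> simp <;> ring
      have e1 : cross (Z - Y) (X - Y) = cross (Y - X) (Z - X) := cross_rotate _ _ _
      have e2 : cross (X - Z) (Y - Z) = cross (Y - X) (Z - X) := by simp [cross]; ring
      refine ⟨?_, ?_, ?_⟩
      · have : bary Y Z X (X + f p) = 1 - p 0 - p 1 := by
          rw [bary, e1, hk, div_eq_iff hD]; simp [cross]; ring
        rw [this]; linarith
      · have : bary Z X Y (X + f p) = p 0 := by
          rw [bary, e2, hk, div_eq_iff hD]; simp [cross]; ring
        rwa [this]
      · have : bary X Y Z (X + f p) = p 1 := by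
          rw [bary, hk, div_eq_iff hD]; simp [cross]; ring
        rwa [this]
  rw [himg, Set.image_add_left, measure_preimage_add, Measure.addHaar_image_linearMap, hdet,
    volume_unit_triangle, ← ENNReal.ofReal_mul (abs_nonneg _)]
  congr 1; ring

theorem volume_line {n : Plane} (hn : n ≠ 0) (m : ℝ) : volume {k : Plane | inner ℝ n k = m} = 0 := by
  set k₀ : Plane := (m / ‖n‖ ^ 2) • n
  have h0 : inner ℝ n k₀ = m := by
    have : ‖n‖ ≠ 0 := norm_ne_zero_iff.2 hn
    rw [real_inner_smul_right, real_inner_self_eq_norm_sq]; field_simp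
  have h := Measure.addHaar_affineSubspace (volume : Measure Plane)
    (AffineSubspace.mk' k₀ (LinearMap.ker (innerₛₗ ℝ n))) (by
      intro h
      have h1 : k₀ + n ∈ AffineSubspace.mk' k₀ (LinearMap.ker (innerₛₗ ℝ n)) := by
        rw [h]; trivial
      rw [AffineSubspace.mem_mk'] at h1
      simp at h1
      exact hn h1)
  refine measure_mono_null ?_ h
  intro k hk
  rw [SetLike.mem_coe, AffineSubspace.mem_mk']
  simp only [vsub_eq_sub, LinearMap.mem_ker, innerₛₗ_apply_apply, inner_sub_right, h0]
  rw [Set.mem_ofPred_eq] at hk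
  linarith

/-! ### Supporting lines, nearest-point projection and monotonicity of perimeter -/

theorem exists_normal {K : Set Plane} (hc : Convex ℝ K) (hi : (interior K).Nonempty) {x : Plane}
    (hx : x ∈ frontier K) : ∃ n : Plane, n ≠ 0 ∧ ∀ k ∈ K, inner ℝ n k ≤ inner ℝ n x := by
  obtain ⟨f, hf⟩ := geometric_hahn_banach_open_point hc.interior isOpen_interior
    (fun h => hx.2 h)
  refine ⟨(InnerProductSpace.toDual ℝ Plane).symm f, ?_, ?_⟩
  · rintro h
    obtain ⟨o, ho⟩ := hi
    have : f = 0 := by simpa using h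
    have h2 := hf o ho
    simp [this] at h2
  · intro k hk
    simp only [InnerProductSpace.toDual_symm_apply]
    have hk' : k ∈ closure (interior K) := by
      rw [hc.closure_interior_eq_closure_of_nonempty_interior hi]; exact subset_closure hk
    have hcl : IsClosed {y | f y ≤ f x} := isClosed_le f.continuous continuous_const
    exact closure_minimal (fun y hy => (hf y hy).le) hcl hk'

/-- Adding the variational inequalities of two projected points and applying Cauchy–Schwarz gives
the Lipschitz bound. A boundary point displaced along an outward normal satisfies the variational
inequality at its starting point, so it projects back there. -/
theorem exists_nearest_point_map {K : Set Plane} (hc : Convex ℝ K) (hcl : IsClosed K)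
    (hne : K.Nonempty) : ∃ π : Plane → Plane, LipschitzWith 1 π ∧
      ∀ x ∈ K, ∀ n : Plane, (∀ k ∈ K, inner ℝ n k ≤ inner ℝ n x) → π (x + n) = x := by
  have h1 : ∀ y : Plane, ∃ v ∈ K, ∀ w ∈ K, inner ℝ (y - v) (w - v) ≤ 0 := fun y => by
    obtain ⟨v, hv, h⟩ := exists_norm_eq_iInf_of_complete_convex hne hcl.isComplete hc y
    exact ⟨v, hv, (norm_eq_iInf_iff_real_inner_le_zero hc hv).1 h⟩
  choose π hπ hin using h1
  have key : ∀ y z : Plane, ∀ v ∈ K, (∀ w ∈ K, inner ℝ (z - v) (w - v) ≤ 0) →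
      ‖π y - v‖ ≤ ‖y - z‖ := by
    intro y z v hv hz
    have a := hin y v hv
    have b := hz (π y) (hπ y)
    have c : ‖π y - v‖ ^ 2 ≤ inner ℝ (y - z) (π y - v) := by
      rw [← real_inner_self_eq_norm_sq]
      have e1 : inner ℝ (π y - v) (π y - v) - inner ℝ (y - z) (π y - v) =
          inner ℝ (y - π y) (v - π y) + inner ℝ (z - v) (π y - v) := by
        simp only [inner_sub_left, inner_sub_right]; ring
      linarith
    have d := real_inner_le_norm (y - z) (π y - v)
    by_contra! h
    nlinarith [norm_nonneg (y - z), norm_nonneg (π y - v)]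
  refine ⟨π, LipschitzWith.of_dist_le_mul fun y z => ?_, fun x hx n hn => ?_⟩
  · simpa [dist_eq_norm] using key y z (π z) (hπ z) (hin z)
  · have := key (x + n) (x + n) x hx (fun w hw => by
      rw [add_sub_cancel_left, inner_sub_right]; linarith [hn w hw])
    simpa [sub_eq_zero] using this

/-- Otherwise the parameters of interior points would be open and closed in the half-line, hence all
of it, against boundedness. -/
theorem exists_ray_mem_frontier {B : Set Plane} (hB : Bornology.IsBounded B) {x n : Plane}
    (hx : x ∈ B) (hn : n ≠ 0) : ∃ t : ℝ, 0 ≤ t ∧ x + t • n ∈ frontier B := by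
  obtain ⟨r, hr⟩ := hB.subset_closedBall x
  have hn' : 0 < ‖n‖ := norm_pos_iff.2 hn
  have hf : Continuous fun t : ℝ => x + t • n := by fun_prop
  by_contra! h
  set s : Set ℝ := {t | x + t • n ∈ interior B}
  have hs : Set.Ici (0 : ℝ) ⊆ s := by
    refine isPreconnected_Ici.subset_of_closure_inter_subset (isOpen_interior.preimage hf)
      ⟨0, Set.self_mem_Ici, ?_⟩ ?_
    · have := h 0 le_rfl
      simp only [zero_smul, add_zero] at this
      change x + (0 : ℝ) • n ∈ interior B
      rw [zero_smul, add_zero]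
      by_contra h'
      exact this ⟨subset_closure hx, h'⟩
    · rintro t ⟨ht, ht0⟩
      by_contra h'
      refine h t ht0 ⟨?_, h'⟩
      have h3 : t ∈ closure ((fun t : ℝ => x + t • n) ⁻¹' B) :=
        closure_mono (Set.preimage_mono interior_subset) ht
      exact map_mem_closure (f := fun t : ℝ => x + t • n) hf h3 (fun _ h => h)
  have h4 : (|r| + 1) / ‖n‖ ∈ s := hs (Set.mem_Ici.2 (by positivity))
  have h5 := hr (interior_subset h4)
  rw [mem_closedBall, dist_eq_norm, add_sub_cancel_left, norm_smul, Real.norm_eq_abs,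
    abs_of_nonneg (by positivity), div_mul_cancel₀ _ hn'.ne'] at h5
  linarith [le_abs_self r]

/-- The outward normal at a boundary point of `K` meets the frontier of `B` at a point that projects
back. Together with the Lipschitz bound this is monotonicity of the perimeter under inclusion. -/
theorem frontier_subset_image_nearest {K B S : Set Plane} {π : Plane → Plane} (hc : Convex ℝ K)
    (hi : (interior K).Nonempty) (hcl : IsClosed K)
    (hπ : ∀ x ∈ K, ∀ n : Plane, (∀ k ∈ K, inner ℝ n k ≤ inner ℝ n x) → π (x + n) = x)
    (hB : Bornology.IsBounded B) (hKB : K ⊆ B) (hS : frontier B ⊆ S) : frontier K ⊆ π '' S := by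
  intro x hx
  obtain ⟨n, hn, hnK⟩ := exists_normal hc hi hx
  have hxK := hcl.frontier_subset hx
  obtain ⟨t, ht, hy⟩ := exists_ray_mem_frontier hB (hKB hxK) hn
  refine ⟨_, hS hy, hπ x hxK _ fun k hk => ?_⟩
  rw [real_inner_smul_left, real_inner_smul_left]
  exact mul_le_mul_of_nonneg_left (hnK k hk) ht

/-! ### Arcs of circles and the length comparison for caps -/

/-- The point of the unit circle with argument `t`. -/
def dir (t : ℝ) : Plane := !₂[Real.cos t, Real.sin t]

@[simp] theorem dir_zero_apply (t : ℝ) : dir t 0 = Real.cos t := rfl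

@[simp] theorem dir_one_apply (t : ℝ) : dir t 1 = Real.sin t := rfl

theorem inner_dir (s t : ℝ) : inner ℝ (dir s) (dir t) = Real.cos (s - t) := by
  rw [inner_eq, Real.cos_sub]; simp

@[simp] theorem norm_dir (t : ℝ) : ‖dir t‖ = 1 := by
  rw [← sq_eq_sq₀ (norm_nonneg _) zero_le_one, norm_sq_eq]
  simp

theorem norm_dir_sub (s t : ℝ) : ‖dir s - dir t‖ = 2 * |Real.sin ((s - t) / 2)| := by
  rw [← sq_eq_sq₀ (norm_nonneg _) (by positivity), mul_pow, sq_abs, norm_sub_sq_real, inner_dir]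
  have := Real.cos_sq_add_sin_sq ((s - t) / 2)
  have h2 : Real.cos (s - t) = 2 * Real.cos ((s - t) / 2) ^ 2 - 1 := by
    rw [← Real.cos_two_mul]; ring_nf
  simp only [norm_dir]; rw [h2]; linarith

theorem exists_dir_eq {x : Plane} (hx : ‖x‖ = 1) : ∃ t, x = dir t := by
  have h : x 0 ^ 2 + x 1 ^ 2 = 1 := by rw [← norm_sq_eq, hx]; norm_num
  have hz : ‖(⟨x 0, x 1⟩ : ℂ)‖ = 1 := by
    rw [← sq_eq_sq₀ (norm_nonneg _) zero_le_one, Complex.sq_norm, Complex.normSq_apply]; simp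
    linarith
  have hz0 : (⟨x 0, x 1⟩ : ℂ) ≠ 0 := norm_ne_zero_iff.1 (by rw [hz]; norm_num)
  refine ⟨Complex.arg ⟨x 0, x 1⟩, plane_ext ?_ ?_⟩
  · rw [dir_zero_apply, Complex.cos_arg hz0, hz, div_one]
  · rw [dir_one_apply, Complex.sin_arg, hz, div_one]

theorem hausdorffMeasure_arc_le {b : ℝ} (hb : 0 ≤ b) (s t : ℝ) :
    μH[1] ((fun φ => b • dir φ) '' Set.Icc s t) ≤ ENNReal.ofReal (b * (t - s)) := by
  have hL : LipschitzWith b.toNNReal (fun φ => b • dir φ) := by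
    refine LipschitzWith.of_dist_le_mul fun x y => ?_
    rw [dist_eq_norm, ← smul_sub, norm_smul, norm_dir_sub, Real.coe_toNNReal _ hb,
      Real.norm_eq_abs, abs_of_nonneg hb, Real.dist_eq]
    have h1 : |Real.sin ((x - y) / 2)| ≤ |(x - y) / 2| := Real.abs_sin_le_abs
    rw [abs_div, abs_two] at h1
    exact mul_le_mul_of_nonneg_left (by linarith) hb
  refine (hL.hausdorffMeasure_image_le zero_le_one _).trans ?_
  rw [hausdorffMeasure_real, Real.volume_Icc, ENNReal.rpow_one,
    ENNReal.ofReal_mul hb]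
  rfl

/-- Taking the argument within `π` of a chosen centre keeps it in a range where the cosine of its
distance to the centre is monotone; later the centre is the midpoint of an arc. -/
theorem exists_dir_eq_near {b : ℝ} (hb : 0 < b) {x : Plane} (hx : ‖x‖ = b) (c : ℝ) :
    ∃ t, x = b • dir t ∧ |t - c| ≤ Real.pi := by
  obtain ⟨t, ht⟩ := exists_dir_eq (x := b⁻¹ • x) (by
    rw [norm_smul, hx, norm_inv, Real.norm_eq_abs, abs_of_pos hb, inv_mul_cancel₀ hb.ne'])
  refine ⟨toIocMod Real.two_pi_pos (c - Real.pi) t, ?_, ?_⟩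
  · have h : dir (toIocMod Real.two_pi_pos (c - Real.pi) t) = dir t := by
      have h : toIocMod Real.two_pi_pos (c - Real.pi) t =
          t - toIocDiv Real.two_pi_pos (c - Real.pi) t * (2 * Real.pi) := by
        rw [← self_sub_toIocDiv_zsmul, zsmul_eq_mul]
      rw [h]
      apply plane_ext
      · simp only [dir_zero_apply, Real.cos_sub_int_mul_two_pi]
      · simp only [dir_one_apply, Real.sin_sub_int_mul_two_pi]
    rw [h, ← ht, smul_smul, mul_inv_cancel₀ hb.ne', one_smul]
  · have := toIocMod_mem_Ioc Real.two_pi_pos (c - Real.pi) t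
    exact abs_le.2 ⟨by linarith [this.1], by linarith [this.2]⟩

theorem sphere_subset_arc (b : ℝ) (hb : 0 < b) :
    sphere (0 : Plane) b ⊆ (fun φ => b • dir φ) '' Set.Icc (-Real.pi) Real.pi := by
  intro x hx
  obtain ⟨t, rfl, ht⟩ := exists_dir_eq_near hb (mem_sphere_zero_iff_norm.1 hx) 0
  rw [sub_zero] at ht
  exact ⟨t, abs_le.1 ht, rfl⟩

/-- Perimeters are read through `toReal`, which would send an infinite length to `0`; this excludes
that case. -/
theorem hausdorffMeasure_frontier_lt_top {K : Set Plane} {b : ℝ} (hb : 0 < b) (hc : Convex ℝ K)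
    (hcl : IsClosed K) (hi : (interior K).Nonempty) (hKb : K ⊆ closedBall 0 b) :
    μH[1] (frontier K) < ⊤ := by
  obtain ⟨π, hπ, hπn⟩ := exists_nearest_point_map hc hcl (hi.mono interior_subset)
  have h1 : frontier K ⊆ π '' ((fun φ => b • dir φ) '' Set.Icc (-Real.pi) Real.pi) :=
    frontier_subset_image_nearest hc hi hcl hπn isBounded_closedBall hKb
      (by rw [frontier_closedBall _ hb.ne']; exact sphere_subset_arc b hb)
  refine (measure_mono h1).trans_lt ((hπ.hausdorffMeasure_image_le zero_le_one _).trans_lt ?_)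
  simp only [ENNReal.coe_one, ENNReal.one_rpow, one_mul]
  exact (hausdorffMeasure_arc_le hb.le _ _).trans_lt ENNReal.ofReal_lt_top

/-- The boundary arc of a closed convex set in a half-plane is not longer than a curve which,
together with the chord, bounds a region containing the cap. -/
theorem hausdorffMeasure_cap_le {K B S : Set Plane} (hc : Convex ℝ K) (hcl : IsClosed K)
    (hi : (interior K).Nonempty) {n X Y p o : Plane} {m : ℝ} (hB : Bornology.IsBounded B)
    (hKB : ∀ k ∈ K, m ≤ inner ℝ n k → k ∈ B) (hS : frontier B ⊆ S ∪ segment ℝ X Y)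
    (hX : X ∈ K) (hY : Y ∈ K) (hXS : X ∈ S) (hYS : Y ∈ S) (hXY : X ≠ Y) (hnX : inner ℝ n X = m)
    (hnY : inner ℝ n Y = m) (hp : p ∈ K) (hnp : m < inner ℝ n p) (ho : o ∈ K)
    (hno : inner ℝ n o < m) :
    μH[1] (frontier K ∩ {k | m ≤ inner ℝ n k}) ≤ μH[1] S := by
  obtain ⟨π, hπ, hπn⟩ := exists_nearest_point_map hc hcl (hi.mono interior_subset)
  suffices h : frontier K ∩ {k | m ≤ inner ℝ n k} ⊆ π '' S by
    refine (measure_mono h).trans ((hπ.hausdorffMeasure_image_le zero_le_one _).trans ?_)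
    simp
  rintro x ⟨hx, hxm⟩
  obtain ⟨ν, hν, hνK⟩ := exists_normal hc hi hx
  have hxK := hcl.frontier_subset hx
  obtain ⟨t, ht, hy⟩ := exists_ray_mem_frontier hB (hKB x hxK hxm) hν
  rcases hS hy with hy | hy
  · refine ⟨_, hy, hπn x hxK _ fun k hk => ?_⟩
    rw [real_inner_smul_left, real_inner_smul_left]
    exact mul_le_mul_of_nonneg_left (hνK k hk) ht
  -- The point reached lies on the chord, hence in `K`, and the supporting inequality then forces `t
  -- = 0`: `x` itself is on the chord.
  · have h1 := hνK _ (hc.segment_subset hX hY hy)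
    rw [inner_add_right, real_inner_smul_right, real_inner_self_eq_norm_sq] at h1
    have h2 : 0 < ‖ν‖ ^ 2 := by have := norm_pos_iff.2 hν; positivity
    have h3 : t = 0 := by nlinarith
    rw [h3, zero_smul, add_zero] at hy
    have hπx : π x = x := by simpa using hπn x hxK 0 (by simp)
    rw [← insert_endpoints_openSegment] at hy
    rcases hy with rfl | rfl | hy
    · exact ⟨_, hXS, hπx⟩
    · exact ⟨_, hYS, hπx⟩
    -- At an inner point of the chord the normal `ν` is orthogonal to the chord, hence parallel to
    -- `n`; but `p` and `o` lie strictly on opposite sides of the chord's line.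
    · exfalso
      obtain ⟨s, r, hs, hr, hsr, rfl⟩ := hy
      have a1 := hνK X hX
      have a2 := hνK Y hY
      have a3 := hνK p hp
      have a4 := hνK o ho
      simp only [inner_add_right, real_inner_smul_right] at a1 a2 a3 a4
      have e1 : inner ℝ ν X = inner ℝ ν Y := by
        obtain rfl : s = 1 - r := by linarith
        apply le_antisymm <;> nlinarith
      have hd : X - Y ≠ 0 := sub_ne_zero.2 hXY
      have e2 : ν 0 * (X - Y) 0 + ν 1 * (X - Y) 1 = 0 := by
        rw [← inner_eq, inner_sub_right, e1, sub_self]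
      have e3 : n 0 * (X - Y) 0 + n 1 * (X - Y) 1 = 0 := by
        rw [← inner_eq, inner_sub_right, hnX, hnY, sub_self]
      have e4 : ν 0 * n 1 = ν 1 * n 0 := by
        by_contra hne
        apply hd
        have hne' : ν 0 * n 1 - ν 1 * n 0 ≠ 0 := sub_ne_zero.2 hne
        apply plane_ext
        · refine (mul_eq_zero.1 (?_ : (ν 0 * n 1 - ν 1 * n 0) * _ = 0)).resolve_left hne'
          linear_combination n 1 * e2 - ν 1 * e3
        · refine (mul_eq_zero.1 (?_ : (ν 0 * n 1 - ν 1 * n 0) * _ = 0)).resolve_left hne'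
          linear_combination ν 0 * e3 - n 0 * e2
      have e5 : s * inner ℝ ν X + r * inner ℝ ν Y = inner ℝ ν X := by
        rw [← e1, ← add_mul, hsr, one_mul]
      rw [e5] at a3 a4
      have b3 : inner ℝ ν (p - X) ≤ 0 := by rw [inner_sub_right]; linarith
      have b4 : inner ℝ ν (o - X) ≤ 0 := by rw [inner_sub_right]; linarith
      have c3 : 0 < inner ℝ n (p - X) := by rw [inner_sub_right]; linarith
      have c4 : inner ℝ n (o - X) < 0 := by rw [inner_sub_right]; linarith
      have hn0 : 0 < n 0 ^ 2 + n 1 ^ 2 := by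
        rw [← norm_sq_eq]
        have : n ≠ 0 := by rintro rfl; simp at c3
        have := norm_pos_iff.2 this
        positivity
      set c := (ν 0 * n 0 + ν 1 * n 1) / (n 0 ^ 2 + n 1 ^ 2) with hcdef
      have hνn : ν = c • n := by
        apply plane_ext
        · simp only [PiLp.smul_apply, smul_eq_mul, hcdef, div_mul_eq_mul_div, eq_div_iff hn0.ne']
          linear_combination n 1 * e4
        · simp only [PiLp.smul_apply, smul_eq_mul, hcdef, div_mul_eq_mul_div, eq_div_iff hn0.ne']
          linear_combination (-n 0) * e4
      rw [hνn, real_inner_smul_left] at b3 b4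
      have : c = 0 := by apply le_antisymm <;> nlinarith
      exact hν (by rw [hνn, this, zero_smul])

theorem notMem_interior_of_ray {S : Set Plane} {x d : Plane} (h : ∀ t : ℝ, 0 < t → x + t • d ∉ S) :
    x ∉ interior S := by
  intro hx
  have hf : Filter.Tendsto (fun t : ℝ => x + t • d) (nhdsWithin 0 (Set.Ioi 0)) (nhds x) := by
    have : Continuous fun t : ℝ => x + t • d := by fun_prop
    have := this.tendsto 0
    rw [zero_smul, add_zero] at this
    exact this.mono_left nhdsWithin_le_nhds
  have h1 := hf.eventually (mem_interior_iff_mem_nhds.1 hx)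
  obtain ⟨t, ht, ht0⟩ := (h1.and self_mem_nhdsWithin).exists
  exact h t ht0 ht

theorem frontier_inter_eq_of_inter_eq {S S' U : Set Plane} (hU : IsOpen U) (h : S ∩ U = S' ∩ U) :
    frontier S ∩ U = frontier S' ∩ U := by
  rw [← frontier_inter_open_inter hU, h, frontier_inter_open_inter hU]

/-! ### Corners, caps and the two competitors -/

/-- The triangle `X Y Z` is cut off by the two lines through `Z` which support `K` at `X` and
at `Y`, and `K` is not contained in it. -/
structure IsCorner (K : Set Plane) (X Y Z : Plane) : Prop where
  left_mem : X ∈ K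
  right_mem : Y ∈ K
  cross_ne : cross (Y - X) (Z - X) ≠ 0
  left_nonneg : ∀ k ∈ K, 0 ≤ bary Y Z X k
  right_nonneg : ∀ k ∈ K, 0 ≤ bary Z X Y k
  exists_neg : ∃ o ∈ K, bary X Y Z o < 0

/-- The length of the boundary of `K` in a closed half-plane. -/
def capLength (K : Set Plane) (n : Plane) (m : ℝ) : ℝ :=
  (μH[1] (frontier K ∩ {k | m ≤ inner ℝ n k})).toReal

/-- The area of `K` in an open half-plane. -/
def capArea (K : Set Plane) (n : Plane) (m : ℝ) : ℝ := (volume (K ∩ {k | m < inner ℝ n k})).toReal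

section Optimal

variable {a b lam : ℝ} {K : Set Plane}

theorem IsOptimal.convex (hK : IsOptimal a b lam K) : Convex ℝ K := hK.1.1

theorem interior_nonempty_of_admissible (ha : 0 < a) (hK : K ∈ Admissible a b) :
    (interior K).Nonempty :=
  ⟨0, interior_mono hK.2.1 (ball_subset_interior_closedBall (mem_ball_self ha))⟩

theorem perimeter_lt_top (ha : 0 < a) (hb : 0 < b) (hK : K ∈ Admissible a b) (hcl : IsClosed K) :
    μH[1] (frontier K) < ⊤ :=
  hausdorffMeasure_frontier_lt_top hb hK.1 hcl (interior_nonempty_of_admissible ha hK) hK.2.2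

theorem volume_lt_top_of_admissible (hK : K ∈ Admissible a b) : volume K < ⊤ :=
  (isBounded_closedBall.subset hK.2.2).measure_lt_top

/-- The line itself is counted with the cap, so that the chord created by a cut belongs to the cap,
while the rest of the boundary lies in an open half-plane, where cutting or adding changes nothing.
-/
theorem perimeter_eq_add_capLength (ha : 0 < a) (hb : 0 < b) (hK : K ∈ Admissible a b)
    (hcl : IsClosed K) (n : Plane) (m : ℝ) :
    perimeter K = (μH[1] (frontier K ∩ {k | inner ℝ n k < m})).toReal + capLength K n m := by
  have hlt := perimeter_lt_top ha hb hK hcl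
  have hm : MeasurableSet {k : Plane | inner ℝ n k < m} :=
    (isOpen_lt (by fun_prop) continuous_const).measurableSet
  have h := measure_inter_add_sdiff (μ := (μH[1] : Measure Plane)) (frontier K) hm
  have hd : frontier K \ {k : Plane | inner ℝ n k < m} = frontier K ∩ {k | m ≤ inner ℝ n k} := by
    ext k; simp [not_lt]
  rw [hd] at h
  rw [perimeter, capLength, ← h, ENNReal.toReal_add]
  · exact ((measure_mono Set.inter_subset_left).trans_lt hlt).ne
  · exact ((measure_mono Set.inter_subset_left).trans_lt hlt).ne

/-- Here the line goes to the other side, so that the remaining part is exactly the set left after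
cutting. -/
theorem area_eq_add_capArea (hK : K ∈ Admissible a b) (n : Plane) (m : ℝ) :
    area K = (volume (K ∩ {k | inner ℝ n k ≤ m})).toReal + capArea K n m := by
  have hlt := volume_lt_top_of_admissible hK
  have hm : MeasurableSet {k : Plane | inner ℝ n k ≤ m} :=
    (isClosed_le (by fun_prop) continuous_const).measurableSet
  have h := measure_inter_add_sdiff (μ := (volume : Measure Plane)) K hm
  have hd : K \ {k : Plane | inner ℝ n k ≤ m} = K ∩ {k | m < inner ℝ n k} := by
    ext k; simp [not_le]
  rw [hd] at h
  rw [area, capArea, ← h, ENNReal.toReal_add]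
  · exact ((measure_mono Set.inter_subset_left).trans_lt hlt).ne
  · exact ((measure_mono Set.inter_subset_left).trans_lt hlt).ne

/-- Cutting off a cap does not decrease the functional. -/
theorem IsOptimal.capArea_le (ha : 0 < a) (hb : 0 < b) (hK : IsOptimal a b lam K)
    (hcl : IsClosed K) {n X Y : Plane} {m : ℝ} (hn : n ≠ 0) (hX : X ∈ K) (hY : Y ∈ K)
    (hnX : inner ℝ n X = m) (hnY : inner ℝ n Y = m)
    (hna : ∀ k ∈ closedBall (0 : Plane) a, inner ℝ n k ≤ m) :
    lam * capArea K n m ≤ capLength K n m - dist X Y := by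
  set K' := K ∩ {k | inner ℝ n k ≤ m} with hK'
  have hcl' : IsClosed K' := hcl.inter (isClosed_le (by fun_prop) continuous_const)
  have hconv : Convex ℝ {k : Plane | inner ℝ n k ≤ m} :=
    convex_halfSpace_le (innerₛₗ ℝ n).isLinear m
  have hadm : K' ∈ Admissible a b := ⟨hK.convex.inter hconv,
    fun k hk => ⟨hK.1.2.1 hk, hna k hk⟩, fun k hk => hK.1.2.2 hk.1⟩
  have h := hK.2 K' hadm
  have harea := area_eq_add_capArea hK.1 n m
  have hper := perimeter_eq_add_capLength ha hb hK.1 hcl n m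
  have hper' := perimeter_eq_add_capLength ha hb hadm hcl' n m
  have hU : IsOpen {k : Plane | inner ℝ n k < m} := isOpen_lt (by fun_prop) continuous_const
  have hfr : frontier K' ∩ {k | inner ℝ n k < m} = frontier K ∩ {k | inner ℝ n k < m} := by
    apply frontier_inter_eq_of_inter_eq hU
    ext k; simp only [hK', Set.mem_inter_iff, Set.mem_ofPred_eq]
    exact ⟨fun h => ⟨h.1.1, h.2⟩, fun h => ⟨⟨h.1, h.2.le⟩, h.2⟩⟩
  have hseg : segment ℝ X Y ⊆ frontier K' ∩ {k | m ≤ inner ℝ n k} := by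
    intro k hk
    have hkm : inner ℝ n k = m := by
      obtain ⟨s, t, _, _, hst, rfl⟩ := hk
      rw [inner_add_right, real_inner_smul_right, real_inner_smul_right, hnX, hnY, ← add_mul, hst,
        one_mul]
    have hkK : k ∈ K' := ⟨hK.convex.segment_subset hX hY hk, hkm.le⟩
    refine ⟨⟨subset_closure hkK, notMem_interior_of_ray (d := n) fun t ht h => ?_⟩, hkm.ge⟩
    have h2 := h.2
    rw [Set.mem_ofPred_eq, inner_add_right, hkm, real_inner_smul_right,
      real_inner_self_eq_norm_sq] at h2
    have := norm_pos_iff.2 hn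
    have : 0 < t * ‖n‖ ^ 2 := by positivity
    linarith
  have hlen : dist X Y ≤ capLength K' n m := by
    rw [capLength, dist_edist, ← hausdorffMeasure_segment]
    exact ENNReal.toReal_mono ((measure_mono Set.inter_subset_left).trans_lt
      (perimeter_lt_top ha hb hadm hcl')).ne (measure_mono hseg)
  rw [hfr] at hper'
  change lam * area K - perimeter K ≤ lam * area K' - perimeter K' at h
  rw [harea, hper, hper', mul_add] at h
  have : area K' = (volume (K ∩ {k | inner ℝ n k ≤ m})).toReal := rfl
  rw [this] at h
  linarith

/-- The normal vector of the line `X Y` for which the coordinate of `Z` is `1`. -/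
def sideNormal (X Y Z : Plane) : Plane := (cross (Y - X) (Z - X))⁻¹ • perp (Y - X)

theorem bary_eq_sideNormal (X Y Z k : Plane) :
    bary X Y Z k = inner ℝ (sideNormal X Y Z) k - inner ℝ (sideNormal X Y Z) X :=
  bary_eq_inner X Y Z k

namespace IsCorner

variable {X Y Z : Plane}

theorem ne_left_right (h : IsCorner K X Y Z) : X ≠ Y := by
  rintro rfl; exact h.cross_ne (by simp [cross])

theorem sideNormal_ne (h : IsCorner K X Y Z) : sideNormal X Y Z ≠ 0 := by
  intro h0
  have h1 := bary_self_right h.cross_ne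
  rw [bary_eq_sideNormal, h0] at h1
  simp at h1

theorem inner_right (X Y Z : Plane) :
    inner ℝ (sideNormal X Y Z) Y = inner ℝ (sideNormal X Y Z) X := by
  have := bary_self_mid X Y Z
  rw [bary_eq_sideNormal] at this
  linarith

/-- A segment from a point of `K` below `XY` to a point of the triangle keeps its coordinates at `X`
and `Y` nonnegative, so it crosses the line `XY` inside the segment `XY`. Up to the crossing it
stays in `K`, afterwards in the triangle. -/
theorem convex_union (hc : Convex ℝ K) (h : IsCorner K X Y Z) : Convex ℝ (K ∪ tri X Y Z) := by
  have hD := h.cross_ne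
  have hseg : ∀ x, 0 ≤ bary Y Z X x → 0 ≤ bary Z X Y x → bary X Y Z x = 0 → x ∈ K := by
    intro x h1 h2 h3
    have hs := bary_sum hD x
    rw [bary_eq hD x, h3, zero_smul, add_zero]
    exact hc h.left_mem h.right_mem h1 h2 (by linarith)
  have hconvT : Convex ℝ (tri X Y Z) := by
    rintro x ⟨x1, x2, x3⟩ y ⟨y1, y2, y3⟩ s t hs ht hst
    refine ⟨?_, ?_, ?_⟩ <;> rw [bary_comb _ _ _ _ _ hst] <;> positivity
  have main : ∀ p ∈ K, ∀ z ∈ tri X Y Z, ∀ s t : ℝ, 0 ≤ s → 0 ≤ t → s + t = 1 →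
      s • p + t • z ∈ K ∪ tri X Y Z := by
    intro p hp z hz s t hs ht hst
    have hu := h.left_nonneg p hp
    have hv := h.right_nonneg p hp
    by_cases hw : 0 ≤ bary X Y Z p
    · exact Or.inr (hconvT ⟨hu, hv, hw⟩ hz hs ht hst)
    push Not at hw
    obtain ⟨z1, z2, z3⟩ := hz
    by_cases hr : 0 ≤ bary X Y Z (s • p + t • z)
    · refine Or.inr ⟨?_, ?_, hr⟩ <;> rw [bary_comb _ _ _ _ _ hst] <;> positivity
    push Not at hr
    rw [bary_comb _ _ _ _ _ hst] at hr
    left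
    have hden : 0 < bary X Y Z z - bary X Y Z p := by linarith
    -- The parameter at which the segment from `p` to `z` crosses the line `XY`.
    set τ := -bary X Y Z p / (bary X Y Z z - bary X Y Z p) with hτ
    have hτ0 : 0 < τ := div_pos (by linarith) hden
    have hτ1 : τ ≤ 1 := by rw [hτ, div_le_one hden]; linarith
    have hτe : τ * (bary X Y Z z - bary X Y Z p) = -bary X Y Z p := div_mul_cancel₀ _ hden.ne'
    have hq : (1 - τ) • p + τ • z ∈ K := by
      have e : (1 - τ) + τ = 1 := by ring
      have : 0 ≤ 1 - τ := by linarith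
      apply hseg
      · rw [bary_comb _ _ _ _ _ e]; positivity
      · rw [bary_comb _ _ _ _ _ e]; positivity
      · rw [bary_comb _ _ _ _ _ e]; linarith
    have htτ : t ≤ τ := by
      by_contra! hlt
      obtain rfl : s = 1 - t := by linarith
      nlinarith
    have hmix : s • p + t • z = (1 - t / τ) • p + (t / τ) • ((1 - τ) • p + τ • z) := by
      obtain rfl : s = 1 - t := by linarith
      rw [smul_add, smul_smul, smul_smul, div_mul_cancel₀ _ hτ0.ne', ← add_assoc, ← add_smul]
      congr 2
      field_simp
      ring
    rw [hmix]
    have : t / τ ≤ 1 := (div_le_one hτ0).2 htτ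
    exact hc hp hq (by linarith) (by positivity) (by ring)
  rintro x (hx | hx) y (hy | hy) s t hs ht hst
  · exact Or.inl (hc hx hy hs ht hst)
  · exact main x hx y hy s t hs ht hst
  · rw [add_comm]; exact main y hy x hx t s ht hs (by linarith)
  · exact Or.inr (hconvT hx hy hs ht hst)

theorem left_bary (k : Plane) (t : ℝ) (hD : cross (Y - X) (Z - X) ≠ 0) :
    bary Z X Y (k + t • (X - Y)) = bary Z X Y k - t := by
  have h2 : cross (X - Z) (Y - Z) = cross (Y - X) (Z - X) := by simp [cross]; ring
  rw [bary, bary, h2, div_sub' hD]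
  congr 1
  simp [cross]; ring

theorem right_bary (k : Plane) (t : ℝ) (hD : cross (Y - X) (Z - X) ≠ 0) :
    bary Y Z X (k + t • (Y - X)) = bary Y Z X k - t := by
  rw [bary, bary, cross_rotate X Y Z, div_sub' hD]
  congr 1
  simp [cross]; ring

theorem bary_segment {P Q : Plane} {k : Plane} (hk : k ∈ segment ℝ P Q) (X Y Z : Plane) :
    ∃ s t : ℝ, 0 ≤ s ∧ 0 ≤ t ∧ s + t = 1 ∧ bary X Y Z k = s * bary X Y Z P + t * bary X Y Z Q := by
  obtain ⟨s, t, hs, ht, hst, rfl⟩ := hk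
  exact ⟨s, t, hs, ht, hst, bary_comb _ _ _ _ _ hst⟩

theorem cross_ne' (h : cross (Y - X) (Z - X) ≠ 0) : cross (Z - Y) (X - Y) ≠ 0 := by
  rwa [cross_rotate]

/-- Adding the corner does not decrease the functional. -/
theorem dist_add_dist_sub_le (ha : 0 < a) (hb : 0 < b) (hK : IsOptimal a b lam K)
    (hcl : IsClosed K) (h : IsCorner K X Y Z) (hZ : Z ∈ closedBall (0 : Plane) b) (hlam : 0 ≤ lam) :
    dist X Z + dist Y Z - capLength K (sideNormal X Y Z) (inner ℝ (sideNormal X Y Z) X) ≤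
      lam * (|cross (Y - X) (Z - X)| / 2 -
        capArea K (sideNormal X Y Z) (inner ℝ (sideNormal X Y Z) X)) := by
  set n := sideNormal X Y Z with hn
  set m := inner ℝ n X with hm
  have hw : ∀ k, bary X Y Z k = inner ℝ n k - m := bary_eq_sideNormal X Y Z
  have hD := h.cross_ne
  have hD1 := cross_ne' hD
  have hD2 := cross_ne' hD1
  set K' := K ∪ tri X Y Z with hK'
  have hcl' : IsClosed K' := hcl.union (isClosed_tri X Y Z)
  have hadm : K' ∈ Admissible a b := ⟨h.convex_union hK.convex,
    hK.1.2.1.trans Set.subset_union_left, Set.union_subset hK.1.2.2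
      (tri_subset hD (convex_closedBall _ _) (hK.1.2.2 h.left_mem) (hK.1.2.2 h.right_mem) hZ)⟩
  have hopt := hK.2 K' hadm
  have harea := area_eq_add_capArea hK.1 n m
  have harea' : area K' ≤ (volume (K ∩ {k | inner ℝ n k ≤ m})).toReal +
      |cross (Y - X) (Z - X)| / 2 := by
    -- Beyond the chord `K` lies in the triangle, which therefore absorbs the old cap. An upper
    -- bound for the new area suffices because `lam` is nonnegative.
    have hsub : K' ⊆ (K ∩ {k | inner ℝ n k ≤ m}) ∪ tri X Y Z := by
      rintro k (hk | hk)
      · by_cases hkm : inner ℝ n k ≤ m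
        · exact Or.inl ⟨hk, hkm⟩
        · push Not at hkm
          exact Or.inr ⟨h.left_nonneg k hk, h.right_nonneg k hk, by rw [hw]; linarith⟩
      · exact Or.inr hk
    have h1 := (measure_mono (μ := volume) hsub).trans (measure_union_le _ _)
    have hfin : volume (K ∩ {k | inner ℝ n k ≤ m}) ≠ ⊤ :=
      ((measure_mono Set.inter_subset_left).trans_lt (volume_lt_top_of_admissible hK.1)).ne
    rw [volume_tri hD] at h1
    have h2 := ENNReal.toReal_mono (ENNReal.add_ne_top.2 ⟨hfin, ENNReal.ofReal_ne_top⟩) h1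
    rwa [ENNReal.toReal_add hfin ENNReal.ofReal_ne_top, ENNReal.toReal_ofReal (by positivity)] at h2
  have hper := perimeter_eq_add_capLength ha hb hK.1 hcl n m
  have hper' := perimeter_eq_add_capLength ha hb hadm hcl' n m
  have hU : IsOpen {k : Plane | inner ℝ n k < m} := isOpen_lt (by fun_prop) continuous_const
  have hfr : frontier K' ∩ {k | inner ℝ n k < m} = frontier K ∩ {k | inner ℝ n k < m} := by
    apply frontier_inter_eq_of_inter_eq hU
    ext k; simp only [hK', Set.mem_inter_iff, Set.mem_union, Set.mem_ofPred_eq]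
    refine ⟨?_, fun h => ⟨Or.inl h.1, h.2⟩⟩
    rintro ⟨hk | hk, hkm⟩
    · exact ⟨hk, hkm⟩
    · have := hk.2.2; rw [hw] at this; linarith
  rw [hfr] at hper'
  have hnn1 : ∀ k ∈ K', 0 ≤ bary Y Z X k := by
    rintro k (hk | hk); exacts [h.left_nonneg k hk, hk.1]
  have hnn2 : ∀ k ∈ K', 0 ≤ bary Z X Y k := by
    rintro k (hk | hk); exacts [h.right_nonneg k hk, hk.2.1]
  have hZK' : Z ∈ K' := Or.inr ⟨(bary_self_mid Y Z X).ge, (bary_self_left Z X Y).ge,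
    by rw [bary_self_right hD]; exact zero_le_one⟩
  have hseg1 : segment ℝ X Z ⊆ frontier K' ∩ {k | m ≤ inner ℝ n k} := by
    intro k hk
    have hkK := hadm.1.segment_subset (Or.inl h.left_mem) hZK' hk
    obtain ⟨s, t, hs, ht, hst, e⟩ := bary_segment hk Z X Y
    obtain ⟨s', t', hs', ht', hst', e'⟩ := bary_segment hk X Y Z
    rw [bary_self_left, bary_self_mid, mul_zero, mul_zero, add_zero] at e
    rw [bary_self_left, bary_self_right hD, hw] at e'
    refine ⟨⟨subset_closure hkK, notMem_interior_of_ray (d := X - Y) fun r hr h' => ?_⟩, ?_⟩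
    · have := hnn2 _ h'
      rw [left_bary _ _ hD, e] at this; linarith
    · rw [Set.mem_ofPred_eq]; linarith
  have hseg2 : segment ℝ Y Z ⊆ frontier K' ∩ {k | m ≤ inner ℝ n k} := by
    intro k hk
    have hkK := hadm.1.segment_subset (Or.inl h.right_mem) hZK' hk
    obtain ⟨s, t, hs, ht, hst, e⟩ := bary_segment hk Y Z X
    obtain ⟨s', t', hs', ht', hst', e'⟩ := bary_segment hk X Y Z
    rw [bary_self_left, bary_self_mid, mul_zero, mul_zero, add_zero] at e
    rw [bary_self_mid, bary_self_right hD, hw] at e'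
    refine ⟨⟨subset_closure hkK, notMem_interior_of_ray (d := Y - X) fun r hr h' => ?_⟩, ?_⟩
    · have := hnn1 _ h'
      rw [right_bary _ _ hD, e] at this; linarith
    · rw [Set.mem_ofPred_eq]; linarith
  have hlen : dist X Z + dist Y Z ≤ capLength K' n m := by
    -- The two new sides meet only in `Z`, so their lengths add.
    have hdisj : AEDisjoint (μH[1] : Measure Plane) (segment ℝ X Z) (segment ℝ Y Z) := by
      refine measure_mono_null (t := {Z}) ?_ ?_
      · rintro k ⟨hk, hk'⟩
        obtain ⟨s, t, hs, ht, hst, e⟩ := bary_segment hk Z X Y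
        obtain ⟨s', t', hs', ht', hst', e'⟩ := bary_segment hk' Y Z X
        rw [bary_self_left, bary_self_mid, mul_zero, mul_zero, add_zero] at e e'
        have hs := bary_sum hD k
        rw [Set.mem_singleton_iff, bary_eq hD k, e, e', show bary X Y Z k = 1 by linarith]
        simp
      · have := Measure.nullSingletonClass_hausdorff Plane one_pos
        exact measure_singleton _
    have hmeas : NullMeasurableSet (segment ℝ Y Z) (μH[1] : Measure Plane) := by
      apply IsClosed.nullMeasurableSet
      rw [← convexHull_pair]
      exact (Set.Finite.isCompact_convexHull ℝ (Set.toFinite _)).isClosed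
    have h1 := measure_union₀ hmeas hdisj
    rw [hausdorffMeasure_segment, hausdorffMeasure_segment] at h1
    rw [capLength, dist_edist, dist_edist, ← ENNReal.toReal_add (edist_ne_top _ _)
      (edist_ne_top _ _), ← h1]
    exact ENNReal.toReal_mono ((measure_mono Set.inter_subset_left).trans_lt
      (perimeter_lt_top ha hb hadm hcl')).ne (measure_mono (Set.union_subset hseg1 hseg2))
  change lam * area K - perimeter K ≤ lam * area K' - perimeter K' at hopt
  have := mul_le_mul_of_nonneg_left harea' hlam
  rw [harea, hper, hper'] at hopt
  rw [mul_add] at this hopt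
  rw [mul_sub]
  linarith

end IsCorner

end Optimal

/-! ### Length and area of a cap in terms of its height -/

theorem cross_eq_zero_of_sameRay {x y : Plane} (h : SameRay ℝ x y) : cross x y = 0 := by
  rcases eq_or_ne x 0 with rfl | hx
  · simp [cross]
  have h1 := sameRay_iff_norm_smul_eq.1 h
  have h2 : ‖x‖ * cross x y = ‖y‖ * cross x x := by
    have : cross x (‖x‖ • y) = cross x (‖y‖ • x) := by rw [h1]
    simp only [cross, PiLp.smul_apply, smul_eq_mul] at this ⊢
    linarith
  have h3 : cross x x = 0 := by simp [cross]; ring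
  rw [h3, mul_zero] at h2
  exact (mul_eq_zero.1 h2).resolve_left (norm_ne_zero_iff.2 hx)

namespace IsCorner

variable {a b lam : ℝ} {K : Set Plane} {X Y Z : Plane}

theorem mem_segment_of_bary (hD : cross (Y - X) (Z - X) ≠ 0) {k : Plane}
    (hu : 0 ≤ bary Y Z X k) (hv : 0 ≤ bary Z X Y k) (hw : bary X Y Z k = 0) :
    k ∈ segment ℝ X Y := by
  have hs := bary_sum hD k
  refine ⟨_, _, hu, hv, by linarith, ?_⟩
  conv_rhs => rw [bary_eq hD k, hw, zero_smul, add_zero]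

theorem toReal_cap_le {n : Plane} {m c : ℝ} {S : Set Plane} (hc : 0 ≤ c)
    (h : μH[1] (frontier K ∩ {k | m ≤ inner ℝ n k}) ≤ μH[1] S) (hS : μH[1] S ≤ ENNReal.ofReal c) :
    capLength K n m ≤ c :=
  ENNReal.toReal_le_of_le_ofReal hc (h.trans hS)

theorem capLength_le_dist (hcl : IsClosed K) (h : IsCorner K X Y Z)
    (h0 : ∀ k ∈ K, bary X Y Z k ≤ 0) :
    capLength K (sideNormal X Y Z) (inner ℝ (sideNormal X Y Z) X) ≤ dist X Y := by
  refine toReal_cap_le (S := segment ℝ X Y) dist_nonneg (measure_mono ?_)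
    (by rw [hausdorffMeasure_segment, edist_dist])
  rintro k ⟨hk, hkm⟩
  have hkK := hcl.frontier_subset hk
  refine mem_segment_of_bary h.cross_ne (h.left_nonneg k hkK) (h.right_nonneg k hkK)
    (le_antisymm (h0 k hkK) ?_)
  rw [bary_eq_sideNormal]
  exact sub_nonneg.2 hkm

theorem capLength_le_of_region (hc : Convex ℝ K) (hcl : IsClosed K) (hi : (interior K).Nonempty)
    (h : IsCorner K X Y Z) {B S : Set Plane} {p : Plane} {c : ℝ} (hB : Bornology.IsBounded B)
    (hKB : ∀ k ∈ K, 0 ≤ bary X Y Z k → k ∈ B) (hS : frontier B ⊆ S ∪ segment ℝ X Y)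
    (hXS : X ∈ S) (hYS : Y ∈ S) (hp : p ∈ K) (hwp : 0 < bary X Y Z p) (hc0 : 0 ≤ c)
    (hSc : μH[1] S ≤ ENNReal.ofReal c) :
    capLength K (sideNormal X Y Z) (inner ℝ (sideNormal X Y Z) X) ≤ c := by
  obtain ⟨o, ho, hwo⟩ := h.exists_neg
  refine toReal_cap_le hc0 (hausdorffMeasure_cap_le hc hcl hi hB (fun k hk hkm => hKB k hk ?_) hS
    h.left_mem h.right_mem hXS hYS h.ne_left_right rfl (inner_right X Y Z) hp ?_ ho ?_) hSc
  · rw [bary_eq_sideNormal]; exact sub_nonneg.2 hkm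
  · rw [bary_eq_sideNormal] at hwp; linarith
  · rw [bary_eq_sideNormal] at hwo; linarith

theorem isBounded_tri (hD : cross (Y - X) (Z - X) ≠ 0) : Bornology.IsBounded (tri X Y Z) := by
  have h : Bornology.IsBounded (convexHull ℝ ({X, Y, Z} : Set Plane)) :=
    (Set.Finite.isCompact_convexHull ℝ (Set.toFinite _)).isBounded
  exact h.subset (tri_subset hD (convex_convexHull _ _) (subset_convexHull _ _ (by simp))
    (subset_convexHull _ _ (by simp)) (subset_convexHull _ _ (by simp)))

theorem frontier_tri_subset (hD : cross (Y - X) (Z - X) ≠ 0) :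
    frontier (tri X Y Z) ⊆ (segment ℝ X Z ∪ segment ℝ Z Y) ∪ segment ℝ X Y := by
  have hD1 := cross_ne' hD
  have hD2 := cross_ne' hD1
  rintro k ⟨hk, hki⟩
  rw [(isClosed_tri X Y Z).closure_eq] at hk
  obtain ⟨hu, hv, hw⟩ := hk
  rcases hu.eq_or_lt with hu' | hu'
  · left; right
    rw [segment_symm]
    exact mem_segment_of_bary hD1 hv hw hu'.symm
  rcases hv.eq_or_lt with hv' | hv'
  · left; left
    rw [segment_symm]
    exact mem_segment_of_bary hD2 hw hu hv'.symm
  rcases hw.eq_or_lt with hw' | hw'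
  · right
    exact mem_segment_of_bary hD hu hv hw'.symm
  exfalso
  apply hki
  have hopen : IsOpen {k | 0 < bary Y Z X k ∧ 0 < bary Z X Y k ∧ 0 < bary X Y Z k} :=
    (isOpen_lt continuous_const (continuous_bary _ _ _)).inter
      ((isOpen_lt continuous_const (continuous_bary _ _ _)).inter
        (isOpen_lt continuous_const (continuous_bary _ _ _)))
  refine interior_maximal (fun z hz => ?_) hopen ⟨hu', hv', hw'⟩
  exact ⟨hz.1.le, hz.2.1.le, hz.2.2.le⟩

/-- If the cap is contained in the triangle `X Y V`, then its arc is not longer than the two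
sides at `V`. -/
theorem capLength_le_of_subset_tri (hc : Convex ℝ K) (hcl : IsClosed K)
    (hi : (interior K).Nonempty) (h : IsCorner K X Y Z) {V : Plane} (hV : V ∈ K)
    (hwV : 0 < bary X Y Z V) (hDV : cross (Y - X) (V - X) ≠ 0)
    (hsub : ∀ k ∈ K, 0 ≤ bary X Y Z k → k ∈ tri X Y V) :
    capLength K (sideNormal X Y Z) (inner ℝ (sideNormal X Y Z) X) ≤ dist X V + dist V Y := by
  refine h.capLength_le_of_region hc hcl hi (isBounded_tri hDV) hsub (frontier_tri_subset hDV)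
    (Or.inl (left_mem_segment _ _ _)) (Or.inr (right_mem_segment _ _ _)) hV hwV (by positivity) ?_
  refine (measure_union_le _ _).trans ?_
  rw [hausdorffMeasure_segment, hausdorffMeasure_segment, ENNReal.ofReal_add dist_nonneg
    dist_nonneg, edist_dist, edist_dist]

/-- If the cap has relative height at most `t`, then its arc is not longer than the one of the
trapezoid of height `t`. -/
theorem capLength_le_of_le (hc : Convex ℝ K) (hcl : IsClosed K) (hi : (interior K).Nonempty)
    (h : IsCorner K X Y Z) {V : Plane} {t : ℝ} (hV : V ∈ K) (hwV : 0 < bary X Y Z V) (ht1 : t < 1)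
    (hsub : ∀ k ∈ K, bary X Y Z k ≤ t) :
    capLength K (sideNormal X Y Z) (inner ℝ (sideNormal X Y Z) X) ≤
      dist X Y + t * (dist X Z + dist Y Z - dist X Y) := by
  have ht0 : 0 < t := hwV.trans_le (hsub V hV)
  have hD := h.cross_ne
  have hD1 := cross_ne' hD
  have hD2 := cross_ne' hD1
  set B := {k ∈ tri X Y Z | bary X Y Z k ≤ t} with hB
  have hBcl : IsClosed B :=
    (isClosed_tri X Y Z).inter (isClosed_le (continuous_bary _ _ _) continuous_const)
  -- The upper vertices of the trapezoid cut from the triangle at relative height `t`.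
  set U₁ := (1 - t) • X + t • Z with hU₁
  set U₂ := (1 - t) • Y + t • Z with hU₂
  have h1t : 0 < 1 - t := by linarith
  refine h.capLength_le_of_region hc hcl hi
    (S := segment ℝ X U₁ ∪ segment ℝ U₁ U₂ ∪ segment ℝ U₂ Y) (B := B)
    ((isBounded_tri hD).subset fun k hk => hk.1)
    (fun k hk hkw => ⟨⟨h.left_nonneg k hk, h.right_nonneg k hk, hkw⟩, hsub k hk⟩) ?_
    (Or.inl (Or.inl (left_mem_segment _ _ _))) (Or.inr (right_mem_segment _ _ _)) hV hwV ?_ ?_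
  · rintro k ⟨hk, hki⟩
    rw [hBcl.closure_eq] at hk
    obtain ⟨⟨hu, hv, hw⟩, hwt⟩ := hk
    have hs := bary_sum hD k
    have hke := bary_eq hD k
    rcases hu.eq_or_lt with hu' | hu'
    · left; right
      rw [← hu', zero_add] at hs
      rw [← hu', zero_smul, zero_add] at hke
      refine ⟨bary X Y Z k / t, 1 - bary X Y Z k / t, by positivity,
        sub_nonneg.2 ((div_le_one ht0).2 hwt), by ring, ?_⟩
      rw [show bary Z X Y k = 1 - bary X Y Z k by linarith] at hke
      conv_rhs => rw [hke]
      rw [hU₂, smul_add, smul_smul, smul_smul, div_mul_cancel₀ _ ht0.ne', add_right_comm, ← add_smul]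
      congr 2
      field_simp; ring
    rcases hv.eq_or_lt with hv' | hv'
    · left; left; left
      rw [← hv', add_zero] at hs
      rw [← hv', zero_smul, add_zero] at hke
      refine ⟨1 - bary X Y Z k / t, bary X Y Z k / t, 
        sub_nonneg.2 ((div_le_one ht0).2 hwt), by positivity, by ring, ?_⟩
      rw [show bary Y Z X k = 1 - bary X Y Z k by linarith] at hke
      conv_rhs => rw [hke]
      rw [hU₁, smul_add, smul_smul, smul_smul, div_mul_cancel₀ _ ht0.ne', ← add_assoc, ← add_smul]
      congr 2
      field_simp; ring
    rcases hw.eq_or_lt with hw' | hw'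
    · right
      exact mem_segment_of_bary hD hu hv hw'.symm
    rcases hwt.eq_or_lt with hwt' | hwt'
    · left; left; right
      rw [hwt'] at hs hke
      refine ⟨bary Y Z X k / (1 - t), bary Z X Y k / (1 - t), by positivity, by positivity, ?_, ?_⟩
      · rw [← add_div, div_eq_one_iff_eq h1t.ne']; linarith
      · rw [hU₁, hU₂, smul_add, smul_add, smul_smul, smul_smul, smul_smul, smul_smul,
          div_mul_cancel₀ _ h1t.ne', div_mul_cancel₀ _ h1t.ne', add_add_add_comm, ← add_smul]
        conv_rhs => rw [hke]
        congr 2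
        rw [← add_mul, ← add_div, show bary Y Z X k + bary Z X Y k = 1 - t by linarith,
          div_self h1t.ne', one_mul]
    exfalso
    apply hki
    have hopen : IsOpen {k | 0 < bary Y Z X k ∧ 0 < bary Z X Y k ∧ 0 < bary X Y Z k ∧
        bary X Y Z k < t} :=
      (isOpen_lt continuous_const (continuous_bary _ _ _)).inter
        ((isOpen_lt continuous_const (continuous_bary _ _ _)).inter
          ((isOpen_lt continuous_const (continuous_bary _ _ _)).inter
            (isOpen_lt (continuous_bary _ _ _) continuous_const)))
    refine interior_maximal (fun z hz => ?_) hopen ⟨hu', hv', hw', hwt'⟩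
    exact ⟨⟨hz.1.le, hz.2.1.le, hz.2.2.1.le⟩, hz.2.2.2.le⟩
  · have : dist X Y + t * (dist X Z + dist Y Z - dist X Y) =
      (1 - t) * dist X Y + t * dist X Z + t * dist Y Z := by ring
    rw [this]; positivity
  · have e1 : dist X U₁ = t * dist X Z := by
      rw [dist_eq_norm, dist_eq_norm, hU₁, show X - ((1 - t) • X + t • Z) = t • (X - Z) by module,
        norm_smul, Real.norm_eq_abs, abs_of_pos ht0]
    have e2 : dist U₂ Y = t * dist Y Z := by
      rw [dist_comm, dist_eq_norm, dist_eq_norm, hU₂,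
        show Y - ((1 - t) • Y + t • Z) = t • (Y - Z) by module,
        norm_smul, Real.norm_eq_abs, abs_of_pos ht0]
    have e3 : dist U₁ U₂ = (1 - t) * dist X Y := by
      rw [dist_eq_norm, dist_eq_norm, hU₁, hU₂,
        show (1 - t) • X + t • Z - ((1 - t) • Y + t • Z) = (1 - t) • (X - Y) by module,
        norm_smul, Real.norm_eq_abs, abs_of_pos h1t]
    refine (measure_union_le _ _).trans ((add_le_add_left (measure_union_le _ _) _).trans ?_)
    rw [hausdorffMeasure_segment, hausdorffMeasure_segment, hausdorffMeasure_segment, edist_dist,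
      edist_dist, edist_dist, ← ENNReal.ofReal_add dist_nonneg dist_nonneg,
      ← ENNReal.ofReal_add (by positivity) dist_nonneg, e1, e2, e3]
    apply le_of_eq; congr 1; ring

theorem volume_tri_inter {V : Plane} (hD : cross (Y - X) (V - X) ≠ 0) {n : Plane} {m : ℝ}
    (hn : n ≠ 0) (hX : inner ℝ n X = m) (hY : inner ℝ n Y = m) (hV : m ≤ inner ℝ n V) :
    volume (tri X Y V ∩ {k | m < inner ℝ n k}) =
      ENNReal.ofReal (|cross (Y - X) (V - X)| / 2) := by
  rw [← volume_tri hD]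
  refine le_antisymm (measure_mono Set.inter_subset_left) ?_
  have hconv : Convex ℝ {k : Plane | m ≤ inner ℝ n k} :=
    convex_halfSpace_ge (innerₛₗ ℝ n).isLinear m
  have hsub : tri X Y V ⊆ (tri X Y V ∩ {k | m < inner ℝ n k}) ∪ {k | inner ℝ n k = m} := by
    intro k hk
    have hk' : m ≤ inner ℝ n k := tri_subset hD hconv hX.ge hY.ge hV hk
    rcases hk'.eq_or_lt with h | h
    · exact Or.inr h.symm
    · exact Or.inl ⟨hk, h⟩
  refine (measure_mono hsub).trans ((measure_union_le _ _).trans ?_)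
  rw [volume_line hn, add_zero]

theorem cross_eq_bary_mul (hD : cross (Y - X) (Z - X) ≠ 0) (V : Plane) :
    cross (Y - X) (V - X) = bary X Y Z V * cross (Y - X) (Z - X) := by
  rw [bary, div_mul_cancel₀ _ hD]

/-- By convexity the cap contains the triangle `X Y V`, whose height over `XY` is the fraction `bary
X Y Z V` of that of `Z`. -/
theorem capArea_ge (hK : K ∈ Admissible a b) (h : IsCorner K X Y Z) {V : Plane} (hV : V ∈ K)
    (hwV : 0 < bary X Y Z V) :
    bary X Y Z V * (|cross (Y - X) (Z - X)| / 2) ≤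
      capArea K (sideNormal X Y Z) (inner ℝ (sideNormal X Y Z) X) := by
  have hDV : cross (Y - X) (V - X) ≠ 0 := by
    rw [cross_eq_bary_mul h.cross_ne]; exact mul_ne_zero hwV.ne' h.cross_ne
  have h1 := volume_tri_inter hDV h.sideNormal_ne rfl (inner_right X Y Z)
    (by rw [bary_eq_sideNormal] at hwV; linarith)
  have e : bary X Y Z V * |cross (Y - X) (Z - X)| = |bary X Y Z V * cross (Y - X) (Z - X)| := by
    rw [abs_mul, abs_of_pos hwV]
  rw [← mul_div_assoc, e, ← cross_eq_bary_mul h.cross_ne,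
    capArea, ← ENNReal.toReal_ofReal (by positivity : 0 ≤ |cross (Y - X) (V - X)| / 2), ← h1]
  refine ENNReal.toReal_mono ((measure_mono Set.inter_subset_left).trans_lt
      (volume_lt_top_of_admissible hK)).ne (measure_mono ?_)
  exact Set.inter_subset_inter_left _ (tri_subset hDV hK.1 h.left_mem h.right_mem hV)

/-- If the area of the cap is the one of the triangle `X Y V`, then the cap is this triangle. -/
theorem subset_tri_of_capArea_le (hK : K ∈ Admissible a b) (h : IsCorner K X Y Z) {V : Plane}
    (hV : V ∈ K) (hwV : 0 < bary X Y Z V)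
    (hA : capArea K (sideNormal X Y Z) (inner ℝ (sideNormal X Y Z) X) ≤
      bary X Y Z V * (|cross (Y - X) (Z - X)| / 2)) {k : Plane} (hk : k ∈ K)
    (hwk : 0 ≤ bary X Y Z k) : k ∈ tri X Y V := by
  have hDV : cross (Y - X) (V - X) ≠ 0 := by
    rw [cross_eq_bary_mul h.cross_ne]; exact mul_ne_zero hwV.ne' h.cross_ne
  by_contra hkT
  have hcomp : IsOpen (tri X Y V)ᶜ := (isClosed_tri X Y V).isOpen_compl
  -- The centroid is interior to the triangle, hence to `K`. Near a point `k` of `K` outside the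
  -- triangle, the segment towards `g` consists of interior points of `K` off the triangle, and
  -- these contribute additional area to the cap.
  set g : Plane := (1 / 3 : ℝ) • X + (1 / 3 : ℝ) • Y + (1 / 3 : ℝ) • V with hg
  have hgw : 0 < bary X Y Z g := by
    have e : g = (2 / 3 : ℝ) • ((1 / 2 : ℝ) • X + (1 / 2 : ℝ) • Y) + (1 / 3 : ℝ) • V := by
      rw [hg]; module
    rw [e, bary_comb _ _ _ _ _ (by norm_num), bary_comb _ _ _ _ _ (by norm_num), bary_self_left,
      bary_self_mid]
    linarith
  have hgi : g ∈ interior (tri X Y V) := by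
    have hD1 := cross_ne' hDV
    have hD2 := cross_ne' hD1
    have hopen : IsOpen {k | 0 < bary Y V X k ∧ 0 < bary V X Y k ∧ 0 < bary X Y V k} :=
      (isOpen_lt continuous_const (continuous_bary _ _ _)).inter
        ((isOpen_lt continuous_const (continuous_bary _ _ _)).inter
          (isOpen_lt continuous_const (continuous_bary _ _ _)))
    suffices hg : g ∈ {k | 0 < bary Y V X k ∧ 0 < bary V X Y k ∧ 0 < bary X Y V k} by
      refine interior_maximal (fun z hz => ?_) hopen hg
      exact ⟨hz.1.le, hz.2.1.le, hz.2.2.le⟩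
    have e : g = (2 / 3 : ℝ) • ((1 / 2 : ℝ) • X + (1 / 2 : ℝ) • Y) + (1 / 3 : ℝ) • V := by
      rw [hg]; module
    refine ⟨?_, ?_, ?_⟩ <;> rw [e, bary_comb _ _ _ _ _ (by norm_num),
      bary_comb _ _ _ _ _ (by norm_num)]
    · rw [bary_self_right hD1, bary_self_left, bary_self_mid]; norm_num
    · rw [bary_self_right hD2, bary_self_left, bary_self_mid]; norm_num
    · rw [bary_self_right hDV, bary_self_left, bary_self_mid]; norm_num
  have hgK : g ∈ interior K :=
    interior_mono (tri_subset hDV hK.1 h.left_mem h.right_mem hV) hgi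
  obtain ⟨y, hyseg, hyT⟩ : ∃ y ∈ openSegment ℝ k g, y ∈ (tri X Y V)ᶜ := by
    have hf : Continuous fun t : ℝ => (1 - t) • k + t • g := by fun_prop
    have h0 : (fun t : ℝ => (1 - t) • k + t • g) 0 ∈ (tri X Y V)ᶜ := by simpa using hkT
    have h1 : ∀ᶠ t in nhdsWithin (0 : ℝ) (Set.Ioi 0), (1 - t) • k + t • g ∈ (tri X Y V)ᶜ :=
      (hf.continuousAt.eventually (hcomp.mem_nhds h0)).filter_mono nhdsWithin_le_nhds
    have h2 : ∀ᶠ t in nhdsWithin (0 : ℝ) (Set.Ioi 0), t < 1 :=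
      (gt_mem_nhds one_pos).filter_mono nhdsWithin_le_nhds
    obtain ⟨t, ht, ht1, ht0⟩ := (h1.and (h2.and self_mem_nhdsWithin)).exists
    exact ⟨_, ⟨1 - t, t, by linarith, ht0, by ring, rfl⟩, ht⟩
  have hyK : y ∈ interior K := hK.1.openSegment_self_interior_subset_interior hk hgK hyseg
  have hyw : 0 < bary X Y Z y := by
    obtain ⟨s, t, hs, ht, hst, rfl⟩ := hyseg
    rw [bary_comb _ _ _ _ _ hst]; positivity
  set n := sideNormal X Y Z
  set m := inner ℝ n X
  have hw : ∀ k, bary X Y Z k = inner ℝ n k - m := bary_eq_sideNormal X Y Z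
  set W : Set Plane := interior K ∩ (tri X Y V)ᶜ ∩ {k | m < inner ℝ n k} with hW
  have hWo : IsOpen W :=
    (isOpen_interior.inter hcomp).inter (isOpen_lt continuous_const (by fun_prop))
  have hWpos : 0 < volume W :=
    hWo.measure_pos _ ⟨y, ⟨hyK, hyT⟩, by rw [hw] at hyw; exact sub_pos.1 hyw⟩
  have h1 := volume_tri_inter hDV h.sideNormal_ne rfl (inner_right X Y Z)
    (by rw [hw] at hwV; exact (sub_pos.1 hwV).le)
  have hsub : (tri X Y V ∩ {k | m < inner ℝ n k}) ∪ W ⊆ K ∩ {k | m < inner ℝ n k} := by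
    rintro z (hz | hz)
    · exact ⟨tri_subset hDV hK.1 h.left_mem h.right_mem hV hz.1, hz.2⟩
    · exact ⟨interior_subset hz.1.1, hz.2⟩
  have hdisj : Disjoint (tri X Y V ∩ {k | m < inner ℝ n k}) W :=
    Set.disjoint_left.2 fun z hz hz' => hz'.1.2 hz.1
  have h2 := measure_mono (μ := volume) hsub
  rw [measure_union hdisj hWo.measurableSet, h1] at h2
  have hfin : volume (K ∩ {k | m < inner ℝ n k}) ≠ ⊤ :=
    ((measure_mono Set.inter_subset_left).trans_lt (volume_lt_top_of_admissible hK)).ne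
  have hWfin : volume W ≠ ⊤ := ne_top_of_le_ne_top hfin (le_add_self.trans h2)
  have h3 := ENNReal.toReal_mono hfin h2
  rw [ENNReal.toReal_add ENNReal.ofReal_ne_top hWfin, ENNReal.toReal_ofReal (by positivity),
    cross_eq_bary_mul h.cross_ne, abs_mul, abs_of_pos hwV] at h3
  have h4 := ENNReal.toReal_pos hWpos.ne' hWfin
  rw [capArea] at hA
  linarith

/-- If a corner can be added to an optimal set, then it is flat. -/
theorem sub_le_of_notMem (ha : 0 < a) (hb : 0 < b) (hK : IsOptimal a b lam K)
    (hcl : IsClosed K) (h : IsCorner K X Y Z) (hZ : Z ∈ closedBall (0 : Plane) b)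
    (hZK : Z ∉ K) (hlam : 0 ≤ lam) :
    dist X Z + dist Y Z - dist X Y ≤ lam * (|cross (Y - X) (Z - X)| / 2) := by
  have hcpt : IsCompact K := Metric.isCompact_of_isClosed_isBounded hcl
    (isBounded_closedBall.subset hK.1.2.2)
  obtain ⟨V, hV, hmax⟩ := hcpt.exists_isMaxOn ⟨X, h.left_mem⟩ (continuous_bary X Y Z).continuousOn
  have hadd := h.dist_add_dist_sub_le ha hb hK hcl hZ hlam
  have hi := interior_nonempty_of_admissible ha hK.1
  by_cases hV0 : bary X Y Z V ≤ 0
  · have h1 := h.capLength_le_dist hcl fun k hk => (hmax hk).trans hV0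
    have h2 : 0 ≤ capArea K (sideNormal X Y Z) (inner ℝ (sideNormal X Y Z) X) :=
      ENNReal.toReal_nonneg
    nlinarith
  · push Not at hV0
    have hV1 : bary X Y Z V < 1 := by
      by_contra! h1
      have hs := bary_sum h.cross_ne V
      have hu := h.left_nonneg V hV
      have hv := h.right_nonneg V hV
      apply hZK
      have : V = Z := by
        rw [bary_eq h.cross_ne V, show bary Y Z X V = 0 by linarith,
          show bary Z X Y V = 0 by linarith, show bary X Y Z V = 1 by linarith]
        simp
      rwa [← this]
    have h1 := h.capLength_le_of_le hK.convex hcl hi hV hV0 hV1 fun k hk => hmax hk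
    have h2 := h.capArea_ge hK.1 hV hV0
    have h3 := mul_le_mul_of_nonneg_left h2 hlam
    set t := bary X Y Z V
    set T := |cross (Y - X) (Z - X)| / 2
    -- The length bound removes `t` times the gain on the left and the area bound removes `t * lam *
    -- T` on the right; the common factor `1 - t` is positive because `Z` is not in `K`.
    have h4 : (1 - t) * (dist X Z + dist Y Z - dist X Y) ≤ (1 - t) * (lam * T) := by
      nlinarith
    exact le_of_mul_le_mul_left h4 (by linarith)

/-- A cap of an optimal set which can be cut off and whose corner can be added is trivial. -/
theorem bary_nonpos_of_notMem (ha : 0 < a) (hb : 0 < b) (hK : IsOptimal a b lam K)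
    (hcl : IsClosed K) (h : IsCorner K X Y Z) (hZ : Z ∈ closedBall (0 : Plane) b)
    (hZK : Z ∉ K) (hlam : 0 < lam) (hna : ∀ k ∈ closedBall (0 : Plane) a, bary X Y Z k ≤ 0) :
    ∀ k ∈ K, bary X Y Z k ≤ 0 := by
  have hcpt : IsCompact K := Metric.isCompact_of_isClosed_isBounded hcl
    (isBounded_closedBall.subset hK.1.2.2)
  obtain ⟨V, hV, hmax⟩ := hcpt.exists_isMaxOn ⟨X, h.left_mem⟩ (continuous_bary X Y Z).continuousOn
  by_contra! hpos
  obtain ⟨p, hp, hp0⟩ := hpos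
  have hV0 : 0 < bary X Y Z V := hp0.trans_le (hmax hp)
  have hi := interior_nonempty_of_admissible ha hK.1
  have hκ := h.sub_le_of_notMem ha hb hK hcl hZ hZK hlam.le
  have hcut := hK.capArea_le ha hb hcl h.sideNormal_ne h.left_mem h.right_mem rfl
    (inner_right X Y Z) (fun k hk => by
      have := hna k hk; rw [bary_eq_sideNormal] at this; linarith)
  have hs := bary_sum h.cross_ne V
  have hVe := bary_eq h.cross_ne V
  have hu := h.left_nonneg V hV
  have hv := h.right_nonneg V hV
  have hV1 : bary X Y Z V < 1 := by
    by_contra! h1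
    apply hZK
    have : V = Z := by
      rw [hVe, show bary Y Z X V = 0 by linarith,
        show bary Z X Y V = 0 by linarith, show bary X Y Z V = 1 by linarith]
      simp
    rwa [← this]
  have h1 := h.capLength_le_of_le hK.convex hcl hi hV hV0 hV1 fun k hk => hmax hk
  have h2 := h.capArea_ge hK.1 hV hV0
  -- Cutting gives `lam * A ≤ L - |XY|`, the trapezoid gives `L - |XY| ≤ t * gain`, and the gain is
  -- at most `lam * T`. So the cap has no more area than the triangle `X Y V` it contains.
  have hA : capArea K (sideNormal X Y Z) (inner ℝ (sideNormal X Y Z) X) ≤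
      bary X Y Z V * (|cross (Y - X) (Z - X)| / 2) := by
    refine le_of_mul_le_mul_left ?_ hlam
    have := mul_le_mul_of_nonneg_left hκ hV0.le
    nlinarith
  have hDV : cross (Y - X) (V - X) ≠ 0 := by
    rw [cross_eq_bary_mul h.cross_ne]; exact mul_ne_zero hV0.ne' h.cross_ne
  have h3 := h.capLength_le_of_subset_tri hK.convex hcl hi hV hV0 hDV
    fun k hk hwk => h.subset_tri_of_capArea_le hK.1 hV hV0 hA hk hwk
  -- Read backwards, the same chain makes the two sides at `V` at least as long as the trapezoid
  -- path.
  have h4 : bary X Y Z V * (dist X Z + dist Y Z - dist X Y) ≤ dist X V + dist V Y - dist X Y := by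
    have := mul_le_mul_of_nonneg_left h2 hlam.le
    have := mul_le_mul_of_nonneg_left hκ hV0.le
    nlinarith
  set u := bary Y Z X V
  set v := bary Z X Y V
  set t := bary X Y Z V
  have hut : u = 1 - v - t := by linarith
  have eX : X - V = v • (X - Y) + t • (X - Z) := by rw [hVe, hut]; module
  have eY : Y - V = u • (Y - X) + t • (Y - Z) := by
    rw [hVe, show v = 1 - u - t by linarith]; module
  have nX : ‖v • (X - Y)‖ + ‖t • (X - Z)‖ = v * dist X Y + t * dist X Z := by
    rw [norm_smul, norm_smul, Real.norm_eq_abs, Real.norm_eq_abs, abs_of_nonneg hv,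
      abs_of_pos hV0, dist_eq_norm, dist_eq_norm]
  have nY : ‖u • (Y - X)‖ + ‖t • (Y - Z)‖ = u * dist X Y + t * dist Y Z := by
    rw [norm_smul, norm_smul, Real.norm_eq_abs, Real.norm_eq_abs, abs_of_nonneg hu,
      abs_of_pos hV0, dist_comm X Y, dist_eq_norm, dist_eq_norm]
  have dX : dist X V ≤ v * dist X Y + t * dist X Z := by
    rw [dist_eq_norm, eX, ← nX]; exact norm_add_le _ _
  have dY : dist V Y ≤ u * dist X Y + t * dist Y Z := by
    rw [dist_comm, dist_eq_norm, eY, ← nY]; exact norm_add_le _ _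
  have hD := h.cross_ne
  -- `X - V` and `Y - V` are sums of vectors along the sides of the triangle; at least one sum has
  -- two nonzero nonparallel terms, so the triangle inequality is strict and contradicts `h4`.
  have hlt : dist X V + dist V Y < (u + v) * dist X Y + t * (dist X Z + dist Y Z) := by
    rcases hv.eq_or_lt with hv0 | hv0
    · have hu0 : 0 < u := by linarith
      have : dist V Y < u * dist X Y + t * dist Y Z := by
        rw [dist_comm, dist_eq_norm, eY, ← nY]
        refine norm_add_lt_of_not_sameRay fun hray => hD ?_
        have := cross_eq_zero_of_sameRay hray
        have e : cross (u • (Y - X)) (t • (Y - Z)) = - (u * t) * cross (Y - X) (Z - X) := by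
          simp [cross]; ring
        rw [e] at this
        exact (mul_eq_zero.1 this).resolve_left (neg_ne_zero.2 (mul_pos hu0 hV0).ne')
      linarith
    · have : dist X V < v * dist X Y + t * dist X Z := by
        rw [dist_eq_norm, eX, ← nX]
        refine norm_add_lt_of_not_sameRay fun hray => hD ?_
        have := cross_eq_zero_of_sameRay hray
        have e : cross (v • (X - Y)) (t • (X - Z)) = (v * t) * cross (Y - X) (Z - X) := by
          simp [cross]; ring
        rw [e] at this
        exact (mul_eq_zero.1 this).resolve_left (mul_pos hv0 hV0).ne'
      linarith
  have : u + v = 1 - t := by linarith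
  rw [this] at hlt
  linarith

end IsCorner

/-! ### Trigonometry of chords and inscribed triangles -/

/-- The signed distance from the chord of the circle of radius `b` between the arguments `φ` and
`ψ`. -/
def chordDist (b φ ψ : ℝ) (k : Plane) : ℝ :=
  inner ℝ (dir ((φ + ψ) / 2)) k - b * Real.cos ((ψ - φ) / 2)

theorem cross_chord (b φ ψ : ℝ) (k : Plane) :
    cross (b • dir ψ - b • dir φ) (k - b • dir φ) =
      -(2 * b * Real.sin ((ψ - φ) / 2)) * chordDist b φ ψ k := by
  obtain ⟨μ, hμ⟩ : ∃ μ, μ = (φ + ψ) / 2 := ⟨_, rfl⟩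
  obtain ⟨θ, hθ⟩ : ∃ θ, θ = (ψ - φ) / 2 := ⟨_, rfl⟩
  obtain rfl : φ = μ - θ := by rw [hμ, hθ]; ring
  obtain rfl : ψ = μ + θ := by rw [hμ, hθ] at *; linarith
  rw [chordDist, ← hμ, ← hθ, inner_eq]
  simp only [cross, PiLp.sub_apply, PiLp.smul_apply, dir_zero_apply, dir_one_apply, smul_eq_mul,
    Real.cos_add, Real.sin_add, Real.cos_sub, Real.sin_sub]
  linear_combination (2 * b ^ 2 * Real.sin θ * Real.cos θ) * Real.sin_sq_add_cos_sq μ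

theorem chordDist_comm (b φ ψ : ℝ) (k : Plane) : chordDist b φ ψ k = chordDist b ψ φ k := by
  rw [chordDist, chordDist, add_comm ψ φ, ← Real.cos_neg]
  ring_nf

theorem chordDist_dir (b φ ψ t : ℝ) : chordDist b φ ψ (b • dir t) =
    2 * b * (Real.sin ((t - φ) / 2) * Real.sin ((ψ - t) / 2)) := by
  rw [chordDist, real_inner_smul_right, inner_dir]
  have e1 : (φ + ψ) / 2 - t = (ψ - t) / 2 - (t - φ) / 2 := by ring
  have e2 : (ψ - φ) / 2 = (ψ - t) / 2 + (t - φ) / 2 := by ring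
  rw [e1, e2, Real.cos_sub, Real.cos_add]; ring

theorem chordDist_left (b φ ψ : ℝ) : chordDist b φ ψ (b • dir φ) = 0 := by
  rw [chordDist_dir]; simp

theorem chordDist_right (b φ ψ : ℝ) : chordDist b φ ψ (b • dir ψ) = 0 := by
  rw [chordDist_dir]; simp

theorem bary_chord {b φ ψ : ℝ} (hb : b ≠ 0) (h : Real.sin ((ψ - φ) / 2) ≠ 0) (Z k : Plane) :
    bary (b • dir φ) (b • dir ψ) Z k = chordDist b φ ψ k / chordDist b φ ψ Z := by
  rw [bary, cross_chord, cross_chord, mul_div_mul_left]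
  simp [hb, h]

theorem inner_sq_add_cross_sq (x y : Plane) :
    inner ℝ x y ^ 2 + cross x y ^ 2 = ‖x‖ ^ 2 * ‖y‖ ^ 2 := by
  rw [inner_eq, cross, norm_sq_eq, norm_sq_eq]; ring

theorem dir_add_inner (μ δ : ℝ) (k : Plane) : inner ℝ (dir (μ + δ)) k =
    inner ℝ (dir μ) k * Real.cos δ + cross (dir μ) k * Real.sin δ := by
  rw [inner_eq, inner_eq, cross]
  simp only [dir_zero_apply, dir_one_apply, Real.cos_add, Real.sin_add]; ring

/-- Circular segments over nested arcs are nested. In the frame of the inner chord, `x > b cos α`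
and `|y| ≤ b sin α`; turning the direction by `δ` gives more than `b cos (α + |δ|)`, which is at
least `b cos θ`. -/
theorem chordDist_pos_of_le {b φ₁ φ₂ ψ₁ ψ₂ : ℝ} {k : Plane} (hb : 0 < b)
    (hk : k ∈ closedBall (0 : Plane) b) (h1 : φ₁ ≤ ψ₁) (h2 : ψ₁ ≤ ψ₂) (h3 : ψ₂ ≤ φ₂)
    (hπ : φ₂ - φ₁ ≤ Real.pi) (h : 0 < chordDist b ψ₁ ψ₂ k) : 0 < chordDist b φ₁ φ₂ k := by
  rw [mem_closedBall_zero_iff] at hk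
  set μ := (ψ₁ + ψ₂) / 2 with hμ
  set α := (ψ₂ - ψ₁) / 2 with hα
  set δ := (φ₁ + φ₂) / 2 - μ with hδ
  set θ := (φ₂ - φ₁) / 2 with hθ
  have hδθ : |δ| + α ≤ θ := by
    have : |δ| ≤ θ - α := abs_le.2 ⟨by linarith, by linarith⟩
    linarith
  have hα0 : 0 ≤ α := by linarith
  rw [chordDist, ← hμ, ← hα] at h
  rw [chordDist, ← hθ, show (φ₁ + φ₂) / 2 = μ + δ by rw [hδ]; ring, dir_add_inner]
  set x := inner ℝ (dir μ) k
  set y := cross (dir μ) k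
  have hxy : x ^ 2 + y ^ 2 ≤ b ^ 2 := by
    rw [inner_sq_add_cross_sq, norm_dir, one_pow, one_mul]
    exact pow_le_pow_left₀ (norm_nonneg _) hk 2
  have hδ0 := abs_nonneg δ
  have hx : x ≤ b := by nlinarith [sq_nonneg y]
  have hα1 : 0 < α := by
    rcases hα0.eq_or_lt with h0 | h0
    · rw [← h0, Real.cos_zero] at h; linarith
    · exact h0
  have hcosδ : 0 < Real.cos |δ| := Real.cos_pos_of_mem_Ioo ⟨by linarith, by linarith⟩
  have hcosα : 0 ≤ Real.cos α := Real.cos_nonneg_of_neg_pi_div_two_le_of_le (by linarith) (by linarith)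
  have hsinα : 0 ≤ Real.sin α := Real.sin_nonneg_of_nonneg_of_le_pi hα0 (by linarith)
  have hsinδ : 0 ≤ Real.sin |δ| := Real.sin_nonneg_of_nonneg_of_le_pi hδ0 (by linarith)
  have hy : |y| ≤ b * Real.sin α := by
    apply abs_le_of_sq_le_sq _ (by positivity)
    have := Real.sin_sq_add_cos_sq α
    have h5 : (b * Real.cos α) ^ 2 ≤ x ^ 2 :=
      pow_le_pow_left₀ (by positivity) (by linarith) 2
    nlinarith
  have hys : -(b * Real.sin α * Real.sin |δ|) ≤ y * Real.sin δ := by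
    have e : |y * Real.sin δ| = |y| * Real.sin |δ| := by
      rw [abs_mul]
      congr 1
      rcases abs_cases δ with ⟨e, _⟩ | ⟨e, _⟩
      · rw [e] at hsinδ ⊢; exact abs_of_nonneg hsinδ
      · rw [e, Real.sin_neg] at hsinδ ⊢; exact abs_of_nonpos (by linarith)
    have := neg_abs_le (y * Real.sin δ)
    rw [e] at this
    have := mul_le_mul_of_nonneg_right hy hsinδ
    linarith
  have hcos : Real.cos θ ≤ Real.cos (|δ| + α) :=
    Real.cos_le_cos_of_nonneg_of_le_pi (by linarith) (by linarith) hδθ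
  rw [Real.cos_add] at hcos
  have h6 := mul_le_mul_of_nonneg_left hcos hb.le
  rw [Real.cos_abs] at hcosδ h6
  have h7 := mul_lt_mul_of_pos_right (sub_pos.1 h) hcosδ
  nlinarith

/-- At half-angles this writes the length gained by an inscribed triangle as a product of sines that
also divides its area, so that their ratio involves only cosines of quarter angles. -/
theorem sin_add_sin_sub_sin (α β : ℝ) : Real.sin α + Real.sin β - Real.sin (α + β) =
    4 * (Real.sin (α / 2) * Real.sin (β / 2) * Real.sin ((α + β) / 2)) := by
  obtain ⟨x, rfl⟩ : ∃ x, α = 2 * x := ⟨α / 2, by ring⟩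
  obtain ⟨y, rfl⟩ : ∃ y, β = 2 * y := ⟨β / 2, by ring⟩
  rw [← mul_add, mul_div_cancel_left₀ _ two_ne_zero, mul_div_cancel_left₀ _ two_ne_zero,
    mul_div_cancel_left₀ _ two_ne_zero, Real.sin_two_mul, Real.sin_two_mul, Real.sin_two_mul,
    Real.sin_add, Real.cos_add]
  have h1 := Real.sin_sq_add_cos_sq x
  have h2 := Real.sin_sq_add_cos_sq y
  have e1 : Real.cos x ^ 2 = 1 - Real.sin x ^ 2 := by linarith
  have e2 : Real.cos y ^ 2 = 1 - Real.sin y ^ 2 := by linarith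
  ring_nf
  rw [e1, e2]
  ring

theorem dist_dir {b φ ψ : ℝ} (hb : 0 ≤ b) (h0 : φ ≤ ψ) (h1 : ψ - φ ≤ 2 * Real.pi) :
    dist (b • dir φ) (b • dir ψ) = 2 * b * Real.sin ((ψ - φ) / 2) := by
  rw [dist_comm, dist_eq_norm, ← smul_sub, norm_smul, norm_dir_sub, Real.norm_eq_abs,
    abs_of_nonneg hb, abs_of_nonneg
      (Real.sin_nonneg_of_nonneg_of_le_pi (by linarith) (by linarith))]
  ring

/-- The length gained by a triangle inscribed in the circle, compared with its area. -/
theorem dist_add_dist_sub_eq {b φ₁ ψ φ₂ : ℝ} (hb : 0 ≤ b) (h1 : φ₁ ≤ ψ) (h2 : ψ ≤ φ₂)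
    (hπ : φ₂ - φ₁ ≤ Real.pi) :
    dist (b • dir φ₁) (b • dir ψ) + dist (b • dir φ₂) (b • dir ψ) -
        dist (b • dir φ₁) (b • dir φ₂) =
      8 * b * (Real.sin ((ψ - φ₁) / 4) * Real.sin ((φ₂ - ψ) / 4) * Real.sin ((φ₂ - φ₁) / 4)) := by
  rw [dist_comm (b • dir φ₂), dist_dir hb h1 (by linarith [Real.pi_pos]),
    dist_dir hb h2 (by linarith [Real.pi_pos]), dist_dir hb (h1.trans h2) (by linarith [Real.pi_pos])]
  have h := sin_add_sin_sub_sin ((ψ - φ₁) / 2) ((φ₂ - ψ) / 2)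
  rw [show (ψ - φ₁) / 2 + (φ₂ - ψ) / 2 = (φ₂ - φ₁) / 2 by ring, div_div, div_div, div_div] at h
  norm_num at h
  linear_combination (2 * b) * h

theorem abs_cross_dir {b φ₁ ψ φ₂ : ℝ} (h1 : φ₁ ≤ ψ) (h2 : ψ ≤ φ₂)
    (hπ : φ₂ - φ₁ ≤ Real.pi) :
    |cross (b • dir φ₂ - b • dir φ₁) (b • dir ψ - b • dir φ₁)| / 2 =
      2 * b ^ 2 * (Real.sin ((ψ - φ₁) / 2) * Real.sin ((φ₂ - ψ) / 2) *
        Real.sin ((φ₂ - φ₁) / 2)) := by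
  have s1 : 0 ≤ Real.sin ((ψ - φ₁) / 2) :=
    Real.sin_nonneg_of_nonneg_of_le_pi (by linarith) (by linarith [Real.pi_pos])
  have s2 : 0 ≤ Real.sin ((φ₂ - ψ) / 2) :=
    Real.sin_nonneg_of_nonneg_of_le_pi (by linarith) (by linarith [Real.pi_pos])
  have s3 : 0 ≤ Real.sin ((φ₂ - φ₁) / 2) :=
    Real.sin_nonneg_of_nonneg_of_le_pi (by linarith) (by linarith [Real.pi_pos])
  rw [cross_chord, chordDist_dir]
  have e : -(2 * b * Real.sin ((φ₂ - φ₁) / 2)) *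
      (2 * b * (Real.sin ((ψ - φ₁) / 2) * Real.sin ((φ₂ - ψ) / 2))) =
      -(4 * b ^ 2 * (Real.sin ((ψ - φ₁) / 2) * Real.sin ((φ₂ - ψ) / 2) *
        Real.sin ((φ₂ - φ₁) / 2))) := by ring
  rw [e, abs_neg, abs_of_nonneg (by positivity)]
  ring

/-- The area of an inscribed triangle in terms of quarter angles. -/
theorem abs_cross_dir' {b φ₁ ψ φ₂ : ℝ} (h1 : φ₁ ≤ ψ) (h2 : ψ ≤ φ₂)
    (hπ : φ₂ - φ₁ ≤ Real.pi) :
    |cross (b • dir φ₂ - b • dir φ₁) (b • dir ψ - b • dir φ₁)| / 2 =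
      16 * b ^ 2 * (Real.sin ((ψ - φ₁) / 4) * Real.sin ((φ₂ - ψ) / 4) *
        Real.sin ((φ₂ - φ₁) / 4)) * (Real.cos ((ψ - φ₁) / 4) * Real.cos ((φ₂ - ψ) / 4) *
        Real.cos ((φ₂ - φ₁) / 4)) := by
  rw [abs_cross_dir h1 h2 hπ, show (ψ - φ₁) / 2 = 2 * ((ψ - φ₁) / 4) by ring,
    show (φ₂ - ψ) / 2 = 2 * ((φ₂ - ψ) / 4) by ring,
    show (φ₂ - φ₁) / 2 = 2 * ((φ₂ - φ₁) / 4) by ring, Real.sin_two_mul, Real.sin_two_mul,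
    Real.sin_two_mul]
  ring

variable {a b lam : ℝ} {K : Set Plane}

/-! ### The second supporting line through an outside point -/

/-- `A` and `B` stand for the inner product and the determinant with a fixed vector of length `|c|`,
and `R` for the norm. On the half-plane `B ≥ 0` the cosine decreases with the angle, so comparing
cosines orders the directions. The split on the sign of `A₂` makes squaring legitimate. -/
theorem det_nonpos_of_cos_le {A₁ B₁ R₁ A₂ B₂ R₂ c : ℝ} (hR₁ : 0 < R₁) (hR₂ : 0 < R₂)
    (h₁ : A₁ ^ 2 + B₁ ^ 2 = (c * R₁) ^ 2) (h₂ : A₂ ^ 2 + B₂ ^ 2 = (c * R₂) ^ 2)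
    (hB₁ : 0 ≤ B₁) (hB₂ : 0 ≤ B₂) (h : A₂ / R₂ ≤ A₁ / R₁) : A₂ * B₁ ≤ A₁ * B₂ := by
  rw [div_le_div_iff₀ hR₂ hR₁] at h
  by_contra! hlt
  have e : (A₂ * B₁) ^ 2 - (A₁ * B₂) ^ 2 = c ^ 2 * ((A₂ * R₁) ^ 2 - (A₁ * R₂) ^ 2) := by
    linear_combination A₂ ^ 2 * h₁ - A₁ ^ 2 * h₂
  rcases lt_or_ge 0 A₂ with hA | hA
  · have hA₁ : 0 < A₁ := by
      by_contra! h0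
      nlinarith [mul_pos hA hR₁]
    have h3 : (A₁ * B₂) ^ 2 < (A₂ * B₁) ^ 2 := pow_lt_pow_left₀ hlt (by positivity) two_ne_zero
    have h4 : (A₂ * R₁) ^ 2 ≤ (A₁ * R₂) ^ 2 := pow_le_pow_left₀ (by positivity) h 2
    nlinarith [sq_nonneg c]
  · have h0 : A₂ * B₁ ≤ 0 := mul_nonpos_of_nonpos_of_nonneg hA hB₁
    have hA₁ : A₁ < 0 := by
      by_contra! h0
      nlinarith [mul_nonneg h0 hB₂]
    have h3 : (A₂ * B₁) ^ 2 < (A₁ * B₂) ^ 2 := by nlinarith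
    have h4 : (A₁ * R₂) ^ 2 ≤ (A₂ * R₁) ^ 2 := by
      have : A₁ * R₂ < 0 := mul_neg_of_neg_of_pos hA₁ hR₂
      nlinarith
    nlinarith [sq_nonneg c]

/-- `X` maximizes over `K` the cosine of the angle between `Z - Y` and `k - Z`. As `K` lies on one
side of the line `YZ`, this extreme direction from `Z` is that of a supporting line. The sign `σ`
records the side. -/
theorem exists_touching_aux (hcpt : IsCompact K) (hc : Convex ℝ K) {Y Z : Plane} (hY : Y ∈ K)
    (hZ : Z ∉ K) {σ : ℝ} (hσ : σ ^ 2 = 1) (hK : ∀ k ∈ K, 0 ≤ σ * cross (Z - Y) (k - Y))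
    {o : Plane} (ho : o ∈ K) (hpos : 0 < σ * cross (Z - Y) (o - Y)) :
    ∃ X ∈ K, cross (Y - X) (Z - X) ≠ 0 ∧ (∀ k ∈ K, 0 ≤ bary Y Z X k) ∧
      ∀ k ∈ K, 0 ≤ bary Z X Y k := by
  set e := Z - Y with he
  have hne : ∀ k ∈ K, 0 < ‖k - Z‖ := fun k hk => norm_pos_iff.2 (sub_ne_zero.2 (by
    rintro rfl; exact hZ hk))
  have hcross : ∀ k : Plane, cross e (k - Y) = cross e (k - Z) := fun k => by
    simp [he, cross]; ring
  simp only [hcross] at hK hpos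
  have hcont : ContinuousOn (fun k : Plane => inner ℝ e (k - Z) / ‖k - Z‖) K := by
    apply ContinuousOn.div
    · fun_prop
    · fun_prop
    · exact fun k hk => (hne k hk).ne'
  obtain ⟨X, hX, hmax⟩ := hcpt.exists_isMaxOn ⟨Y, hY⟩ hcont
  have hsq : ∀ k : Plane, inner ℝ e (k - Z) ^ 2 + (σ * cross e (k - Z)) ^ 2 =
      (‖e‖ * ‖k - Z‖) ^ 2 := fun k => by
    rw [mul_pow, hσ, one_mul, inner_sq_add_cross_sq, mul_pow]
  have hdet : ∀ k ∈ K, inner ℝ e (k - Z) * (σ * cross e (X - Z)) ≤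
      inner ℝ e (X - Z) * (σ * cross e (k - Z)) := fun k hk =>
    det_nonpos_of_cos_le (hne X hX) (hne k hk) (hsq X) (hsq k) (hK X hX) (hK k hk) (hmax hk)
  have he0 : e ≠ 0 := by
    intro h0; rw [h0] at hpos; simp [cross] at hpos
  have heE : 0 < e 0 ^ 2 + e 1 ^ 2 := by
    rw [← norm_sq_eq]; have := norm_pos_iff.2 he0; positivity
  -- `X` is off the line `YZ`: beyond `Z` it would put `Z` between two points of `K`, and on the
  -- other side the cosine would be the least possible, while `o` does better.
  have hXpos : 0 < σ * cross e (X - Z) := by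
    refine (hK X hX).lt_of_ne fun h0 => ?_
    have hc0 : cross e (X - Z) = 0 := by
      refine (mul_eq_zero.1 h0.symm).resolve_left ?_
      rintro rfl; norm_num at hσ
    have hXr : X - Z = (inner ℝ e (X - Z) / (e 0 ^ 2 + e 1 ^ 2)) • e := by
      rw [cross] at hc0
      apply plane_ext
      · rw [PiLp.smul_apply, smul_eq_mul, div_mul_eq_mul_div, eq_div_iff heE.ne', inner_eq]
        linear_combination (-e 1) * hc0
      · rw [PiLp.smul_apply, smul_eq_mul, div_mul_eq_mul_div, eq_div_iff heE.ne', inner_eq]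
        linear_combination e 0 * hc0
    set r := inner ℝ e (X - Z) / (e 0 ^ 2 + e 1 ^ 2) with hr
    rcases lt_or_ge 0 r with hr0 | hr0
    · apply hZ
      have h1r : 1 + r ≠ 0 := by positivity
      have : Z = (1 / (1 + r)) • X + (r / (1 + r)) • Y := by
        have hXe : X = Z + r • (Z - Y) := by rw [← he, ← hXr]; abel
        rw [hXe]
        apply plane_ext <;> simp <;> field_simp <;> ring
      rw [this]
      exact hc hX hY (by positivity) (by positivity) (by field_simp)
    · have h1 := hdet o ho
      rw [← h0, mul_zero] at h1
      have hαX : inner ℝ e (X - Z) < 0 := by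
        have h2 : inner ℝ e (X - Z) = r * (e 0 ^ 2 + e 1 ^ 2) := by
          rw [hr, div_mul_cancel₀ _ heE.ne']
        rw [h2]
        refine mul_neg_of_neg_of_pos (hr0.lt_of_ne ?_) heE
        intro h3
        rw [h3, zero_smul] at hXr
        have := hne X hX
        rw [hXr, norm_zero] at this
        exact this.false
      nlinarith
  have hfac : cross (Y - X) (Z - X) = cross e (X - Z) := by rw [he]; simp [cross]; ring
  have hD : cross (Y - X) (Z - X) ≠ 0 := by
    rw [hfac]; intro h0
    rw [h0, mul_zero] at hXpos
    exact hXpos.false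
  refine ⟨X, hX, hD, fun k hk => ?_, fun k hk => ?_⟩
  · have : bary Y Z X k = (σ * cross e (k - Z)) / (σ * cross e (X - Z)) := by
      rw [mul_div_mul_left _ _ (by rintro rfl; norm_num at hσ), bary, ← hcross, ← hcross]
    rw [this]
    exact div_nonneg (hK k hk) (hK X hX)
  · have e1 : cross (X - Z) (Y - Z) = cross e (X - Z) := by rw [he]; simp [cross]; ring
    have e2 : (e 0 ^ 2 + e 1 ^ 2) * cross (X - Z) (k - Z) =
        inner ℝ e (X - Z) * cross e (k - Z) - inner ℝ e (k - Z) * cross e (X - Z) := by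
      rw [inner_eq, inner_eq, cross, cross, cross]; ring
    have h1 : 0 ≤ σ * cross (X - Z) (k - Z) := by
      have := hdet k hk
      refine nonneg_of_mul_nonneg_right (a := e 0 ^ 2 + e 1 ^ 2) ?_ heE
      rw [mul_left_comm, e2]
      linarith
    have : bary Z X Y k = (σ * cross (X - Z) (k - Z)) / (σ * cross e (X - Z)) := by
      rw [mul_div_mul_left _ _ (by rintro rfl; norm_num at hσ), bary, e1]
    rw [this]
    exact div_nonneg h1 (hK X hX)

/-- From a point `Z` outside `K` on the supporting line at `Y`, there is a second supporting
line. -/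
theorem exists_touching (hcpt : IsCompact K) (hc : Convex ℝ K) {Y Z n : Plane} (hY : Y ∈ K)
    (hZ : Z ∉ K) (hn : ∀ k ∈ K, inner ℝ n k ≤ inner ℝ n Y) (hnZ : inner ℝ n Z = inner ℝ n Y)
    {o : Plane} (ho : o ∈ K) (hno : inner ℝ n o < inner ℝ n Y) :
    ∃ X ∈ K, cross (Y - X) (Z - X) ≠ 0 ∧ (∀ k ∈ K, 0 ≤ bary Y Z X k) ∧
      ∀ k ∈ K, 0 ≤ bary Z X Y k := by
  set e := Z - Y with he
  have he0 : e ≠ 0 := sub_ne_zero.2 (by rintro rfl; exact hZ hY)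
  have heE : 0 < e 0 ^ 2 + e 1 ^ 2 := by
    rw [← norm_sq_eq]; have := norm_pos_iff.2 he0; positivity
  have hne : n 0 * e 0 + n 1 * e 1 = 0 := by
    rw [← inner_eq, he, inner_sub_right, hnZ, sub_self]
  have key : ∀ k : Plane, (e 0 ^ 2 + e 1 ^ 2) * (inner ℝ n k - inner ℝ n Y) =
      cross e n * cross e (k - Y) := by
    intro k
    rw [← inner_sub_right, inner_eq, cross, cross]
    linear_combination (e 0 * (k - Y) 0 + e 1 * (k - Y) 1) * hne
  have hso : cross e n * cross e (o - Y) < 0 := by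
    rw [← key]; exact mul_neg_of_pos_of_neg heE (by linarith)
  have hsk : ∀ k ∈ K, cross e n * cross e (k - Y) ≤ 0 := fun k hk => by
    rw [← key]; exact mul_nonpos_of_nonneg_of_nonpos heE.le (by linarith [hn k hk])
  rcases lt_or_ge 0 (cross e n) with hs | hs
  · refine exists_touching_aux hcpt hc hY hZ (σ := -1) (by norm_num) (fun k hk => ?_) ho ?_
    · have := hsk k hk
      rw [← he]; nlinarith
    · rw [← he]; nlinarith
  · have hs' : cross e n < 0 := hs.lt_of_ne (by intro h0; rw [h0] at hso; simp at hso)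
    refine exists_touching_aux hcpt hc hY hZ (σ := 1) (by norm_num) (fun k hk => ?_) ho ?_
    · have := hsk k hk
      rw [← he]; nlinarith
    · rw [← he]; nlinarith

/-! ### An optimal set does not touch the inner circle -/

/-- A line supporting `K` at `R` also supports `D_a` there; equality in Cauchy–Schwarz makes its
normal radial. -/
theorem inner_le_of_mem_frontier (ha : 0 < a) (hK : K ∈ Admissible a b) {R : Plane}
    (hR : R ∈ frontier K) (hRa : ‖R‖ = a) : ∀ k ∈ K, inner ℝ R k ≤ a ^ 2 := by
  obtain ⟨n, hn, hnK⟩ := exists_normal hK.1 (interior_nonempty_of_admissible ha hK) hR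
  have hn' := norm_pos_iff.2 hn
  have h1 := hnK _ (hK.2.1 (show (a / ‖n‖) • n ∈ closedBall (0 : Plane) a by
    rw [mem_closedBall_zero_iff, norm_smul, norm_div, norm_norm, div_mul_cancel₀ _ hn'.ne',
      Real.norm_eq_abs, abs_of_pos ha]))
  rw [real_inner_smul_right, real_inner_self_eq_norm_sq] at h1
  have h2 : a / ‖n‖ * ‖n‖ ^ 2 = ‖n‖ * ‖R‖ := by rw [hRa]; field_simp
  rw [h2] at h1
  have h3 := inner_eq_norm_mul_iff_real.1 (le_antisymm (real_inner_le_norm n R) h1)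
  intro k hk
  have h4 := hnK k hk
  have h5 : ‖R‖ * inner ℝ n k ≤ ‖R‖ * inner ℝ n R :=
    mul_le_mul_of_nonneg_left h4 (norm_nonneg _)
  rw [← real_inner_smul_left, ← real_inner_smul_left, h3, real_inner_smul_left,
    real_inner_smul_left, real_inner_self_eq_norm_sq, hRa] at h5
  exact le_of_mul_le_mul_left h5 hn'

/-- Put `Z` at the origin, the tangency point `Y` at `(-s, 0)` and `X` at `(α, β)`, with the second
axis along the outward normal; then `hX` says that `X` lies in `D_b`. Multiplication by `q + s + r`
turns the gain into `2 * s * (q - α)`, and `r < q + s` bounds this factor on the area side. What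
remains is `h1`, where the constant `a + b` arises. -/
theorem tangent_corner_gain {s q r α β : ℝ} (ha : 0 < a) (hb : 0 < b) (hs : 0 < s) (hq : 0 < q)
    (hr : 0 ≤ r) (hβ : β < 0) (hs2 : s ^ 2 = b ^ 2 - a ^ 2) (hq2 : q ^ 2 = α ^ 2 + β ^ 2)
    (hr2 : r ^ 2 = (α + s) ^ 2 + β ^ 2) (hX : 2 * a * β + 2 * s * α + q ^ 2 ≤ 0)
    (hlam0 : 0 < lam) (hlam : lam * (a + b) < 1) : lam * (-(s * β) / 2) < q + s - r := by
  have hαq : α < q := by nlinarith [sq_nonneg (α - q), sq_pos_of_neg hβ]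
  have hαq' : -q < α := by
    have := abs_lt_of_sq_lt_sq (show α ^ 2 < q ^ 2 by nlinarith [sq_pos_of_neg hβ]) hq.le
    linarith [(abs_lt.1 (by exact this)).1]
  have hrlt : r < q + s := by
    apply lt_of_pow_lt_pow_left₀ 2 (by positivity)
    nlinarith
  have hprod : (q + s - r) * (q + s + r) = 2 * s * (q - α) := by
    linear_combination hq2 - hr2
  have hcs : -(s * β) + a * α ≤ b * q := by
    apply le_of_sq_le_sq _ (by positivity)
    have : (b * q) ^ 2 = (a * α - s * β) ^ 2 + (a * β + s * α) ^ 2 := by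
      rw [mul_pow, show b ^ 2 = s ^ 2 + a ^ 2 by linarith, hq2]; ring
    nlinarith [sq_nonneg (a * β + s * α)]
  -- After multiplying by `q`: `hX` bounds `q ^ 2`, the factor `q - α` comes from `β ^ 2 = (q - α) *
  -- (q + α)`, and Cauchy–Schwarz against a vector of length `b` (`hcs`) bounds the rest.
  have h1 : -β * (s + q) ≤ 2 * (q - α) * (a + b) := by
    refine le_of_mul_le_mul_left ?_ hq
    have e1 : q * (-β * q) ≤ -β * (-(2 * s * α) - 2 * a * β) := by nlinarith
    have e2 : β ^ 2 = (q - α) * (q + α) := by linarith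
    have e3 : -β * s * (q - 2 * α) ≤ -β * s * (2 * (q - α)) := by
      apply mul_le_mul_of_nonneg_left (by linarith)
      exact mul_nonneg (by linarith) hs.le
    have e4 : 2 * (q - α) * (-(s * β) + a * α + a * q) ≤ 2 * (q - α) * (b * q + a * q) :=
      mul_le_mul_of_nonneg_left (by linarith) (by linarith)
    nlinarith
  have h2 : lam * (-β) * (s + q) < 2 * (q - α) := by
    have : lam * (-β * (s + q)) ≤ lam * (2 * (q - α) * (a + b)) :=
      mul_le_mul_of_nonneg_left h1 hlam0.le
    nlinarith
  have hpos : 0 < q + s + r := by positivity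
  refine lt_of_mul_lt_mul_right ?_ hpos.le
  rw [hprod]
  have h3 : lam * (-β) * (q + s + r) ≤ lam * (-β) * (2 * (s + q)) :=
    mul_le_mul_of_nonneg_left (by linarith) (mul_nonneg hlam0.le (by linarith))
  have h4 : s * (lam * (-β) * (q + s + r)) < s * (4 * (q - α)) :=
    mul_lt_mul_of_pos_left (by linarith) hs
  linarith

variable {a b lam : ℝ} {K : Set Plane}

theorem perp_ne_zero {x : Plane} (hx : x ≠ 0) : perp x ≠ 0 := by
  intro h
  apply hx
  have h0 := congrArg (fun z : Plane => z 0) h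
  have h1 := congrArg (fun z : Plane => z 1) h
  simp only [perp_zero_apply, perp_one_apply, PiLp.zero_apply] at h0 h1
  exact plane_ext (by simpa using h1) (by simpa using h0)

theorem neg_smul_mem_closedBall {r : ℝ} (hr : 0 ≤ r) {ν : Plane} (hν : ν ≠ 0) :
    -(r / ‖ν‖) • ν ∈ closedBall (0 : Plane) r := by
  rw [mem_closedBall_zero_iff, norm_smul, norm_neg, norm_div, norm_norm,
    div_mul_cancel₀ _ (norm_ne_zero_iff.2 hν), Real.norm_eq_abs, abs_of_nonneg hr]

theorem inner_neg_smul_self {r : ℝ} {ν : Plane} (hν : ν ≠ 0) :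
    inner ℝ ν (-(r / ‖ν‖) • ν) = -(r * ‖ν‖) := by
  have := norm_ne_zero_iff.2 hν
  rw [real_inner_smul_right, real_inner_self_eq_norm_sq]
  field_simp

/-- If an optimal set touches the inner circle, then it contains the whole tangent chord. -/
theorem tangent_endpoint_mem (ha : 0 < a) (hab : a < b) (hlam0 : 0 < lam)
    (hlam : lam * (a + b) < 1) (hK : IsOptimal a b lam K) (hcl : IsClosed K) {e : Plane}
    (he : ‖e‖ = 1) {σ s : ℝ} (hσ : σ ^ 2 = 1) (hs : 0 < s) (hs2 : s ^ 2 = b ^ 2 - a ^ 2)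
    (hKe : ∀ k ∈ K, inner ℝ e k ≤ a) : a • e + s • σ • perp e ∈ K := by
  have hb : 0 < b := ha.trans hab
  have hcpt : IsCompact K := Metric.isCompact_of_isClosed_isBounded hcl
    (isBounded_closedBall.subset hK.1.2.2)
  have hee : e 0 ^ 2 + e 1 ^ 2 = 1 := by rw [← norm_sq_eq, he, one_pow]
  set Y := a • e with hY
  set Z := Y + s • σ • perp e with hZ
  have hYK : Y ∈ K := hK.1.2.1 (by
    rw [mem_closedBall_zero_iff, hY, norm_smul, he, Real.norm_eq_abs, abs_of_pos ha, mul_one])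
  have heY : inner ℝ e Y = a := by
    rw [hY, real_inner_smul_right, real_inner_self_eq_norm_sq, he]; ring
  have heZ : inner ℝ e Z = a := by
    rw [hZ, inner_add_right, heY, real_inner_smul_right, real_inner_smul_right, inner_eq]
    simp; ring_nf; simp
  have hZ2 : ‖Z‖ ^ 2 = b ^ 2 := by
    rw [norm_sq_eq, hZ, hY]
    simp
    linear_combination (a ^ 2 + s ^ 2) * hee + s ^ 2 * (e 0 ^ 2 + e 1 ^ 2) * hσ + hs2
  have hZb : Z ∈ closedBall (0 : Plane) b := by
    rw [mem_closedBall_zero_iff]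
    exact le_of_sq_le_sq hZ2.le hb.le
  by_contra hZK
  obtain ⟨X, hX, hD, hu, hv⟩ := exists_touching hcpt hK.convex (n := e) hYK hZK
    (by rwa [heY]) (by rw [heY, heZ]) (hK.1.2.1 (mem_closedBall_self ha.le))
    (by rw [inner_zero_right, heY]; exact ha)
  have hcorner : IsCorner K X Y Z := by
    refine ⟨hX, hYK, hD, hu, hv, ?_⟩
    -- If `K` lay entirely on the side of `Z`, the line `XY` would support `D_a` at `Y`. It would
    -- then be the tangent line and contain `Z`.
    by_contra! hneg
    set ν := sideNormal X Y Z with hν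
    have hw : ∀ k, bary X Y Z k = inner ℝ ν k - inner ℝ ν Y := fun k => by
      rw [bary_eq_sideNormal, IsCorner.inner_right]
    have hwZ : inner ℝ ν Z - inner ℝ ν Y = 1 := by rw [← hw, bary_self_right hD]
    have hν0 : ν ≠ 0 := by intro h0; rw [h0] at hwZ; simp at hwZ
    have h1 := hneg _ (hK.1.2.1 (neg_smul_mem_closedBall ha.le hν0))
    rw [hw, inner_neg_smul_self hν0, hY, real_inner_smul_right] at h1
    have h2 : inner ℝ (-ν) e = ‖-ν‖ * ‖e‖ := by
      refine le_antisymm (real_inner_le_norm _ _) ?_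
      rw [he, norm_neg, inner_neg_left, mul_one]
      nlinarith
    have h3 := inner_eq_norm_mul_iff_real.1 h2
    rw [he, one_smul, norm_neg] at h3
    have h4 : inner ℝ (-ν) Z - inner ℝ (-ν) Y = 0 := by
      rw [h3, real_inner_smul_left, real_inner_smul_left, heZ, heY, sub_self]
    rw [inner_neg_left, inner_neg_left] at h4
    linarith
  have hgain := hcorner.sub_le_of_notMem ha hb hK hcl hZb hZK hlam0.le
  -- Coordinates of `X - Z` as in `tangent_corner_gain`: `α` along the tangent from `Y` to `Z`, `β`
  -- along the outward normal.
  set β := inner ℝ e (X - Z) with hβ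
  set α := σ * cross e (X - Z) with hα
  have hDβ : cross (Y - X) (Z - X) = -(s * σ * β) := by
    rw [hβ, inner_eq, hZ]; simp [cross]; ring
  have hβ0 : β < 0 := by
    refine lt_of_le_of_ne ?_ ?_
    · rw [hβ, inner_sub_right, heZ]; linarith [hKe X hX]
    · intro h0; rw [hDβ, h0] at hD; simp at hD
  have hσ1 : |σ| = 1 := by rw [← sq_eq_sq₀ (abs_nonneg _) zero_le_one, sq_abs, hσ, one_pow]
  have hDabs : |cross (Y - X) (Z - X)| = -(s * β) := by
    rw [hDβ, abs_neg, abs_mul, abs_mul, hσ1, abs_of_pos hs, abs_of_neg hβ0]; ring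
  have hframe : ∀ x : Plane, ‖x‖ ^ 2 = (σ * cross e x) ^ 2 + inner ℝ e x ^ 2 := fun x => by
    have := inner_sq_add_cross_sq e x
    rw [he] at this
    rw [mul_pow, hσ]; linarith
  have hdYZ : dist Y Z = s := by
    rw [dist_comm, dist_eq_norm, hZ, add_sub_cancel_left, norm_smul, norm_smul, Real.norm_eq_abs,
      Real.norm_eq_abs, hσ1, abs_of_pos hs]
    have : ‖perp e‖ = 1 := by
      rw [← sq_eq_sq₀ (norm_nonneg _) zero_le_one, norm_sq_eq]; simp; linarith
    rw [this]; ring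
  have hq2 : dist X Z ^ 2 = α ^ 2 + β ^ 2 := by rw [dist_eq_norm, hframe]
  have hr2 : dist X Y ^ 2 = (α + s) ^ 2 + β ^ 2 := by
    rw [dist_eq_norm, hframe]
    congr 2
    · rw [hα, show X - Y = X - Z + s • σ • perp e by rw [hZ]; abel]
      simp [cross]
      linear_combination s * hee * σ ^ 2 + s * hσ
    · rw [hβ, inner_sub_right, inner_sub_right, heY, heZ]
  have hXb : 2 * a * β + 2 * s * α + dist X Z ^ 2 ≤ 0 := by
    have h1 : ‖X‖ ^ 2 ≤ b ^ 2 :=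
      pow_le_pow_left₀ (norm_nonneg _) (mem_closedBall_zero_iff.1 (hK.1.2.2 hX)) 2
    have h2 : ‖X‖ ^ 2 = ‖Z‖ ^ 2 + 2 * inner ℝ Z (X - Z) + ‖X - Z‖ ^ 2 := by
      rw [← norm_add_sq_real, add_sub_cancel]
    have h3 : inner ℝ Z (X - Z) = a * β + s * α := by
      generalize X - Z = x at *
      rw [hβ, hα, hZ, hY, inner_eq, inner_eq]; simp [cross]; ring
    rw [h2, hZ2, h3] at h1
    rw [dist_eq_norm]; linarith
  have hqpos : 0 < dist X Z := dist_pos.2 (by rintro rfl; exact hZK hX)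
  have := tangent_corner_gain ha hb hs hqpos dist_nonneg hβ0 hs2 hq2 hr2 hXb hlam0 hlam
  rw [hDabs, hdYZ] at hgain
  linarith

/-- An optimal set does not touch the inner circle. -/
theorem norm_ne_of_mem_frontier (ha : 0 < a) (hab : a < b) (hlam0 : 0 < lam)
    (hlam : lam * (a + b) < 1) (hK : IsOptimal a b lam K) (hcl : IsClosed K) {R : Plane}
    (hR : R ∈ frontier K) : ‖R‖ ≠ a := by
  intro hRa
  have hb : 0 < b := ha.trans hab
  have hKR := inner_le_of_mem_frontier ha hK.1 hR hRa
  obtain ⟨m, hm⟩ := exists_dir_eq (x := a⁻¹ • R) (by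
    rw [norm_smul, hRa, norm_inv, Real.norm_eq_abs, abs_of_pos ha, inv_mul_cancel₀ ha.ne'])
  have hKe : ∀ k ∈ K, inner ℝ (dir m) k ≤ a := fun k hk => by
    rw [← hm, real_inner_smul_left, inv_mul_le_iff₀ ha, ← sq]; exact hKR k hk
  set ω := Real.arccos (a / b) with hω
  have hab1 : a / b < 1 := (div_lt_one hb).2 hab
  have hab0 : 0 < a / b := div_pos ha hb
  have hcosω : Real.cos ω = a / b := Real.cos_arccos (by linarith) hab1.le
  have hω0 : 0 < ω := Real.arccos_pos.2 hab1
  have hω1 : ω < Real.pi / 2 := Real.arccos_lt_pi_div_two.2 hab0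
  have hsinω : 0 < Real.sin ω := Real.sin_pos_of_pos_of_lt_pi hω0 (by linarith)
  have hbcos : b * Real.cos ω = a := by rw [hcosω, mul_div_cancel₀ _ hb.ne']
  have hs2 : (b * Real.sin ω) ^ 2 = b ^ 2 - a ^ 2 := by
    rw [← hbcos, mul_pow, Real.sin_sq]; ring
  have hmem : ∀ σ : ℝ, σ ^ 2 = 1 → a • dir m + (b * Real.sin ω) • σ • perp (dir m) ∈ K :=
    fun σ hσ => tangent_endpoint_mem ha hab hlam0 hlam hK hcl (norm_dir m) hσ (by positivity) hs2 hKe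
  have hW₁ : b • dir (m - ω) ∈ K := by
    convert hmem (-1) (by norm_num) using 1
    apply plane_ext <;> simp [Real.cos_sub, Real.sin_sub, ← hbcos] <;> ring
  have hW₂ : b • dir (m + ω) ∈ K := by
    convert hmem 1 (by norm_num) using 1
    apply plane_ext <;> simp [Real.cos_add, Real.sin_add, ← hbcos] <;> ring
  -- `η` is the arc between the new vertex and one end of the tangent chord. At `η = 0` the
  -- expression is `2 * b * lam * cos (ω / 2) ^ 2 = lam * (a + b)`, so small `η` work by continuity.
  obtain ⟨η, hη0, hη1, hη⟩ : ∃ η : ℝ, 0 < η ∧ η < 2 * ω ∧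
      2 * b * lam * (Real.cos ((2 * ω - η) / 4) * Real.cos (η / 4) * Real.cos (ω / 2)) < 1 := by
    have hf : Continuous fun η : ℝ =>
        2 * b * lam * (Real.cos ((2 * ω - η) / 4) * Real.cos (η / 4) * Real.cos (ω / 2)) := by
      fun_prop
    have h0 : 2 * b * lam * (Real.cos ((2 * ω - 0) / 4) * Real.cos (0 / 4) * Real.cos (ω / 2)) <
        1 := by
      have h1 : Real.cos ω = 2 * Real.cos (ω / 2) ^ 2 - 1 := by
        rw [← Real.cos_two_mul]; ring_nf
      rw [show (2 * ω - 0) / 4 = ω / 2 by ring, zero_div, Real.cos_zero]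
      have : 2 * b * lam * (Real.cos (ω / 2) * 1 * Real.cos (ω / 2)) = lam * (a + b) := by
        rw [← hbcos, h1]; ring
      rw [this]; exact hlam
    have h1 := (hf.tendsto 0).eventually (gt_mem_nhds h0)
    have h2 : ∀ᶠ η in nhdsWithin (0 : ℝ) (Set.Ioi 0), η < 2 * ω :=
      (gt_mem_nhds (by linarith : (0 : ℝ) < 2 * ω)).filter_mono nhdsWithin_le_nhds
    obtain ⟨η, hη, hη1, hη0⟩ :=
      ((h1.filter_mono nhdsWithin_le_nhds).and (h2.and self_mem_nhdsWithin)).exists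
    exact ⟨η, hη0, hη1, hη⟩
  set φ₁ := m - ω with hφ₁
  set φ₂ := m + ω with hφ₂
  set ψ := φ₂ - η with hψ
  have hπ : φ₂ - φ₁ < Real.pi := by linarith
  have h1ψ : φ₁ < ψ := by linarith
  have h2ψ : ψ < φ₂ := by linarith
  have hchord : ∀ k, chordDist b φ₁ φ₂ k = inner ℝ (dir m) k - a := fun k => by
    rw [chordDist, show (φ₁ + φ₂) / 2 = m by rw [hφ₁, hφ₂]; ring,
      show (φ₂ - φ₁) / 2 = ω by rw [hφ₁, hφ₂]; ring, hbcos]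
  have hsp : ∀ x : ℝ, 0 < x → x < Real.pi → 0 < Real.sin x := fun x =>
    Real.sin_pos_of_pos_of_lt_pi
  have s1 := hsp ((ψ - φ₁) / 2) (by linarith) (by linarith)
  have s2 := hsp ((φ₂ - ψ) / 2) (by linarith) (by linarith)
  have s3 := hsp ((φ₂ - φ₁) / 2) (by linarith) (by linarith)
  have hZpos : 0 < chordDist b φ₁ φ₂ (b • dir ψ) := by
    rw [chordDist_dir]; positivity
  -- `K` has no point beyond the tangent chord, hence none beyond a chord over a smaller arc: the
  -- new sides support `K`.
  have hnest : ∀ k ∈ K, ∀ x y : ℝ, φ₁ ≤ x → x ≤ y → y ≤ φ₂ → chordDist b x y k ≤ 0 := by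
    intro k hk x y hx hxy hy
    by_contra! hpos
    have := chordDist_pos_of_le hb (hK.1.2.2 hk) hx hxy hy hπ.le hpos
    rw [hchord] at this
    linarith [hKe k hk]
  have hcorner : IsCorner K (b • dir φ₁) (b • dir φ₂) (b • dir ψ) := by
    refine ⟨hW₁, hW₂, ?_, fun k hk => ?_, fun k hk => ?_, ⟨0, hK.1.2.1 (mem_closedBall_self ha.le),
      ?_⟩⟩
    · rw [cross_chord]
      have : 0 < 2 * b * Real.sin ((φ₂ - φ₁) / 2) * chordDist b φ₁ φ₂ (b • dir ψ) := by positivity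
      linarith
    · rw [bary_chord hb.ne' (by
        rw [show (ψ - φ₂) / 2 = -((φ₂ - ψ) / 2) by ring, Real.sin_neg]; exact neg_ne_zero.2 s2.ne')]
      apply div_nonneg_of_nonpos
      · rw [chordDist_comm]; exact hnest k hk _ _ h1ψ.le h2ψ.le le_rfl
      · rw [chordDist_comm]; exact hnest _ hW₁ _ _ h1ψ.le h2ψ.le le_rfl
    · rw [bary_chord hb.ne' (by
        rw [show (φ₁ - ψ) / 2 = -((ψ - φ₁) / 2) by ring, Real.sin_neg]; exact neg_ne_zero.2 s1.ne')]
      apply div_nonneg_of_nonpos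
      · rw [chordDist_comm]; exact hnest k hk _ _ le_rfl h1ψ.le h2ψ.le
      · rw [chordDist_comm]; exact hnest _ hW₂ _ _ le_rfl h1ψ.le h2ψ.le
    · rw [bary_chord hb.ne' s3.ne']
      apply div_neg_of_neg_of_pos _ hZpos
      rw [hchord, inner_zero_right]; linarith
  have hZK : b • dir ψ ∉ K := fun h => by
    have := hKe _ h
    rw [hchord] at hZpos; linarith
  have hZb : b • dir ψ ∈ closedBall (0 : Plane) b := by
    rw [mem_closedBall_zero_iff, norm_smul, norm_dir, Real.norm_eq_abs, abs_of_pos hb, mul_one]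
  have hgain := hcorner.sub_le_of_notMem ha hb hK hcl hZb hZK hlam0.le
  rw [dist_add_dist_sub_eq hb.le h1ψ.le h2ψ.le hπ.le, abs_cross_dir' h1ψ.le h2ψ.le hπ.le] at hgain
  rw [show (ψ - φ₁) / 4 = (2 * ω - η) / 4 by rw [hψ, hφ₁, hφ₂]; ring,
    show (φ₂ - ψ) / 4 = η / 4 by rw [hψ]; ring,
    show (φ₂ - φ₁) / 4 = ω / 2 by rw [hφ₁, hφ₂]; ring] at hgain
  have t1 := hsp ((2 * ω - η) / 4) (by linarith) (by linarith)
  have t2 := hsp (η / 4) (by linarith) (by linarith)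
  have t3 := hsp (ω / 2) (by linarith) (by linarith)
  set S := Real.sin ((2 * ω - η) / 4) * Real.sin (η / 4) * Real.sin (ω / 2)
  have hS : 0 < 8 * b * S := by positivity
  nlinarith

/-! ### Extreme points lie on the outer circle -/

theorem exists_closedBall_subset (ha : 0 < a) (hab : a < b) (hlam0 : 0 < lam)
    (hlam : lam * (a + b) < 1) (hK : IsOptimal a b lam K) (hcl : IsClosed K) :
    ∃ a' > a, closedBall (0 : Plane) a' ⊆ K := by
  have hsub : closedBall (0 : Plane) a ⊆ interior K := by
    intro x hx
    by_contra hxi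
    have hxK := hK.1.2.1 hx
    have hxf : x ∈ frontier K := ⟨subset_closure hxK, hxi⟩
    have hxa := mem_closedBall_zero_iff.1 hx
    refine norm_ne_of_mem_frontier ha hab hlam0 hlam hK hcl hxf (le_antisymm hxa ?_)
    by_contra! hlt
    exact hxi (interior_mono hK.1.2.1 (ball_subset_interior_closedBall (by simpa using hlt)))
  obtain ⟨δ, hδ, h⟩ := (isCompact_closedBall (0 : Plane) a).exists_cthickening_subset_open
    isOpen_interior hsub
  refine ⟨δ + a, by linarith, ?_⟩
  rw [← cthickening_closedBall hδ.le ha.le]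
  exact h.trans interior_subset

theorem mem_frontier_of_inner_max {n : Plane} (hn : n ≠ 0) {x : Plane} (hx : x ∈ K)
    (h : ∀ k ∈ K, inner ℝ n k ≤ inner ℝ n x) : x ∈ frontier K := by
  refine ⟨subset_closure hx, notMem_interior_of_ray (d := n) fun t ht h' => ?_⟩
  have h2 := h _ h'
  rw [inner_add_right, real_inner_smul_right, real_inner_self_eq_norm_sq] at h2
  have := norm_pos_iff.2 hn
  have : 0 < t * ‖n‖ ^ 2 := by positivity
  linarith

/-- A short corner on a supporting line of an optimal set is cut off by a supporting line. -/
theorem exists_flat_corner {a' : ℝ} (ha : 0 < a) (hb : 0 < b) (hlam0 : 0 < lam)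
    (hK : IsOptimal a b lam K) (hcl : IsClosed K) (haa' : a < a')
    (ha'K : closedBall (0 : Plane) a' ⊆ K) {Y Z n : Plane} (hn : n ≠ 0) (hY : Y ∈ K) (hZ : Z ∉ K)
    (hnK : ∀ k ∈ K, inner ℝ n k ≤ inner ℝ n Y) (hnZ : inner ℝ n Z = inner ℝ n Y)
    (hZb : ‖Z‖ ≤ b) (hYZ : ‖Y - Z‖ < a' - a) :
    ∃ X, IsCorner K X Y Z ∧ ∀ k ∈ K, bary X Y Z k ≤ 0 := by
  have hcpt : IsCompact K := Metric.isCompact_of_isClosed_isBounded hcl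
    (isBounded_closedBall.subset hK.1.2.2)
  have ha'0 : 0 < a' := ha.trans haa'
  have h0 : (0 : Plane) ∈ K := ha'K (mem_closedBall_self ha'0.le)
  have hnY : 0 < inner ℝ n Y := by
    have h1 := hnK _ (ha'K (neg_smul_mem_closedBall ha'0.le (neg_ne_zero.2 hn)))
    have h2 := inner_neg_smul_self (r := a') (neg_ne_zero.2 hn)
    rw [inner_neg_left] at h2
    have := norm_pos_iff.2 (neg_ne_zero.2 hn)
    have : 0 < a' * ‖-n‖ := by positivity
    linarith
  obtain ⟨X, hX, hD, hu, hv⟩ := exists_touching hcpt hK.convex hY hZ hnK hnZ h0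
    (by rwa [inner_zero_right])
  have hD2 := IsCorner.cross_ne' (IsCorner.cross_ne' hD)
  set μ := sideNormal Z X Y with hμ
  have hvμ : ∀ k, bary Z X Y k = inner ℝ μ k - inner ℝ μ Z := bary_eq_sideNormal Z X Y
  have hvY : inner ℝ μ (Y - Z) = 1 := by
    rw [inner_sub_right, ← hvμ, bary_self_right hD2]
  have hμ0 : μ ≠ 0 := by intro h; rw [h] at hvY; simp at hvY
  have hμpos := norm_pos_iff.2 hμ0
  -- The coordinate at `Y` changes by `1` between `Z` and `Y`, so its gradient `μ` satisfies `‖μ‖ *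
  -- ‖Y - Z‖ ≥ 1`. Being nonnegative on the disc of radius `a'`, it is at least `‖μ‖ * (a' - a) > 1`
  -- on `D_a`, whereas a point beyond `XY` would have it at most `1`.
  have hneg : ∀ d ∈ closedBall (0 : Plane) a, bary X Y Z d < 0 := by
    intro d hd
    by_contra! hw
    have hdK := hK.1.2.1 hd
    have hs := bary_sum hD d
    have hv1 : bary Z X Y d ≤ 1 := by linarith [hu d hdK]
    have h1 := hv _ (ha'K (neg_smul_mem_closedBall ha'0.le hμ0))
    rw [hvμ, inner_neg_smul_self hμ0] at h1
    rw [hvμ] at hv1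
    have h2 : -(‖μ‖ * a) ≤ inner ℝ μ d := by
      have h3 := neg_le_of_abs_le (abs_real_inner_le_norm μ d)
      have h4 := mul_le_mul_of_nonneg_left (mem_closedBall_zero_iff.1 hd) hμpos.le
      linarith
    have h5 := real_inner_le_norm μ (Y - Z)
    have h6 := mul_lt_mul_of_pos_left hYZ hμpos
    nlinarith
  have hcorner : IsCorner K X Y Z :=
    ⟨hX, hY, hD, hu, hv, 0, h0, hneg 0 (mem_closedBall_self ha.le)⟩
  exact ⟨X, hcorner, hcorner.bary_nonpos_of_notMem ha hb hK hcl (mem_closedBall_zero_iff.2 hZb) hZ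
    hlam0 fun k hk => (hneg k hk).le⟩

/-- Take `Y` and `Z` at equal small distances from `Q` on the line of the segment, with `Z` on the
outer side. Extremality keeps `Z` out of `K`, and the corner at `Z` is flat; but `Q`, the midpoint
of `YZ`, has height `1 / 2` in it. -/
theorem extreme_not_endpoint {a' : ℝ} (ha : 0 < a) (hb : 0 < b) (hlam0 : 0 < lam)
    (hK : IsOptimal a b lam K) (hcl : IsClosed K) (haa' : a < a')
    (ha'K : closedBall (0 : Plane) a' ⊆ K) {Q R : Plane} (hQ : Q ∈ Set.extremePoints ℝ K)
    (hQb : ‖Q‖ < b) (hR : R ∈ K) (hQR : Q ≠ R) (hseg : segment ℝ Q R ⊆ frontier K) : False := by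
  obtain ⟨n, hn, hnK⟩ := exists_normal hK.convex (interior_nonempty_of_admissible ha hK.1)
    (hseg (⟨1 / 2, 1 / 2, by norm_num, by norm_num, by norm_num, rfl⟩ :
      (1 / 2 : ℝ) • Q + (1 / 2 : ℝ) • R ∈ segment ℝ Q R))
  rw [inner_add_right, real_inner_smul_right, real_inner_smul_right] at hnK
  have hnQR : inner ℝ n Q = inner ℝ n R := by
    have := hnK Q hQ.1
    have := hnK R hR
    linarith
  have hd : 0 < ‖R - Q‖ := norm_pos_iff.2 (sub_ne_zero.2 hQR.symm)
  obtain ⟨ε, hε0, hε⟩ : ∃ ε : ℝ, 0 < ε ∧ ε < min 1 (min ((a' - a) / (2 * ‖R - Q‖))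
      ((b - ‖Q‖) / ‖R - Q‖)) :=
    exists_between (lt_min one_pos (lt_min (div_pos (by linarith) (by positivity))
      (div_pos (by linarith) hd)))
  rw [lt_min_iff, lt_min_iff, lt_div_iff₀ (by positivity), lt_div_iff₀ hd] at hε
  obtain ⟨hε1, hε2, hε3⟩ := hε
  set Y := Q + ε • (R - Q) with hY
  set Z := Q - ε • (R - Q) with hZ
  have hYK : Y ∈ K := by
    have : Y = (1 - ε) • Q + ε • R := by rw [hY]; module
    rw [this]
    exact hK.convex hQ.1 hR (by linarith) hε0.le (by ring)
  have hmid : Q = (1 / 2 : ℝ) • Y + (1 / 2 : ℝ) • Z := by rw [hY, hZ]; module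
  have hZK : Z ∉ K := by
    intro h
    have h1 := (mem_extremePoints.1 hQ).2 Y hYK Z h
      ⟨1 / 2, 1 / 2, by norm_num, by norm_num, by norm_num, hmid.symm⟩
    have h2 : ε • (R - Q) = 0 := by
      have h3 := h1.1
      rw [hY] at h3
      exact add_eq_left.1 h3
    rcases smul_eq_zero.1 h2 with h3 | h3
    · exact hε0.ne' h3
    · exact hQR (sub_eq_zero.1 h3).symm
  have hnY : inner ℝ n Y = inner ℝ n Q := by
    rw [hY, inner_add_right, real_inner_smul_right, inner_sub_right, hnQR]; ring
  have hnZ : inner ℝ n Z = inner ℝ n Q := by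
    rw [hZ, inner_sub_right, real_inner_smul_right, inner_sub_right, hnQR]; ring
  have hnorm : ‖ε • (R - Q)‖ = ε * ‖R - Q‖ := by rw [norm_smul, Real.norm_eq_abs, abs_of_pos hε0]
  obtain ⟨X, hcorner, hflat⟩ := exists_flat_corner ha hb hlam0 hK hcl haa' ha'K hn hYK hZK
    (fun k hk => by have := hnK k hk; rw [hnY]; linarith) (by rw [hnY, hnZ])
    (by
      have := norm_sub_le Q (ε • (R - Q))
      rw [← hZ, hnorm] at this; linarith)
    (by
      rw [show Y - Z = (2 : ℝ) • ε • (R - Q) by rw [hY, hZ]; module, norm_smul, hnorm]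
      norm_num; linarith)
  have h1 := hflat Q hQ.1
  have h2 : bary X Y Z Q = 1 / 2 := by
    have e := bary_comb X Y Z Y Z (s := 1 / 2) (t := 1 / 2) (by norm_num)
    rw [← hmid] at e
    rw [e, bary_self_mid, bary_self_right hcorner.cross_ne]
    norm_num
  linarith

/-- The extreme points of an optimal set lie on the outer circle. -/
theorem norm_eq_of_mem_extremePoints (ha : 0 < a) (hab : a < b) (hlam0 : 0 < lam)
    (hlam : lam * (a + b) < 1) (hK : IsOptimal a b lam K) (hcl : IsClosed K) {Q : Plane}
    (hQ : Q ∈ Set.extremePoints ℝ K) : ‖Q‖ = b := by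
  have hb : 0 < b := ha.trans hab
  obtain ⟨a', haa', ha'K⟩ := exists_closedBall_subset ha hab hlam0 hlam hK hcl
  refine le_antisymm (mem_closedBall_zero_iff.1 (hK.1.2.2 hQ.1)) ?_
  by_contra! hQb
  have hQf : Q ∈ frontier K := ⟨subset_closure hQ.1, fun hi =>
    Set.disjoint_left.1 (disjoint_interior_extremePoints K) hi hQ⟩
  obtain ⟨n, hn, hnK⟩ := exists_normal hK.convex (interior_nonempty_of_admissible ha hK.1) hQf
  have hp : 0 < ‖perp n‖ := norm_pos_iff.2 (perp_ne_zero hn)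
  obtain ⟨ε, hε0, hε⟩ : ∃ ε : ℝ, 0 < ε ∧ ε < min ((a' - a) / ‖perp n‖) ((b - ‖Q‖) / ‖perp n‖) :=
    exists_between (lt_min (div_pos (by linarith) hp) (div_pos (by linarith) hp))
  rw [lt_min_iff, lt_div_iff₀ hp, lt_div_iff₀ hp] at hε
  have hnorm : ‖ε • perp n‖ = ε * ‖perp n‖ := by rw [norm_smul, Real.norm_eq_abs, abs_of_pos hε0]
  set Z := Q + ε • perp n with hZ
  have hnZ : inner ℝ n Z = inner ℝ n Q := by
    rw [hZ, inner_add_right, real_inner_smul_right, inner_eq n (perp n)]; simp; right; ring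
  have hQZ : Q ≠ Z := by
    intro h
    have h1 : ε • perp n = 0 := by rw [hZ] at h; simpa using h
    rw [h1, norm_zero] at hnorm
    have := mul_pos hε0 hp
    linarith
  -- In either case `Q` ends a boundary segment: the segment `QZ` if `Z ∈ K`, and otherwise the base
  -- `QX` of the flat corner at `Z`.
  by_cases hZK : Z ∈ K
  · refine extreme_not_endpoint ha hb hlam0 hK hcl haa' ha'K hQ hQb hZK hQZ fun k hk => ?_
    refine mem_frontier_of_inner_max hn (hK.convex.segment_subset hQ.1 hZK hk) fun j hj => ?_
    obtain ⟨s, t, _, _, hst, rfl⟩ := hk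
    rw [inner_add_right, real_inner_smul_right, real_inner_smul_right, hnZ, ← add_mul, hst, one_mul]
    exact hnK j hj
  · obtain ⟨X, hcorner, hflat⟩ := exists_flat_corner ha hb hlam0 hK hcl haa' ha'K hn hQ.1 hZK hnK
      hnZ (by have := norm_add_le Q (ε • perp n); rw [hnorm] at this; linarith)
      (by rw [hZ, sub_add_cancel_left, norm_neg, hnorm]; exact hε.1)
    refine extreme_not_endpoint ha hb hlam0 hK hcl haa' ha'K hQ hQb hcorner.left_mem
      hcorner.ne_left_right.symm fun k hk => ?_
    refine mem_frontier_of_inner_max hcorner.sideNormal_ne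
      (hK.convex.segment_subset hQ.1 hcorner.left_mem hk) fun j hj => ?_
    have h1 := hflat j hj
    obtain ⟨s, t, _, _, hst, rfl⟩ := hk
    rw [bary_eq_sideNormal] at h1
    rw [inner_add_right, real_inner_smul_right, real_inner_smul_right, IsCorner.inner_right,
      ← add_mul, hst, one_mul]
    linarith

/-! ### Caps over arcs of the outer circle -/

theorem chordDist_dir_eq (b φ ψ t : ℝ) : chordDist b φ ψ (b • dir t) =
    b * (Real.cos |t - (φ + ψ) / 2| - Real.cos ((ψ - φ) / 2)) := by
  rw [chordDist, real_inner_smul_right, inner_dir, Real.cos_abs, ← Real.cos_neg, neg_sub]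
  ring

theorem exists_mem_Ioo_of_chordDist_pos {b φ ψ : ℝ} (hb : 0 < b) (h0 : φ ≤ ψ)
    {x : Plane} (hx : ‖x‖ = b) (h : 0 < chordDist b φ ψ x) : ∃ t ∈ Set.Ioo φ ψ, x = b • dir t := by
  obtain ⟨t, rfl, ht⟩ := exists_dir_eq_near hb hx ((φ + ψ) / 2)
  refine ⟨t, ?_, rfl⟩
  rw [chordDist_dir_eq] at h
  have h2 : |t - (φ + ψ) / 2| < (ψ - φ) / 2 := by
    by_contra! hlt
    have := Real.cos_le_cos_of_nonneg_of_le_pi (by linarith) ht hlt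
    nlinarith
  rw [abs_lt] at h2
  exact ⟨by linarith [h2.1], by linarith [h2.2]⟩

theorem exists_mem_Icc_of_chordDist_nonneg {b φ ψ : ℝ} (hb : 0 < b) (h0 : φ ≤ ψ)
    {x : Plane} (hx : ‖x‖ = b) (h : 0 ≤ chordDist b φ ψ x) : ∃ t ∈ Set.Icc φ ψ, b • dir t = x := by
  obtain ⟨t, rfl, ht⟩ := exists_dir_eq_near hb hx ((φ + ψ) / 2)
  refine ⟨t, ?_, rfl⟩
  rw [chordDist_dir_eq] at h
  have h2 : |t - (φ + ψ) / 2| ≤ (ψ - φ) / 2 := by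
    by_contra! hlt
    have := Real.cos_lt_cos_of_nonneg_of_le_pi (by linarith) ht hlt
    nlinarith
  rw [abs_le] at h2
  exact ⟨by linarith [h2.1], by linarith [h2.2]⟩

theorem mem_segment_of_chordDist_eq_zero {b φ ψ : ℝ} (hb : 0 < b) (h0 : φ ≤ ψ)
    (hπ : ψ - φ ≤ Real.pi) {k : Plane} (hk : k ∈ closedBall (0 : Plane) b)
    (h : chordDist b φ ψ k = 0) : k ∈ segment ℝ (b • dir φ) (b • dir ψ) := by
  rw [mem_closedBall_zero_iff] at hk
  obtain ⟨μ, hμ⟩ : ∃ μ, μ = (φ + ψ) / 2 := ⟨_, rfl⟩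
  obtain ⟨θ, hθ⟩ : ∃ θ, θ = (ψ - φ) / 2 := ⟨_, rfl⟩
  obtain rfl : φ = μ - θ := by rw [hμ, hθ]; ring
  obtain rfl : ψ = μ + θ := by rw [hμ, hθ] at *; linarith
  have hs : 0 ≤ Real.sin θ := Real.sin_nonneg_of_nonneg_of_le_pi (by linarith) (by linarith)
  rw [chordDist, ← hμ, ← hθ] at h
  set x := inner ℝ (dir μ) k with hx
  set y := cross (dir μ) k with hy
  have hxy : x ^ 2 + y ^ 2 ≤ b ^ 2 := by
    rw [inner_sq_add_cross_sq, norm_dir, one_pow, one_mul]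
    exact pow_le_pow_left₀ (norm_nonneg _) hk 2
  have hsc := Real.sin_sq_add_cos_sq θ
  have hyb : |y| ≤ b * Real.sin θ := by
    apply abs_le_of_sq_le_sq _ (by positivity)
    have h5 : x ^ 2 = (b * Real.cos θ) ^ 2 := by rw [sub_eq_zero.1 h]
    nlinarith
  obtain ⟨r, hr, hry⟩ : ∃ r : ℝ, |r| ≤ 1 ∧ y = r * (b * Real.sin θ) := by
    rcases hs.eq_or_lt with h1 | h1
    · rw [← h1, mul_zero] at hyb
      exact ⟨0, by simp, by rw [zero_mul]; exact abs_nonpos_iff.1 hyb⟩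
    · have h2 : 0 < b * Real.sin θ := by positivity
      refine ⟨y / (b * Real.sin θ), ?_, (div_mul_cancel₀ _ h2.ne').symm⟩
      rw [abs_div, abs_of_pos h2, div_le_one h2]; exact hyb
  rw [abs_le] at hr
  refine ⟨(1 - r) / 2, (1 + r) / 2, by linarith, by linarith, by ring, ?_⟩
  have hx' : x = b * Real.cos θ := by linarith
  rw [inner_eq] at hx
  simp only [cross, dir_zero_apply, dir_one_apply] at hx hy
  have hμ1 := Real.sin_sq_add_cos_sq μ
  have e0 : k 0 = x * Real.cos μ - y * Real.sin μ := by
    rw [hx, hy]; linear_combination (-(k 0)) * hμ1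
  have e1 : k 1 = x * Real.sin μ + y * Real.cos μ := by
    rw [hx, hy]; linear_combination (-(k 1)) * hμ1
  apply plane_ext
  · rw [e0, hx', hry]
    simp only [PiLp.add_apply, PiLp.smul_apply, dir_zero_apply, smul_eq_mul, Real.cos_add,
      Real.cos_sub]
    ring
  · rw [e1, hx', hry]
    simp only [PiLp.add_apply, PiLp.smul_apply, dir_one_apply, smul_eq_mul, Real.sin_add,
      Real.sin_sub]
    ring

/-- The length of the boundary of `K` beyond the chord between the arguments `φ` and `ψ`. -/
def arcLength (K : Set Plane) (b φ ψ : ℝ) : ℝ :=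
  capLength K (dir ((φ + ψ) / 2)) (b * Real.cos ((ψ - φ) / 2))

/-- The area of `K` beyond the chord between the arguments `φ` and `ψ`. -/
def arcArea (K : Set Plane) (b φ ψ : ℝ) : ℝ :=
  capArea K (dir ((φ + ψ) / 2)) (b * Real.cos ((ψ - φ) / 2))

theorem arcLength_eq (K : Set Plane) (b φ ψ : ℝ) :
    arcLength K b φ ψ = (μH[1] (frontier K ∩ {k | 0 ≤ chordDist b φ ψ k})).toReal := by
  simp only [arcLength, capLength, chordDist, sub_nonneg]

theorem arcArea_eq (K : Set Plane) (b φ ψ : ℝ) :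
    arcArea K b φ ψ = (volume (K ∩ {k | 0 < chordDist b φ ψ k})).toReal := by
  simp only [arcArea, capArea, chordDist, sub_pos]

@[fun_prop]
theorem continuous_chordDist (b φ ψ : ℝ) : Continuous (chordDist b φ ψ) := by
  unfold chordDist; fun_prop

section Arc

variable {a b φ ψ : ℝ} {K : Set Plane}

theorem arcLength_le_dist (hb : 0 < b) (hKb : K ⊆ closedBall 0 b) (hcl : IsClosed K) (h0 : φ ≤ ψ)
    (hπ : ψ - φ ≤ Real.pi) (h : ∀ k ∈ K, chordDist b φ ψ k ≤ 0) :
    arcLength K b φ ψ ≤ dist (b • dir φ) (b • dir ψ) := by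
  rw [arcLength_eq]
  refine ENNReal.toReal_le_of_le_ofReal dist_nonneg ?_
  rw [← edist_dist, ← hausdorffMeasure_segment]
  refine measure_mono ?_
  rintro k ⟨hk, hk0⟩
  have hkK := hcl.frontier_subset hk
  exact mem_segment_of_chordDist_eq_zero hb h0 hπ (hKb hkK) (le_antisymm (h k hkK) hk0)

/-- The circular arc and the chord enclose the cap, so the projection argument bounds its boundary
length by the circular arc. -/
theorem arcLength_le (hb : 0 < b) (hc : Convex ℝ K) (hcl : IsClosed K)
    (hi : (interior K).Nonempty) (hKb : K ⊆ closedBall 0 b) (h0K : (0 : Plane) ∈ K)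
    (h0 : φ < ψ) (hπ : ψ - φ < Real.pi) (hφ : b • dir φ ∈ K) (hψ : b • dir ψ ∈ K) :
    arcLength K b φ ψ ≤ b * (ψ - φ) := by
  by_cases h : ∀ k ∈ K, chordDist b φ ψ k ≤ 0
  · refine (arcLength_le_dist hb hKb hcl h0.le hπ.le h).trans ?_
    rw [dist_dir hb.le h0.le (by linarith)]
    have := Real.sin_le (x := (ψ - φ) / 2) (by linarith)
    nlinarith
  push Not at h
  obtain ⟨p, hp, hpos⟩ := h
  have hd0 : dist (b • dir φ) (b • dir ψ) ≠ 0 := by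
    rw [dist_dir hb.le h0.le (by linarith)]
    have := Real.sin_pos_of_pos_of_lt_pi (x := (ψ - φ) / 2) (by linarith) (by linarith)
    positivity
  have hcos : 0 < Real.cos ((ψ - φ) / 2) :=
    Real.cos_pos_of_mem_Ioo ⟨by linarith, by linarith⟩
  have hL := chordDist_left b φ ψ
  have hR := chordDist_right b φ ψ
  rw [chordDist, sub_eq_zero] at hL hR
  rw [chordDist, sub_pos] at hpos
  refine ENNReal.toReal_le_of_le_ofReal (mul_nonneg hb.le (by linarith))
    ((hausdorffMeasure_cap_le hc hcl hi
      (B := closedBall 0 b ∩ {k | 0 ≤ chordDist b φ ψ k})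
      (S := (fun φ => b • dir φ) '' Set.Icc φ ψ)
      (isBounded_closedBall.subset Set.inter_subset_left) (fun k hk hkm => ⟨hKb hk, ?_⟩) ?_ hφ hψ
      ⟨φ, ⟨le_rfl, h0.le⟩, rfl⟩ ⟨ψ, ⟨h0.le, le_rfl⟩, rfl⟩ (dist_ne_zero.1 hd0) hL hR hp hpos h0K
      (by rw [inner_zero_right]; positivity)).trans (hausdorffMeasure_arc_le hb.le _ _))
  · exact sub_nonneg.2 hkm
  · rintro k ⟨hk, hki⟩
    have hclB : IsClosed (closedBall (0 : Plane) b ∩ {k | 0 ≤ chordDist b φ ψ k}) :=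
      isClosed_closedBall.inter (isClosed_le continuous_const (by fun_prop))
    rw [hclB.closure_eq] at hk
    obtain ⟨hkb, hk0⟩ := hk
    rw [Set.mem_ofPred_eq] at hk0
    rcases hk0.eq_or_lt with h1 | h1
    · exact Or.inr (mem_segment_of_chordDist_eq_zero hb h0.le hπ.le hkb h1.symm)
    · refine Or.inl (exists_mem_Icc_of_chordDist_nonneg hb h0.le ?_ hk0)
      rw [mem_closedBall_zero_iff] at hkb
      refine hkb.eq_of_not_lt fun hlt => hki ?_
      refine mem_interior.2 ⟨ball 0 b ∩ {k | 0 < chordDist b φ ψ k}, ?_,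
        isOpen_ball.inter (isOpen_lt continuous_const (by fun_prop)),
        mem_ball_zero_iff.2 hlt, h1⟩
      exact Set.inter_subset_inter ball_subset_closedBall fun j (hj : 0 < chordDist b φ ψ j) => hj.le

/-- By Krein–Milman it suffices to test extreme points; these lie on the circle, and beyond the
chord only the excluded arc remains. -/
theorem chordDist_nonpos_of_forall (hb : 0 < b) (h0 : φ ≤ ψ) (hcpt : IsCompact K)
    (hc : Convex ℝ K) (hext : ∀ e ∈ Set.extremePoints ℝ K, ‖e‖ = b)
    (hgap : ∀ t ∈ Set.Ioo φ ψ, b • dir t ∉ K) : ∀ k ∈ K, chordDist b φ ψ k ≤ 0 := by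
  have h1 : closure (convexHull ℝ (Set.extremePoints ℝ K)) ⊆ {k | chordDist b φ ψ k ≤ 0} := by
    refine closure_minimal (convexHull_min (fun e he => ?_) ?_)
      (isClosed_le (by fun_prop) continuous_const)
    · by_contra hlt
      rw [Set.mem_ofPred_eq, not_le] at hlt
      obtain ⟨t, ht, rfl⟩ := exists_mem_Ioo_of_chordDist_pos hb h0 (hext e he) hlt
      exact hgap t ht he.1
    · simp only [chordDist, sub_nonpos]
      exact convex_halfSpace_le (innerₛₗ ℝ _).isLinear _
  rw [closure_convexHull_extremePoints hcpt hc] at h1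
  exact h1

/-- The inner product with `dir ψ` is at most `b`, so a positive chord distance must come from the
cross term. With the mirror statement below, this separates the circular segments over adjacent
arcs. -/
theorem cross_neg_of_chordDist_pos (h0 : φ ≤ ψ) (hπ : ψ - φ ≤ Real.pi) {k : Plane}
    (hk : k ∈ closedBall (0 : Plane) b) (h : 0 < chordDist b φ ψ k) : cross (dir ψ) k < 0 := by
  rw [mem_closedBall_zero_iff] at hk
  rw [chordDist, show (φ + ψ) / 2 = ψ + -((ψ - φ) / 2) by ring, dir_add_inner, Real.cos_neg,
    Real.sin_neg] at h
  have hu : inner ℝ (dir ψ) k ≤ b := by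
    have := real_inner_le_norm (dir ψ) k
    rw [norm_dir, one_mul] at this
    linarith
  have hs : 0 ≤ Real.sin ((ψ - φ) / 2) :=
    Real.sin_nonneg_of_nonneg_of_le_pi (by linarith) (by linarith)
  have hc : 0 ≤ Real.cos ((ψ - φ) / 2) :=
    Real.cos_nonneg_of_neg_pi_div_two_le_of_le (by linarith) (by linarith)
  by_contra! hv
  nlinarith [mul_nonneg hv hs, mul_nonneg (sub_nonneg.2 hu) hc]

theorem cross_pos_of_chordDist_pos (h0 : φ ≤ ψ) (hπ : ψ - φ ≤ Real.pi) {k : Plane}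
    (hk : k ∈ closedBall (0 : Plane) b) (h : 0 < chordDist b φ ψ k) : 0 < cross (dir φ) k := by
  rw [mem_closedBall_zero_iff] at hk
  rw [chordDist, show (φ + ψ) / 2 = φ + (ψ - φ) / 2 by ring, dir_add_inner] at h
  have hu : inner ℝ (dir φ) k ≤ b := by
    have := real_inner_le_norm (dir φ) k
    rw [norm_dir, one_mul] at this
    linarith
  have hs : 0 ≤ Real.sin ((ψ - φ) / 2) :=
    Real.sin_nonneg_of_nonneg_of_le_pi (by linarith) (by linarith)
  have hc : 0 ≤ Real.cos ((ψ - φ) / 2) :=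
    Real.cos_nonneg_of_neg_pi_div_two_le_of_le (by linarith) (by linarith)
  by_contra! hv
  nlinarith [mul_nonneg (neg_nonneg.2 hv) hs, mul_nonneg (sub_nonneg.2 hu) hc]

end Arc

/-! ### Excess of length over weighted area -/

/-- The excess of the boundary of `K` beyond a chord, with area weight `ρ`. -/
def excess (K : Set Plane) (b ρ φ ψ : ℝ) : ℝ :=
  arcLength K b φ ψ - dist (b • dir φ) (b • dir ψ) - ρ * arcArea K b φ ψ

section Excess

variable {a b ρ φ₁ ψ φ₂ : ℝ} {K : Set Plane}

theorem arcLength_nonneg : 0 ≤ arcLength K b φ₁ φ₂ := ENNReal.toReal_nonneg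

theorem arcArea_nonneg : 0 ≤ arcArea K b φ₁ φ₂ := ENNReal.toReal_nonneg

theorem chordDist_dir_pos (hb : 0 < b) (h1 : φ₁ < ψ) (h2 : ψ < φ₂) (hπ : φ₂ - φ₁ ≤ Real.pi) :
    0 < chordDist b φ₁ φ₂ (b • dir ψ) := by
  rw [chordDist_dir]
  have s1 := Real.sin_pos_of_pos_of_lt_pi (x := (ψ - φ₁) / 2) (by linarith) (by linarith)
  have s2 := Real.sin_pos_of_pos_of_lt_pi (x := (φ₂ - ψ) / 2) (by linarith) (by linarith)
  positivity

theorem chordDist_dir_left_neg (hb : 0 < b) (h1 : φ₁ < ψ) (h2 : ψ < φ₂)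
    (hπ : φ₂ - φ₁ ≤ Real.pi) : chordDist b ψ φ₂ (b • dir φ₁) < 0 := by
  rw [chordDist_dir, show (φ₁ - ψ) / 2 = -((ψ - φ₁) / 2) by ring, Real.sin_neg]
  have s1 := Real.sin_pos_of_pos_of_lt_pi (x := (ψ - φ₁) / 2) (by linarith) (by linarith)
  have s2 := Real.sin_pos_of_pos_of_lt_pi (x := (φ₂ - φ₁) / 2) (by linarith) (by linarith)
  have : 0 < 2 * b * (Real.sin ((ψ - φ₁) / 2) * Real.sin ((φ₂ - φ₁) / 2)) := by positivity
  linarith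

theorem chordDist_dir_right_neg (hb : 0 < b) (h1 : φ₁ < ψ) (h2 : ψ < φ₂)
    (hπ : φ₂ - φ₁ ≤ Real.pi) : chordDist b φ₁ ψ (b • dir φ₂) < 0 := by
  rw [chordDist_dir, show (ψ - φ₂) / 2 = -((φ₂ - ψ) / 2) by ring, Real.sin_neg]
  have s1 := Real.sin_pos_of_pos_of_lt_pi (x := (φ₂ - ψ) / 2) (by linarith) (by linarith)
  have s2 := Real.sin_pos_of_pos_of_lt_pi (x := (φ₂ - φ₁) / 2) (by linarith) (by linarith)
  have : 0 < 2 * b * (Real.sin ((φ₂ - φ₁) / 2) * Real.sin ((φ₂ - ψ) / 2)) := by positivity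
  linarith

/-- The triangle with vertices on the circle, described by its three chords. -/
theorem mem_tri_dir (hb : 0 < b) (h1 : φ₁ < ψ) (h2 : ψ < φ₂) (hπ : φ₂ - φ₁ ≤ Real.pi)
    (k : Plane) : k ∈ tri (b • dir φ₁) (b • dir φ₂) (b • dir ψ) ↔
      0 ≤ chordDist b φ₁ φ₂ k ∧ chordDist b φ₁ ψ k ≤ 0 ∧ chordDist b ψ φ₂ k ≤ 0 := by
  have s1 := Real.sin_pos_of_pos_of_lt_pi (x := (ψ - φ₁) / 2) (by linarith) (by linarith)
  have s2 := Real.sin_pos_of_pos_of_lt_pi (x := (φ₂ - ψ) / 2) (by linarith) (by linarith)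
  have s3 := Real.sin_pos_of_pos_of_lt_pi (x := (φ₂ - φ₁) / 2) (by linarith) (by linarith)
  have s2' : Real.sin ((ψ - φ₂) / 2) ≠ 0 := by
    rw [show (ψ - φ₂) / 2 = -((φ₂ - ψ) / 2) by ring, Real.sin_neg]; exact neg_ne_zero.2 s2.ne'
  have s1' : Real.sin ((φ₁ - ψ) / 2) ≠ 0 := by
    rw [show (φ₁ - ψ) / 2 = -((ψ - φ₁) / 2) by ring, Real.sin_neg]; exact neg_ne_zero.2 s1.ne'
  simp only [tri, Set.mem_ofPred_eq]
  rw [bary_chord hb.ne' s2', bary_chord hb.ne' s1', bary_chord hb.ne' s3.ne',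
    chordDist_comm b φ₂ ψ, chordDist_comm b ψ φ₁, chordDist_comm b φ₂ ψ, chordDist_comm b ψ φ₁,
    le_div_iff₀ (chordDist_dir_pos hb h1 h2 hπ),
    le_div_iff_of_neg (chordDist_dir_left_neg hb h1 h2 hπ),
    le_div_iff_of_neg (chordDist_dir_right_neg hb h1 h2 hπ), zero_mul, zero_mul, zero_mul]
  tauto

theorem cross_dir_ne_zero (hb : 0 < b) (h1 : φ₁ < ψ) (h2 : ψ < φ₂) (hπ : φ₂ - φ₁ ≤ Real.pi) :
    cross (b • dir φ₂ - b • dir φ₁) (b • dir ψ - b • dir φ₁) ≠ 0 := by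
  rw [cross_chord]
  have s3 := Real.sin_pos_of_pos_of_lt_pi (x := (φ₂ - φ₁) / 2) (by linarith) (by linarith)
  have := chordDist_dir_pos hb h1 h2 hπ
  have : 0 < 2 * b * Real.sin ((φ₂ - φ₁) / 2) := by positivity
  exact mul_ne_zero (neg_ne_zero.2 this.ne') (by linarith)

/-- A point beyond the long chord but strictly behind both short ones stays in the inscribed
triangle when pushed slightly away from the centre. The pushed point is in `K` and `0` is interior,
so the original point is interior too. -/
theorem frontier_inter_subset (ha : 0 < a) (hb : 0 < b) (hK : K ∈ Admissible a b)
    (h1 : φ₁ < ψ) (h2 : ψ < φ₂) (hπ : φ₂ - φ₁ ≤ Real.pi)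
    (hX : b • dir φ₁ ∈ K) (hM : b • dir ψ ∈ K) (hY : b • dir φ₂ ∈ K) :
    frontier K ∩ {k | 0 ≤ chordDist b φ₁ φ₂ k} ⊆
      (frontier K ∩ {k | 0 ≤ chordDist b φ₁ ψ k}) ∪
        (frontier K ∩ {k | 0 ≤ chordDist b ψ φ₂ k}) := by
  rintro k ⟨hk, hk0⟩
  rw [Set.mem_ofPred_eq] at hk0
  by_contra hne
  simp only [Set.mem_union, Set.mem_inter_iff, hk, true_and, Set.mem_ofPred_eq, not_or, not_le]
    at hne
  obtain ⟨hn1, hn2⟩ := hne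
  have hev : ∀ α β : ℝ, chordDist b α β k < 0 →
      ∀ᶠ ε : ℝ in nhdsWithin 0 (Set.Ioi 0), chordDist b α β ((1 + ε) • k) < 0 := by
    intro α β h
    refine (Filter.Tendsto.eventually_lt_const h (f := fun ε : ℝ => chordDist b α β ((1 + ε) • k))
      ?_)
    have hc : Continuous fun ε : ℝ => chordDist b α β ((1 + ε) • k) := by fun_prop
    have := hc.tendsto 0
    rw [add_zero, one_smul] at this
    exact this.mono_left nhdsWithin_le_nhds
  obtain ⟨ε, hε1, hε2, hε⟩ := ((hev _ _ hn1).and ((hev _ _ hn2).and self_mem_nhdsWithin)).exists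
  have hε : 0 < ε := hε
  have hin : 0 ≤ inner ℝ (dir ((φ₁ + φ₂) / 2)) k := by
    have : 0 ≤ Real.cos ((φ₂ - φ₁) / 2) :=
      Real.cos_nonneg_of_neg_pi_div_two_le_of_le (by linarith) (by linarith)
    rw [chordDist] at hk0
    have := mul_nonneg hb.le this
    linarith
  have hmem : (1 + ε) • k ∈ K := by
    refine tri_subset (cross_dir_ne_zero hb h1 h2 hπ) hK.1 hX hY hM
      ((mem_tri_dir hb h1 h2 hπ _).2 ⟨?_, hε1.le, hε2.le⟩)
    rw [chordDist] at hk0 ⊢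
    rw [real_inner_smul_right]
    nlinarith
  have h0 : (0 : Plane) ∈ interior K :=
    interior_mono hK.2.1 (ball_subset_interior_closedBall (mem_ball_self ha))
  refine hk.2 ?_
  have := hK.1.combo_interior_self_mem_interior h0 hmem (a := 1 - (1 + ε)⁻¹) (b := (1 + ε)⁻¹)
    (by rw [sub_pos]; exact inv_lt_one_of_one_lt₀ (by linarith)) (by positivity) (by ring)
  rwa [smul_zero, zero_add, smul_smul, inv_mul_cancel₀ (by positivity), one_smul] at this

theorem arcLength_le_add (ha : 0 < a) (hb : 0 < b) (hK : K ∈ Admissible a b)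
    (hcl : IsClosed K) (h1 : φ₁ < ψ) (h2 : ψ < φ₂) (hπ : φ₂ - φ₁ ≤ Real.pi)
    (hX : b • dir φ₁ ∈ K) (hM : b • dir ψ ∈ K) (hY : b • dir φ₂ ∈ K) :
    arcLength K b φ₁ φ₂ ≤ arcLength K b φ₁ ψ + arcLength K b ψ φ₂ := by
  have hlt := perimeter_lt_top ha hb hK hcl
  have hf : ∀ s, μH[1] (frontier K ∩ s) ≠ ⊤ := fun s =>
    ((measure_mono Set.inter_subset_left).trans_lt hlt).ne
  rw [arcLength_eq, arcLength_eq, arcLength_eq, ← ENNReal.toReal_add (hf _) (hf _)]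
  exact ENNReal.toReal_mono (ENNReal.add_ne_top.2 ⟨hf _, hf _⟩)
    ((measure_mono (frontier_inter_subset ha hb hK h1 h2 hπ hX hM hY)).trans
      (measure_union_le _ _))

/-- The two small caps and the inscribed triangle are disjoint pieces of the large cap. -/
theorem arcArea_add_le (hb : 0 < b) (hK : K ∈ Admissible a b)
    (hcl : IsClosed K) (h1 : φ₁ < ψ) (h2 : ψ < φ₂) (hπ : φ₂ - φ₁ ≤ Real.pi)
    (hX : b • dir φ₁ ∈ K) (hM : b • dir ψ ∈ K) (hY : b • dir φ₂ ∈ K) :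
    arcArea K b φ₁ ψ + arcArea K b ψ φ₂ +
      |cross (b • dir φ₂ - b • dir φ₁) (b • dir ψ - b • dir φ₁)| / 2 ≤ arcArea K b φ₁ φ₂ := by
  have hlt := volume_lt_top_of_admissible hK
  have hf : ∀ s, volume (K ∩ s) ≠ ⊤ := fun s =>
    ((measure_mono Set.inter_subset_left).trans_lt hlt).ne
  have hD := cross_dir_ne_zero hb h1 h2 hπ
  have hms : ∀ α β, MeasurableSet {k | 0 < chordDist b α β k} := fun α β =>
    (isOpen_lt continuous_const (by fun_prop)).measurableSet
  have hL := chordDist_left b φ₁ φ₂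
  have hR := chordDist_right b φ₁ φ₂
  have hV := chordDist_dir_pos hb h1 h2 hπ
  set T := tri (b • dir φ₁) (b • dir φ₂) (b • dir ψ) with hT
  have hvT : volume (T ∩ {k | 0 < chordDist b φ₁ φ₂ k}) =
      ENNReal.ofReal (|cross (b • dir φ₂ - b • dir φ₁) (b • dir ψ - b • dir φ₁)| / 2) := by
    simp only [chordDist, sub_pos]
    rw [chordDist, sub_eq_zero] at hL hR
    rw [chordDist, sub_pos] at hV
    exact IsCorner.volume_tri_inter hD (fun h => by simpa [h] using norm_dir ((φ₁ + φ₂) / 2))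
      hL hR hV.le
  have hd1 : Disjoint (K ∩ {k | 0 < chordDist b φ₁ ψ k}) (K ∩ {k | 0 < chordDist b ψ φ₂ k}) := by
    rw [Set.disjoint_left]
    rintro k ⟨hk, hk1⟩ ⟨_, hk2⟩
    have c1 := cross_neg_of_chordDist_pos h1.le (by linarith) (hK.2.2 hk) hk1
    have c2 := cross_pos_of_chordDist_pos h2.le (by linarith) (hK.2.2 hk) hk2
    linarith
  have hd2 : Disjoint ((K ∩ {k | 0 < chordDist b φ₁ ψ k}) ∪ (K ∩ {k | 0 < chordDist b ψ φ₂ k}))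
      (T ∩ {k | 0 < chordDist b φ₁ φ₂ k}) := by
    rw [Set.disjoint_left]
    rintro k hk ⟨hkT, _⟩
    obtain ⟨_, t1, t2⟩ := (mem_tri_dir hb h1 h2 hπ k).1 hkT
    rcases hk with ⟨_, hk⟩ | ⟨_, hk⟩
    · exact t1.not_gt hk
    · exact t2.not_gt hk
  have hsub : ((K ∩ {k | 0 < chordDist b φ₁ ψ k}) ∪ (K ∩ {k | 0 < chordDist b ψ φ₂ k})) ∪
      (T ∩ {k | 0 < chordDist b φ₁ φ₂ k}) ⊆ K ∩ {k | 0 < chordDist b φ₁ φ₂ k} := by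
    rintro k ((⟨hk, hk1⟩ | ⟨hk, hk1⟩) | ⟨hk, hk1⟩)
    · exact ⟨hk, chordDist_pos_of_le hb (hK.2.2 hk) le_rfl h1.le h2.le hπ hk1⟩
    · exact ⟨hk, chordDist_pos_of_le hb (hK.2.2 hk) h1.le h2.le le_rfl hπ hk1⟩
    · exact ⟨tri_subset hD hK.1 hX hY hM hk, hk1⟩
  have hmain := measure_mono (μ := volume) hsub
  rw [measure_union hd2 ((isClosed_tri _ _ _).measurableSet.inter (hms _ _)),
    measure_union hd1 (hcl.measurableSet.inter (hms _ _)), hvT] at hmain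
  have := ENNReal.toReal_mono (hf _) hmain
  rwa [ENNReal.toReal_add (ENNReal.add_ne_top.2 ⟨hf _, hf _⟩) ENNReal.ofReal_ne_top,
    ENNReal.toReal_add (hf _) (hf _), ENNReal.toReal_ofReal (by positivity), ← arcArea_eq,
    ← arcArea_eq, ← arcArea_eq] at this

/-- Serves the degenerate splittings in `excess_le_add`: beyond a tangent line of `D_b` there is no
area, and the length is nonnegative. -/
theorem excess_self_nonneg (hKb : K ⊆ closedBall 0 b) (φ : ℝ) : 0 ≤ excess K b ρ φ φ := by
  have hA : arcArea K b φ φ = 0 := by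
    rw [arcArea_eq]
    have : K ∩ {k | 0 < chordDist b φ φ k} = ∅ := by
      ext k
      simp only [Set.mem_inter_iff, Set.mem_ofPred_eq, Set.mem_empty_iff_false, iff_false, not_and,
        not_lt]
      intro hk
      have h1 := mem_closedBall_zero_iff.1 (hKb hk)
      have h2 := real_inner_le_norm (dir ((φ + φ) / 2)) k
      rw [norm_dir, one_mul] at h2
      rw [chordDist, sub_self, zero_div, Real.cos_zero]
      linarith
    rw [this]; simp
  have := arcLength_nonneg (K := K) (b := b) (φ₁ := φ) (φ₂ := φ)
  rw [excess, hA, dist_self]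
  linarith

/-- The excess is subadditive when the area weight is large enough for short chords. -/
theorem excess_le_add {θ : ℝ} (ha : 0 < a) (hb : 0 < b) (hK : K ∈ Admissible a b)
    (hcl : IsClosed K) (hθ : θ ≤ Real.pi) (hρ0 : 0 ≤ ρ)
    (hρ : 1 ≤ 2 * b * ρ * Real.cos (θ / 4) ^ 3) (h1 : φ₁ ≤ ψ) (h2 : ψ ≤ φ₂)
    (hφ : φ₂ - φ₁ ≤ θ) (hX : b • dir φ₁ ∈ K) (hM : b • dir ψ ∈ K) (hY : b • dir φ₂ ∈ K) :
    excess K b ρ φ₁ φ₂ ≤ excess K b ρ φ₁ ψ + excess K b ρ ψ φ₂ := by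
  rcases h1.eq_or_lt with rfl | h1
  · linarith [excess_self_nonneg (ρ := ρ) hK.2.2 φ₁]
  rcases h2.eq_or_lt with rfl | h2
  · linarith [excess_self_nonneg (ρ := ρ) hK.2.2 ψ]
  have hπ := hφ.trans hθ
  have hlen := arcLength_le_add ha hb hK hcl h1 h2 hπ hX hM hY
  have harea := arcArea_add_le hb hK hcl h1 h2 hπ hX hM hY
  have htri := dist_add_dist_sub_eq hb.le h1.le h2.le hπ
  rw [dist_comm (b • dir φ₂)] at htri
  rw [abs_cross_dir' h1.le h2.le hπ] at harea
  have hcos : ∀ x, 0 ≤ x → x ≤ θ / 4 → Real.cos (θ / 4) ≤ Real.cos x := fun x hx hxθ =>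
    Real.cos_le_cos_of_nonneg_of_le_pi hx (by linarith) hxθ
  have hcθ : 0 ≤ Real.cos (θ / 4) :=
    Real.cos_nonneg_of_neg_pi_div_two_le_of_le (by linarith) (by linarith)
  have hc : Real.cos (θ / 4) ^ 3 ≤ Real.cos ((ψ - φ₁) / 4) * Real.cos ((φ₂ - ψ) / 4) *
      Real.cos ((φ₂ - φ₁) / 4) := by
    rw [pow_succ, pow_two]
    have k1 := hcos ((ψ - φ₁) / 4) (by linarith) (by linarith)
    have k2 := hcos ((φ₂ - ψ) / 4) (by linarith) (by linarith)
    have k3 := hcos ((φ₂ - φ₁) / 4) (by linarith) (by linarith)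
    exact mul_le_mul (mul_le_mul k1 k2 hcθ (hcθ.trans k1)) k3 hcθ
      (mul_nonneg (hcθ.trans k1) (hcθ.trans k2))
  set C := Real.cos ((ψ - φ₁) / 4) * Real.cos ((φ₂ - ψ) / 4) * Real.cos ((φ₂ - φ₁) / 4)
  have hs : 0 ≤ Real.sin ((ψ - φ₁) / 4) * Real.sin ((φ₂ - ψ) / 4) * Real.sin ((φ₂ - φ₁) / 4) := by
    refine mul_nonneg (mul_nonneg ?_ ?_) ?_ <;>
      exact Real.sin_nonneg_of_nonneg_of_le_pi (by linarith) (by linarith)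
  set S := Real.sin ((ψ - φ₁) / 4) * Real.sin ((φ₂ - ψ) / 4) * Real.sin ((φ₂ - φ₁) / 4)
  have h5 : 1 ≤ 2 * b * ρ * C := hρ.trans (by gcongr)
  have h6 := mul_le_mul_of_nonneg_left harea hρ0
  -- Splitting at `ψ` adds `8 * b * S` to the chord lengths and accounts for the triangle area `16 *
  -- b ^ 2 * S * C`; weighted by `ρ`, the area outweighs the length since `2 * b * ρ * C ≥ 1`.
  have h7 := mul_le_mul_of_nonneg_left h5 (mul_nonneg (mul_nonneg (by norm_num : (0:ℝ) ≤ 8) hb.le) hs)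
  unfold excess
  nlinarith

end Excess

/-! ### Short arcs carry at most two points: finitely many extreme points -/

section Finite

variable {a b lam ρ θ φ₁ φ₂ : ℝ} {K : Set Plane}

theorem excess_nonpos_of_forall (hb : 0 < b) (hρ0 : 0 ≤ ρ) (hK : K ∈ Admissible a b)
    (hcl : IsClosed K) (hext : ∀ e ∈ Set.extremePoints ℝ K, ‖e‖ = b) (h0 : φ₁ ≤ φ₂)
    (hπ : φ₂ - φ₁ ≤ Real.pi) (hgap : ∀ t ∈ Set.Ioo φ₁ φ₂, b • dir t ∉ K) :
    excess K b ρ φ₁ φ₂ ≤ 0 := by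
  have hcpt : IsCompact K := Metric.isCompact_of_isClosed_isBounded hcl
    (isBounded_closedBall.subset hK.2.2)
  have h := arcLength_le_dist hb hK.2.2 hcl h0 hπ
    (chordDist_nonpos_of_forall hb h0 hcpt hK.1 hext hgap)
  have := mul_nonneg hρ0 (arcArea_nonneg (K := K) (b := b) (φ₁ := φ₁) (φ₂ := φ₂))
  rw [excess]
  linarith

/-- The boundary beyond the chord is at most `b * δ` long with `δ = φ₂ - φ₁`, the chord `2 * b * sin
(δ / 2)` is at least `b * δ - b * δ ^ 3 / 24`, and the area term only helps. -/
theorem excess_le_cube (ha : 0 < a) (hb : 0 < b) (hρ0 : 0 ≤ ρ) (hK : K ∈ Admissible a b)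
    (hcl : IsClosed K) (h0 : φ₁ ≤ φ₂) (h2 : φ₂ - φ₁ ≤ 2) (hX : b • dir φ₁ ∈ K)
    (hY : b • dir φ₂ ∈ K) (hself : excess K b ρ φ₁ φ₁ ≤ 0) :
    excess K b ρ φ₁ φ₂ ≤ b / 24 * (φ₂ - φ₁) ^ 3 := by
  rcases h0.eq_or_lt with rfl | h0
  · simpa using hself
  have hπ := Real.pi_gt_three
  have h := arcLength_le hb hK.1 hcl (interior_nonempty_of_admissible ha hK) hK.2.2
    (hK.2.1 (mem_closedBall_self ha.le)) h0 (by linarith) hX hY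
  have hd := dist_dir hb.le h0.le (by linarith)
  have hs := Real.sin_gt_sub_cube (x := (φ₂ - φ₁) / 2) (by linarith)
  have := mul_nonneg hρ0 (arcArea_nonneg (K := K) (b := b) (φ₁ := φ₁) (φ₂ := φ₂))
  have h3 := mul_lt_mul_of_pos_left hs (by positivity : 0 < 2 * b)
  rw [excess, hd]
  nlinarith

/-- By repeated bisection, the excess beyond short chords is not positive. -/
theorem excess_le_cube_div_pow (ha : 0 < a) (hb : 0 < b) (hK : K ∈ Admissible a b)
    (hcl : IsClosed K) (hext : ∀ e ∈ Set.extremePoints ℝ K, ‖e‖ = b) (hθ : θ ≤ 2) (hρ0 : 0 ≤ ρ)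
    (hρ : 1 ≤ 2 * b * ρ * Real.cos (θ / 4) ^ 3) (N : ℕ) :
    ∀ φ₁ φ₂ : ℝ, φ₁ ≤ φ₂ → φ₂ - φ₁ ≤ θ → b • dir φ₁ ∈ K → b • dir φ₂ ∈ K →
      excess K b ρ φ₁ φ₂ ≤ b / 24 * (φ₂ - φ₁) ^ 3 / 4 ^ N := by
  have hπ := Real.pi_gt_three
  induction N with
  | zero =>
    intro φ₁ φ₂ h0 hφ hX hY
    rw [pow_zero, div_one]
    exact excess_le_cube ha hb hρ0 hK hcl h0 (hφ.trans hθ) hX hY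
      (excess_nonpos_of_forall hb hρ0 hK hcl hext le_rfl (by linarith)
        fun t ht => absurd ht (by simp))
  | succ N ih =>
    intro φ₁ φ₂ h0 hφ hX hY
    have hclE : IsClosed {t : ℝ | b • dir t ∈ K} := by
      refine hcl.preimage ?_
      have : dir = fun t => WithLp.toLp 2 ![Real.cos t, Real.sin t] := rfl
      rw [this]
      fun_prop
    obtain ⟨m, hm⟩ : ∃ m, m = (φ₁ + φ₂) / 2 := ⟨_, rfl⟩
    -- The midpoint of the arc need not belong to `K`. The nearest points of `K` on the arc on
    -- either side bound a gap of nonpositive excess, and each outer piece spans at most half the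
    -- angle.
    obtain ⟨M₁, ⟨⟨hM1, hM1m⟩, hM1K⟩, hM1max⟩ := (isCompact_Icc.inter_right hclE).exists_isGreatest
      (s := Set.Icc φ₁ m ∩ {t : ℝ | b • dir t ∈ K}) ⟨φ₁, ⟨le_rfl, by linarith⟩, hX⟩
    obtain ⟨M₂, ⟨⟨hM2m, hM2⟩, hM2K⟩, hM2min⟩ := (isCompact_Icc.inter_right hclE).exists_isLeast
      (s := Set.Icc m φ₂ ∩ {t : ℝ | b • dir t ∈ K}) ⟨φ₂, ⟨by linarith, le_rfl⟩, hY⟩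
    have e1 := excess_le_add ha hb hK hcl (by linarith) hρ0 hρ hM1 (by linarith) hφ hX hM1K hY
    have e2 := excess_le_add ha hb hK hcl (by linarith) hρ0 hρ (by linarith) hM2
      (by linarith) hM1K hM2K hY
    have e3 := excess_nonpos_of_forall (ρ := ρ) hb hρ0 hK hcl hext (hM1m.trans hM2m)
      (by linarith) (by
        rintro t ⟨ht1, ht2⟩ htK
        rcases le_total t m with h | h
        · exact (hM1max ⟨⟨by linarith, h⟩, htK⟩).not_gt ht1
        · exact (hM2min ⟨⟨h, by linarith⟩, htK⟩).not_gt ht2)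
    have e4 := ih φ₁ M₁ hM1 (by linarith) hX hM1K
    have e5 := ih M₂ φ₂ hM2 (by linarith) hM2K hY
    have hstep : ∀ x, 0 ≤ x → x ≤ (φ₂ - φ₁) / 2 →
        b / 24 * x ^ 3 / 4 ^ N ≤ b / 24 * ((φ₂ - φ₁) / 2) ^ 3 / 4 ^ N := by
      intro x hx hx2
      gcongr
    have s1 := hstep (M₁ - φ₁) (by linarith) (by linarith)
    have s2 := hstep (φ₂ - M₂) (by linarith) (by linarith)
    -- Two pieces of half the angle: the cubic bound drops by `2 * (1 / 2) ^ 3 = 1 / 4`.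
    have e6 : b / 24 * (φ₂ - φ₁) ^ 3 / 4 ^ (N + 1) =
        2 * (b / 24 * ((φ₂ - φ₁) / 2) ^ 3 / 4 ^ N) := by
      rw [pow_succ (4 : ℝ) N, mul_comm ((4 : ℝ) ^ N), ← div_div]; ring
    linarith

theorem excess_nonpos (ha : 0 < a) (hb : 0 < b) (hK : K ∈ Admissible a b)
    (hcl : IsClosed K) (hext : ∀ e ∈ Set.extremePoints ℝ K, ‖e‖ = b) (hθ : θ ≤ 2) (hρ0 : 0 ≤ ρ)
    (hρ : 1 ≤ 2 * b * ρ * Real.cos (θ / 4) ^ 3) (h0 : φ₁ ≤ φ₂) (hφ : φ₂ - φ₁ ≤ θ)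
    (hX : b • dir φ₁ ∈ K) (hY : b • dir φ₂ ∈ K) : excess K b ρ φ₁ φ₂ ≤ 0 := by
  refine ge_of_tendsto' (?_ : Filter.Tendsto
    (fun N : ℕ => b / 24 * (φ₂ - φ₁) ^ 3 / 4 ^ N) Filter.atTop (nhds 0)) fun N =>
      excess_le_cube_div_pow ha hb hK hcl hext hθ hρ0 hρ N φ₁ φ₂ h0 hφ hX hY
  exact tendsto_const_nhds.div_atTop (tendsto_pow_atTop_atTop_of_one_lt (by norm_num))

/-- An optimal set has no three points on a short arc of the outer circle. -/
theorem IsOptimal.dir_notMem (ha : 0 < a) (hb : 0 < b) (hK : IsOptimal a b lam K)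
    (hcl : IsClosed K) (hext : ∀ e ∈ Set.extremePoints ℝ K, ‖e‖ = b) (hθ : θ ≤ 2) (hρ0 : 0 ≤ ρ)
    (hρ : 1 ≤ 2 * b * ρ * Real.cos (θ / 4) ^ 3) (hρlam : ρ < lam)
    (haθ : a ≤ b * Real.cos (θ / 2)) {t : ℝ} (h1 : φ₁ < t) (h2 : t < φ₂) (hφ : φ₂ - φ₁ ≤ θ)
    (hX : b • dir φ₁ ∈ K) (hY : b • dir φ₂ ∈ K) : b • dir t ∉ K := by
  intro ht
  have hπ := Real.pi_gt_three
  have hex := excess_nonpos ha hb hK.1 hcl hext hθ hρ0 hρ (h1.trans h2).le hφ hX hY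
  have harea := arcArea_add_le hb hK.1 hcl h1 h2 (by linarith) hX ht hY
  have hpos := abs_pos.2 (cross_dir_ne_zero hb h1 h2 (by linarith))
  have hn1 := arcArea_nonneg (K := K) (b := b) (φ₁ := φ₁) (φ₂ := t)
  have hn2 := arcArea_nonneg (K := K) (b := b) (φ₁ := t) (φ₂ := φ₂)
  have hL := chordDist_left b φ₁ φ₂
  have hR := chordDist_right b φ₁ φ₂
  rw [chordDist, sub_eq_zero] at hL hR
  -- The hypothesis `haθ` keeps `D_a` behind the chord, so the cap may be cut off.
  have hcut : lam * arcArea K b φ₁ φ₂ ≤ arcLength K b φ₁ φ₂ - dist (b • dir φ₁) (b • dir φ₂) := by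
    refine hK.capArea_le ha hb hcl (fun h => by simpa [h] using norm_dir ((φ₁ + φ₂) / 2)) hX hY
      hL hR fun k hk => ?_
    rw [mem_closedBall_zero_iff] at hk
    have e1 := real_inner_le_norm (dir ((φ₁ + φ₂) / 2)) k
    rw [norm_dir, one_mul] at e1
    have e2 : Real.cos (θ / 2) ≤ Real.cos ((φ₂ - φ₁) / 2) :=
      Real.cos_le_cos_of_nonneg_of_le_pi (by linarith) (by linarith) (by linarith)
    have := mul_le_mul_of_nonneg_left e2 hb.le
    linarith
  -- A third point would put a nondegenerate triangle into the cap; then `lam * A ≤ L - |XY| ≤ ρ *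
  -- A` contradicts `ρ < lam`.
  have hA : 0 < arcArea K b φ₁ φ₂ := by linarith
  rw [excess] at hex
  nlinarith

/-- All conditions are strict at `θ = 0`, where `2 * b * lam > 1` leaves room for `ρ`. The weight is
the least one allowed, `1 / (2 * b * cos (θ / 4) ^ 3)`. -/
theorem exists_short_angle (ha : 0 < a) (hab : a < b) (hlam : 1 < 2 * b * lam) :
    ∃ θ ρ : ℝ, 0 < θ ∧ θ ≤ 2 ∧ 0 ≤ ρ ∧ 1 ≤ 2 * b * ρ * Real.cos (θ / 4) ^ 3 ∧ ρ < lam ∧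
      a ≤ b * Real.cos (θ / 2) := by
  have hb : 0 < b := ha.trans hab
  have c1 : Continuous fun θ : ℝ => 2 * b * lam * Real.cos (θ / 4) ^ 3 := by fun_prop
  have c2 : Continuous fun θ : ℝ => b * Real.cos (θ / 2) := by fun_prop
  have c3 : Continuous fun θ : ℝ => Real.cos (θ / 4) := by fun_prop
  have t1 := (c1.tendsto 0).eventually_const_lt (u := 1) (by simpa using hlam)
  have t2 := (c2.tendsto 0).eventually_const_lt (u := a) (by simpa using hab)
  have t3 := (c3.tendsto 0).eventually_const_lt (u := 0) (by simp)
  have t4 : ∀ᶠ θ : ℝ in nhds 0, θ < 2 := eventually_lt_nhds two_pos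
  obtain ⟨θ, ⟨h1, h2, h3, h4⟩, h0⟩ := ((Filter.Eventually.filter_mono
    (nhdsWithin_le_nhds (s := Set.Ioi 0)) (t1.and (t2.and (t3.and t4)))).and
      self_mem_nhdsWithin).exists
  have hc : 0 < 2 * b * Real.cos (θ / 4) ^ 3 := by positivity
  refine ⟨θ, 1 / (2 * b * Real.cos (θ / 4) ^ 3), h0, h4.le, by positivity, ?_, ?_, h2.le⟩
  · rw [show 2 * b * (1 / (2 * b * Real.cos (θ / 4) ^ 3)) * Real.cos (θ / 4) ^ 3 =
      (1 / (2 * b * Real.cos (θ / 4) ^ 3)) * (2 * b * Real.cos (θ / 4) ^ 3) by ring,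
      one_div_mul_cancel hc.ne']
  · rw [div_lt_iff₀ hc]; linarith

/-- Half-open cells of length `θ` contain at most two points each, and finitely many cells meet a
bounded interval. -/
theorem finite_of_no_three {F : Set ℝ} {θ c d : ℝ} (hθ : 0 < θ) (hF : F ⊆ Set.Icc c d)
    (h : ∀ x ∈ F, ∀ y ∈ F, ∀ z ∈ F, x < y → y < z → θ < z - x) : F.Finite := by
  have hmono : Monotone fun x : ℝ => ⌊x / θ⌋ := fun x y hxy => Int.floor_mono (by gcongr)
  refine Set.Finite.of_finite_fibers (fun x : ℝ => ⌊x / θ⌋)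
    ((Set.finite_Icc ⌊c / θ⌋ ⌊d / θ⌋).subset ?_) fun n _ => ?_
  · rintro _ ⟨x, hx, rfl⟩
    exact ⟨hmono (hF hx).1, hmono (hF hx).2⟩
  · by_contra hinf
    obtain ⟨s, hs, hcard⟩ := Set.Infinite.exists_subset_card_eq hinf 3
    set f := s.orderEmbOfFin hcard
    have hf : ∀ i, f i ∈ F ∧ ⌊f i / θ⌋ = n := fun i => hs (s.orderEmbOfFin_mem hcard i)
    have h3 := h (f 0) (hf 0).1 (f 1) (hf 1).1 (f 2) (hf 2).1
      (f.lt_iff_lt.2 (by decide)) (f.lt_iff_lt.2 (by decide))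
    have h4 := Int.lt_floor_add_one (f 2 / θ)
    have h5 := Int.floor_le (f 0 / θ)
    rw [(hf 2).2, div_lt_iff₀ hθ] at h4
    rw [(hf 0).2, le_div_iff₀ hθ] at h5
    nlinarith

/-- An optimal set has finitely many extreme points if they all lie on the outer circle. -/
theorem IsOptimal.finite_extremePoints (ha : 0 < a) (hab : a < b) (hlam : 1 < 2 * b * lam)
    (hK : IsOptimal a b lam K) (hcl : IsClosed K)
    (hext : ∀ e ∈ Set.extremePoints ℝ K, ‖e‖ = b) : (Set.extremePoints ℝ K).Finite := by
  have hb : 0 < b := ha.trans hab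
  obtain ⟨θ, ρ, hθ0, hθ, hρ0, hρ, hρlam, haθ⟩ := exists_short_angle ha hab hlam
  have hfin : (Set.Icc (-Real.pi) Real.pi ∩ {t : ℝ | b • dir t ∈ K}).Finite := by
    refine finite_of_no_three hθ0 Set.inter_subset_left fun x hx y hy z hz hxy hyz => ?_
    by_contra! hle
    exact hK.dir_notMem ha hb hcl hext hθ hρ0 hρ hρlam haθ hxy hyz hle hx.2 hz.2 hy.2
  refine (hfin.image fun t => b • dir t).subset fun e he => ?_
  obtain ⟨t, ht, rfl⟩ := sphere_subset_arc b hb (mem_sphere_zero_iff_norm.2 (hext e he))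
  exact ⟨t, ⟨ht, he.1⟩, rfl⟩

end Finite

/-! ### Passage to the closure, sides and the inscribed polygon -/

section Polygon

variable {a b lam : ℝ} {K : Set Plane} {P Q : Plane}

theorem frontier_closure_of_admissible (ha : 0 < a) (hK : K ∈ Admissible a b) :
    frontier (closure K) = frontier K := by
  rw [frontier, frontier, closure_closure,
    hK.1.interior_closure_eq_interior_of_nonempty_interior (interior_nonempty_of_admissible ha hK)]

/-- The boundary of a convex set has area zero and, with interior points present, does not change
under closure. So closedness, assumed in all comparisons above, costs nothing. -/
theorem IsOptimal.closure (ha : 0 < a) (hK : IsOptimal a b lam K) :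
    IsOptimal a b lam (closure K) := by
  refine ⟨⟨hK.1.1.closure, hK.1.2.1.trans subset_closure,
    closure_minimal hK.1.2.2 isClosed_closedBall⟩, fun K' hK' => ?_⟩
  have h := hK.2 K' hK'
  rwa [J, area, perimeter, frontier_closure_of_admissible ha hK.1,
    measure_closure_of_null_frontier (hK.1.1.addHaar_frontier volume)]

theorem isSide_closure (ha : 0 < a) (hK : K ∈ Admissible a b) :
    IsSide (closure K) P Q ↔ IsSide K P Q := by
  rw [IsSide, IsSide, frontier_closure_of_admissible ha hK]

theorem IsSide.symm (h : IsSide K P Q) : IsSide K Q P := by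
  rw [IsSide, segment_symm ℝ Q P]
  exact ⟨h.1.symm, h.2⟩

theorem exists_smul_eq_of_inner_eq_zero {n d w : Plane} (hn : n ≠ 0) (hd : d ≠ 0)
    (h1 : inner ℝ n d = 0) (h2 : inner ℝ n w = 0) : ∃ r : ℝ, w = r • d := by
  have hn0 := norm_pos_iff.2 hn
  have hd0 := norm_pos_iff.2 hd
  have hc : cross d w = 0 := by
    have h3 : ‖n‖ ^ 2 * cross d w = 0 := by
      rw [inner_eq] at h1 h2
      rw [norm_sq_eq, cross]
      linear_combination (n 0 * w 1 - n 1 * w 0) * h1 + (n 1 * d 0 - n 0 * d 1) * h2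
    exact (mul_eq_zero.1 h3).resolve_left (by positivity)
  have hw : ‖d‖ ^ 2 • w = inner ℝ d w • d := by
    rw [norm_sq_eq, inner_eq]
    rw [cross] at hc
    apply plane_ext <;> simp only [PiLp.smul_apply, smul_eq_mul]
    · linear_combination (-(d 1)) * hc
    · linear_combination (d 0) * hc
  refine ⟨(‖d‖ ^ 2)⁻¹ * inner ℝ d w, ?_⟩
  rw [mul_smul, ← hw, inv_smul_smul₀ (by positivity)]

/-- The endpoints of a side of a closed convex set are extreme points. -/
theorem IsSide.left_mem_extremePoints (hc : Convex ℝ K) (hcl : IsClosed K)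
    (hi : (interior K).Nonempty) (h : IsSide K P Q) : P ∈ Set.extremePoints ℝ K := by
  obtain ⟨hPQ, hseg, hmax⟩ := h
  have hP := hcl.frontier_subset (hseg (left_mem_segment ℝ P Q))
  have hQ := hcl.frontier_subset (hseg (right_mem_segment ℝ P Q))
  obtain ⟨n, hn, hnK⟩ := exists_normal hc hi (hseg (midpoint_mem_segment P Q))
  have hmid : inner ℝ n (midpoint ℝ P Q) = (inner ℝ n P + inner ℝ n Q) / 2 := by
    rw [midpoint_eq_smul_add, real_inner_smul_right, inner_add_right, invOf_eq_inv]; ring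
  rw [hmid] at hnK
  have h1 := hnK P hP
  have h2 := hnK Q hQ
  have hPQn : inner ℝ n Q = inner ℝ n P := by linarith
  have hnP : ∀ k ∈ K, inner ℝ n k ≤ inner ℝ n P := fun k hk => by linarith [hnK k hk]
  -- A point of `K` on the line beyond `P` would lengthen the side, against its maximality.
  have key : ∀ r : ℝ, P + r • (Q - P) ∈ K → 0 ≤ r := by
    intro r hr
    by_contra! hr0
    have hsub : segment ℝ (P + r • (Q - P)) Q ⊆ frontier K := fun k hk => by
      refine mem_frontier_of_inner_max hn (hc.segment_subset hr hQ hk) fun j hj => ?_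
      obtain ⟨s, t, _, _, hst, rfl⟩ := hk
      rw [inner_add_right, real_inner_smul_right, real_inner_smul_right, inner_add_right,
        real_inner_smul_right, inner_sub_right, hPQn, sub_self, mul_zero, add_zero, ← add_mul, hst,
        one_mul]
      exact hnP j hj
    have hPmem : P ∈ segment ℝ (P + r • (Q - P)) Q := by
      refine ⟨1 / (1 - r), -r / (1 - r), div_nonneg zero_le_one (by linarith),
        div_nonneg (by linarith) (by linarith), ?_, ?_⟩
      · rw [← add_div, ← sub_eq_add_neg, div_self (by linarith)]
      · have e : P + r • (Q - P) = (1 - r) • P + r • Q := by module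
        rw [e, smul_add, smul_smul, smul_smul, one_div_mul_cancel (by linarith), one_smul,
          add_assoc, ← add_smul, one_div_mul_eq_div, neg_div, add_neg_cancel, zero_smul, add_zero]
    have heq := hmax _ _ ((convex_segment _ _).segment_subset hPmem (right_mem_segment ℝ _ _)) hsub
    have hmem : P + r • (Q - P) ∈ segment ℝ P Q := heq ▸ left_mem_segment ℝ _ _
    rw [segment_eq_image'] at hmem
    obtain ⟨t, ht, hteq⟩ := hmem
    have h3 := smul_left_injective ℝ (sub_ne_zero.2 hPQ.symm) (add_left_cancel hteq)
    rw [← h3] at hr0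
    linarith [ht.1]
  refine mem_extremePoints.2 ⟨hP, fun u hu v hv ⟨s, t, hs, ht, hst, he⟩ => ?_⟩
  have hne : inner ℝ n P = s * inner ℝ n u + t * inner ℝ n v := by
    rw [← he, inner_add_right, real_inner_smul_right, real_inner_smul_right]
  have hu1 := hnP u hu
  have hv1 := hnP v hv
  obtain rfl : s = 1 - t := by linarith
  have hue : inner ℝ n u = inner ℝ n P := by nlinarith
  have hve : inner ℝ n v = inner ℝ n P := by nlinarith
  have hd : inner ℝ n (Q - P) = 0 := by rw [inner_sub_right, hPQn, sub_self]
  obtain ⟨α, hα⟩ := exists_smul_eq_of_inner_eq_zero (w := u - P) hn (sub_ne_zero.2 hPQ.symm) hd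
    (by rw [inner_sub_right, hue, sub_self])
  obtain ⟨β, hβ⟩ := exists_smul_eq_of_inner_eq_zero (w := v - P) hn (sub_ne_zero.2 hPQ.symm) hd
    (by rw [inner_sub_right, hve, sub_self])
  rw [sub_eq_iff_eq_add'] at hα hβ
  subst hα hβ
  -- Both `u` and `v` lie on the line of the side at nonnegative parameters whose weighted mean is
  -- `0`, so both parameters vanish.
  have hα0 := key α hu
  have hβ0 := key β hv
  have hz : ((1 - t) * α + t * β) • (Q - P) = 0 := by
    rw [← sub_eq_zero] at he
    rw [← he]; module
  have hz' := (smul_eq_zero.1 hz).resolve_right (sub_ne_zero.2 hPQ.symm)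
  have hα' : α = 0 := by nlinarith [mul_nonneg hs.le hα0, mul_nonneg ht.le hβ0]
  have hβ' : β = 0 := by nlinarith [mul_nonneg hs.le hα0, mul_nonneg ht.le hβ0]
  simp [hα', hβ']

theorem IsOptimal.isInscribedPolygon (ha : 0 < a) (hab : a < b) (hlam : lam * (a + b) < 1)
    (hlam' : 1 < 2 * b * lam) (hK : IsOptimal a b lam K) : IsInscribedPolygon b K := by
  have hb : 0 < b := ha.trans hab
  have hlam0 : 0 < lam := pos_of_mul_pos_right (zero_lt_one.trans hlam') (by positivity)
  have hC := hK.closure ha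
  have hext : ∀ e ∈ Set.extremePoints ℝ (_root_.closure K), ‖e‖ = b := fun e he =>
    norm_eq_of_mem_extremePoints ha hab hlam0 hlam hC isClosed_closure he
  have hfin := hC.finite_extremePoints ha hab hlam' isClosed_closure hext
  refine ⟨hfin.toFinset, fun v hv => hext v (hfin.mem_toFinset.1 hv), ?_⟩
  rw [hfin.coe_toFinset, ← (hfin.isCompact_convexHull ℝ).isClosed.closure_eq]
  exact (closure_convexHull_extremePoints (Metric.isCompact_of_isClosed_isBounded isClosed_closure
    (isBounded_closedBall.subset hC.1.2.2)) hC.convex).symm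

theorem IsOptimal.norm_left_eq (ha : 0 < a) (hab : a < b) (hlam0 : 0 < lam)
    (hlam : lam * (a + b) < 1) (hK : IsOptimal a b lam K) (h : IsSide K P Q) : ‖P‖ = b :=
  have hC := hK.closure ha
  norm_eq_of_mem_extremePoints ha hab hlam0 hlam hC isClosed_closure
    (((isSide_closure ha hK.1).2 h).left_mem_extremePoints hC.convex isClosed_closure
      (interior_nonempty_of_admissible ha hC.1))

theorem IsOptimal.lt_norm_of_mem_frontier (ha : 0 < a) (hab : a < b) (hlam0 : 0 < lam)
    (hlam : lam * (a + b) < 1) (hK : IsOptimal a b lam K) {k : Plane} (hk : k ∈ frontier K) :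
    a < ‖k‖ := by
  rw [← frontier_closure_of_admissible ha hK.1] at hk
  refine lt_of_le_of_ne ?_
    (norm_ne_of_mem_frontier ha hab hlam0 hlam (hK.closure ha) isClosed_closure hk).symm
  by_contra! hlt
  exact hk.2 (interior_mono (hK.closure ha).1.2.1
    (ball_subset_interior_closedBall (mem_ball_zero_iff.2 hlt)))

end Polygon

end ConvexRing

end

theorem proposition3p4 (a b lam : ℝ) (ha : 0 < a) (hab : a < b)
    (hlam₁ : 1 / (2 * b) < lam) (hlam₂ : lam < 1 / (a + b))
    (K : Set ConvexRing.Plane) (hK : ConvexRing.IsOptimal a b lam K) :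
    ConvexRing.classLab a b K = ∅ ∧
    ConvexRing.classLa a b K = ∅ ∧
    (∀ P Q T : ConvexRing.Plane, ConvexRing.IsSide K P Q → ¬ ConvexRing.IsTangentAt a P Q T) ∧
    ConvexRing.IsInscribedPolygon b K ∧
    (∀ P Q : ConvexRing.Plane, ConvexRing.IsSide K P Q →
      ‖P‖ = b ∧ ‖Q‖ = b ∧ Disjoint (segment ℝ P Q) (Metric.closedBall (0 : ConvexRing.Plane) a)) := by
  have hb : 0 < b := ha.trans hab
  have hlam0 : 0 < lam := lt_trans (by positivity) hlam₁
  rw [div_lt_iff₀ (by positivity)] at hlam₁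
  rw [lt_div_iff₀ (by positivity)] at hlam₂
  have hfr : ∀ k ∈ frontier K, a < ‖k‖ := fun k hk =>
    hK.lt_norm_of_mem_frontier ha hab hlam0 hlam₂ hk
  have htan : ∀ P Q T : ConvexRing.Plane, ConvexRing.IsSide K P Q →
      ¬ ConvexRing.IsTangentAt a P Q T := fun P Q T hside hT =>
    (hfr T (hside.2.1 hT.1)).ne' hT.2.1
  refine ⟨?_, ?_, htan, hK.isInscribedPolygon ha hab hlam₂ (by linarith), fun P Q hside =>
    ⟨hK.norm_left_eq ha hab hlam0 hlam₂ hside, hK.norm_left_eq ha hab hlam0 hlam₂ hside.symm, ?_⟩⟩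
  · exact Set.eq_empty_of_forall_notMem fun S ⟨P, Q, T, hside, hT, _⟩ => htan P Q T hside hT
  · exact Set.eq_empty_of_forall_notMem fun S ⟨P, Q, T, hside, hT, _⟩ => htan P Q T hside hT
  · rw [Set.disjoint_left]
    intro k hk hka
    exact (hfr k (hside.2.1 hk)).not_ge (mem_closedBall_zero_iff.1 hka)
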